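/- Let $D\ge 1$. On tempered distributions $\psi$ on $\mathbb{R}^D$ let $\hat q^\mu$ be multiplication by $x^\mu$, $\hat p^\mu=-i\,\partial/\partial x^\mu$, $\hat q^2=\sum_\mu\hat q^\mu\hat q^\mu$, $\hat p^2=\sum_\mu\hat p^\mu\hat p^\mu$, and $$H=\tfrac{i}{2}\sum_\mu(\hat q^\mu\hat p^\mu+\hat p^\mu\hat q^\mu),\qquad C_{(2)}=\tfrac12(\hat p^2\hat q^2+\hat q^2\hat p^2)+H^2 .$$ For $\beta\in\mathbb{C}$ let $H_\beta=\hat p^{2\beta}\hat q^{2\beta}$, where $\hat q^{2\beta}$ is multiplication by $(x^2)^\beta$ and $\hat p^{2\beta}$ is multiplication by $(k^2)^\beta$ in the momentum representation. The equation $H_\beta\psi=\tau\psi$ is understood in the generalized sense: $\langle\psi,\hat q^{2\beta}\hat p^{2\beta}\varphi\rangle=\tau\,\langle\psi,\varphi\rangle$ (bilinear pairing) for all Schwartz functions $\varphi$ for which $\chi=\hat p^{2\beta}\varphi$ and $\hat q^{2\beta}\chi$ are Schwartz functions. Let $\psi_{j,\nu}\ne0$ be a tempered distribution with $$H\psi_{j,\nu}=-2i\nu\,\psi_{j,\nu},\qquad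 C_{(2)}\psi_{j,\nu}=4j(j-1)\,\psi_{j,\nu},\qquad \nu,j\in\mathbb{R},$$ where $j\ge\frac12$, that is, $j$ is the larger of the two roots $j$, $1-j$ that give the same Casimir eigenvalue. If $D\ge2$ set $J=j$. Whenever $\psi_{j,\nu}$ is also an eigenvector of $H_\beta$, $H_\beta\psi_{j,\nu}=\tau_{j,\nu}(\beta)\,\psi_{j,\nu}$, the number $J+\beta-i\nu$ is not a pole of $\Gamma$, and $$\tau_{j,\nu}(\beta)=4^\beta\,\frac{\Gamma(J+\beta-i\nu)\,\Gamma(J+i\nu)}{\Gamma(J-\beta+i\nu)\,\Gamma(J-i\nu)}$$ (understood as $0$ when $J-\beta+i\nu$ is a pole of $\Gamma$). If $\psi_{j,\nu}$ is moreover an eigenvector of $H_{\beta-1}$ with eigenvalue $\tau_{j,\nu}(\beta-1)$, then $$\tau_{j,\nu}(\beta)=4\,(J+i\nu-\beta)(J-1+\beta-i\nu)\,\tau_{j,\nu}(\beta-1).$$ If $D=1$, the same holds for at least one of the two choices $J=j$, $J=1-j$, the choice being the same for all $\beta$. -/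

import Mathlib

open scoped SchwartzMap FourierTransform

noncomputable section

namespace LadderOperators

/-- The `D`-dimensional Euclidean coordinate space. -/
abbrev Space (D : ℕ) := EuclideanSpace ℝ (Fin D)

/-- The states: tempered distributions `ψ(x) = ⟨x|ψ⟩` on Euclidean space. Common eigenvectors of the
operators below are not square integrable, they are generalized eigenvectors. -/
abbrev State (D : ℕ) := 𝓢'(Space D, ℂ)

/-- The coordinate operator `q^μ`: multiplication by the coordinate `x^μ`. -/
def position {D : ℕ} (μ : Fin D) : State D →L[ℂ] State D :=
  TemperedDistribution.smulLeftCLM ℂ (fun x : Space D => ((x μ : ℝ) : ℂ))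

/-- The momentum operator `p^μ = -i ∂/∂x^μ`. -/
def momentum {D : ℕ} (μ : Fin D) : State D →L[ℂ] State D :=
  (-Complex.I) • LineDeriv.lineDerivOpCLM ℂ (State D) (EuclideanSpace.single μ (1 : ℝ) : Space D)

/-- `q² = ∑_μ q^μ q^μ`. -/
def positionSq (D : ℕ) : State D →L[ℂ] State D :=
  ∑ μ : Fin D, (position μ).comp (position μ)

/-- `p² = ∑_μ p^μ p^μ`. -/
def momentumSq (D : ℕ) : State D →L[ℂ] State D :=
  ∑ μ : Fin D, (momentum μ).comp (momentum μ)

/-- The dilatation operator `H = (i/2) ∑_μ (q^μ p^μ + p^μ q^μ)`. -/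
def dilatation (D : ℕ) : State D →L[ℂ] State D :=
  (Complex.I / 2) •
    ∑ μ : Fin D, ((position μ).comp (momentum μ) + (momentum μ).comp (position μ))

/-- The quadratic Casimir operator `C = (p² q² + q² p²)/2 + H²` of the algebra `sl(2)` generated by
`q²`, `p²` and `H`. -/
def casimir (D : ℕ) : State D →L[ℂ] State D :=
  (1 / 2 : ℂ) • ((momentumSq D).comp (positionSq D) + (positionSq D).comp (momentumSq D)) +
    (dilatation D).comp (dilatation D)

/-- `χ = q^{2β} φ` for Schwartz functions: `χ(x) = (x²)^β φ(x)` for all `x ≠ 0`. -/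
def IsPositionPow {D : ℕ} (β : ℂ) (φ χ : 𝓢(Space D, ℂ)) : Prop :=
  ∀ x : Space D, x ≠ 0 → χ x = ((‖x‖ ^ 2 : ℝ) : ℂ) ^ β * φ x

/-- `χ = p^{2β} φ` for Schwartz functions: in the momentum representation `p^{2β}` is multiplication
by `(k²)^β`, where `k ≠ 0`. The Fourier transform used here has the kernel `exp(-2πi ⟨x, ξ⟩)`, so that
the momentum is `k = 2πξ`. -/
def IsMomentumPow {D : ℕ} (β : ℂ) (φ χ : 𝓢(Space D, ℂ)) : Prop :=
  ∀ ξ : Space D, ξ ≠ 0 → 𝓕 χ ξ = ((‖(2 * Real.pi) • ξ‖ ^ 2 : ℝ) : ℂ) ^ β * 𝓕 φ ξ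

/-- `H_β ψ = t ψ` for `H_β = p^{2β} q^{2β}`, in the sense of generalized eigenvectors. With respect to
the bilinear pairing `∫ ψ(x) φ(x) dx` both `q^{2β}` and `p^{2β}` are symmetric, so the transpose of `H_β`
is `q^{2β} p^{2β}`, and the equation says that `ψ (q^{2β} p^{2β} φ) = t * ψ φ` for every Schwartz
function `φ` for which `χ = p^{2β} φ` and `η = q^{2β} χ` are Schwartz functions. -/
def IsEigen {D : ℕ} (β t : ℂ) (ψ : State D) : Prop :=
  ∀ φ χ η : 𝓢(Space D, ℂ), IsMomentumPow β φ χ → IsPositionPow β χ η → ψ η = t * ψ φ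

/-- The function `4^β Γ(j+β-iν) Γ(j+iν) / (Γ(j-β+iν) Γ(j-iν))`. A pole of a Gamma function in the
denominator counts as a zero of the quotient, which is what `Complex.Gamma` and division give. -/
def tau (j ν : ℝ) (β : ℂ) : ℂ :=
  4 ^ β * (Complex.Gamma (j + β - Complex.I * ν) * Complex.Gamma (j + Complex.I * ν)) /
    (Complex.Gamma (j - β + Complex.I * ν) * Complex.Gamma (j - Complex.I * ν))

end LadderOperators

end

/-! ### Test functions `P(x) h(‖x‖²)` and the action of the dilatation and Casimir operators on them
-/

noncomputable section

namespace LadderOperators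

open MvPolynomial LineDeriv

variable {D : ℕ}

/-! Up to the shift D/2, H is the Euler operator. Hence ψ is homogeneous, and so is its inverse
Fourier transform, with ν replaced by -ν (`fourierInv_apply_euler_of_dilatation`). On test functions
P(x) g(‖x‖²), with P harmonic and homogeneous of degree n, homogeneity forces ψ to be a multiple of
the moment ∫ u^(κ-1) g(u) du over u > 0, where κ = J - iν and 2J = n + D/2 (`apply_radial_eq`). The
reason is that every g of zero moment has the form u h' + κ h on the half-line
(`exists_schwartz_ode`). The Casimir operator acts on these functions as the scalar 4J(J-1)
(`casimir_radial`). Since ψ ≠ 0 does not vanish on all of them (`exists_harmonic_apply_ne_zero`), J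
is j or 1-j. For D ≥ 2 one has J ≥ 1/2, which leaves J = j; for D = 1 the values J = 1/4 (even) and
J = 3/4 (odd) share one Casimir eigenvalue.

It remains to find one test function on which the eigenvalue equation can be evaluated for every
complex β. Take χ = P(x) f(‖x‖²), where f and the profile of 𝓕χ should both vanish to infinite order
at 0 and decay rapidly, so that all complex powers may be applied. This is achieved by f(u) = ∑ wᵢ
exp(-π aᵢ u), with aᵢ integral powers of q = e^(-ε) and weights built from the Taylor coefficients
of Euler's product ∏ (1 - q^k x), arranged so that 𝓕χ = (-i)^n χ.

The Mellin transform of f is M(s) = Γ(s) π^(-s) ω(s) with ω(s) = ω(2J - s) (`mellinSum_dualWeight`).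
The eigenvalue equation relates M(J - iν + β) to M(J + iν - β) (`mellinSum_eq_of_isEigen`). The two
arguments add up to 2J, so ω cancels and the quotient of Gamma functions remains. At s = -m a simple
zero of ω meets a simple pole of Γ, so that M(-m) ≠ 0 while M(2J + m) = 0; this rules out poles of τ
and gives τ = 0 where its denominator has a pole. The recursion in β is Γ(z+1) = zΓ(z). -/

/-- The standard basis vector of `Space D`. -/
abbrev basisVec (μ : Fin D) : Space D := EuclideanSpace.single μ (1 : ℝ)

/-- The complex valued function defined by a polynomial with complex coefficients. -/
def polyFun (Q : MvPolynomial (Fin D) ℂ) (x : Space D) : ℂ := eval (fun μ => ((x μ : ℝ) : ℂ)) Q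

theorem hasTemperateGrowth_coord (μ : Fin D) :
    (fun x : Space D => ((x μ : ℝ) : ℂ)).HasTemperateGrowth :=
  (Complex.ofRealCLM.comp (EuclideanSpace.proj μ : Space D →L[ℝ] ℝ)).hasTemperateGrowth

theorem hasTemperateGrowth_polyFun (Q : MvPolynomial (Fin D) ℂ) :
    (polyFun Q).HasTemperateGrowth := by
  induction Q using MvPolynomial.induction_on with
  | C a =>
    have : polyFun (D := D) (C a) = fun _ => a := by ext x; simp [polyFun]
    rw [this]; exact .const a
  | add p q hp hq =>
    have : polyFun (p + q) = polyFun p + polyFun q := by ext x; simp [polyFun]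
    rw [this]; exact hp.add hq
  | mul_X p μ hp =>
    have : polyFun (p * X μ) = polyFun p * fun x : Space D => ((x μ : ℝ) : ℂ) := by
      ext x; simp [polyFun]
    rw [this]; exact hp.mul (hasTemperateGrowth_coord μ)

theorem hasFDerivAt_coord (μ : Fin D) (x : Space D) :
    HasFDerivAt (fun x : Space D => ((x μ : ℝ) : ℂ))
      (Complex.ofRealCLM.comp (EuclideanSpace.proj μ : Space D →L[ℝ] ℝ)) x :=
  (Complex.ofRealCLM.comp (EuclideanSpace.proj μ : Space D →L[ℝ] ℝ)).hasFDerivAt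

theorem hasFDerivAt_polyFun (Q : MvPolynomial (Fin D) ℂ) (x : Space D) :
    ∃ L : Space D →L[ℝ] ℂ, HasFDerivAt (polyFun Q) L x ∧
      ∀ μ, L (basisVec μ) = polyFun (pderiv μ Q) x := by
  induction Q using MvPolynomial.induction_on with
  | C a =>
    have : polyFun (D := D) (C a) = fun _ => a := by ext x; simp [polyFun]
    rw [this]; exact ⟨0, hasFDerivAt_const a x, by simp [polyFun]⟩
  | add p q hp hq =>
    obtain ⟨L, hL, hL'⟩ := hp
    obtain ⟨M, hM, hM'⟩ := hq
    have : polyFun (p + q) = polyFun p + polyFun q := by ext x; simp [polyFun]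
    rw [this]; refine ⟨L + M, hL.add hM, fun μ => ?_⟩
    simp [hL', hM', polyFun]
  | mul_X p ν hp =>
    obtain ⟨L, hL, hL'⟩ := hp
    have : polyFun (p * X ν) = polyFun p * fun x : Space D => ((x ν : ℝ) : ℂ) := by
      ext x; simp [polyFun]
    rw [this]; refine ⟨_, hL.mul (hasFDerivAt_coord ν x), fun μ => ?_⟩
    simp [hL', polyFun, pderiv_X, Pi.single_apply, eq_comm]
    split_ifs <;> simp [mul_comm]

/-- Composition of a Schwartz function on the line with `x ↦ ‖x‖ ^ 2`. -/
def compNormSq (D : ℕ) : 𝓢(ℝ, ℂ) →L[ℂ] 𝓢(Space D, ℂ) :=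
  SchwartzMap.compCLM ℂ (g := fun x : Space D => ‖x‖ ^ 2)
    (Function.hasTemperateGrowth_norm_sq (Space D))
    ⟨1, 1, fun x => by
      simp only [norm_pow, norm_norm, pow_one, one_mul]
      nlinarith [sq_nonneg (‖x‖ - 1)]⟩

/-- The Schwartz function `x ↦ Q(x) h(‖x‖ ^ 2)`. -/
def radial (Q : MvPolynomial (Fin D) ℂ) (h : 𝓢(ℝ, ℂ)) : 𝓢(Space D, ℂ) :=
  SchwartzMap.smulLeftCLM ℂ (polyFun Q) (compNormSq D h)

theorem radial_apply (Q : MvPolynomial (Fin D) ℂ) (h : 𝓢(ℝ, ℂ)) (x : Space D) :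
    radial Q h x = polyFun Q x * h (‖x‖ ^ 2) := by
  rw [radial, SchwartzMap.smulLeftCLM_apply_apply (hasTemperateGrowth_polyFun Q)]; rfl

/-- Profiles matter only on the closed half-line. This permits profiles such as exp(-πbu), which are
not Schwartz on the whole line, to be replaced by Schwartz extensions. -/
theorem radial_congr (Q : MvPolynomial (Fin D) ℂ) {h₁ h₂ : 𝓢(ℝ, ℂ)}
    (h : ∀ u, 0 ≤ u → h₁ u = h₂ u) : radial Q h₁ = radial Q h₂ := by
  ext x; rw [radial_apply, radial_apply, h _ (by positivity)]

theorem radial_add_left (Q R : MvPolynomial (Fin D) ℂ) (h : 𝓢(ℝ, ℂ)) :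
    radial (Q + R) h = radial Q h + radial R h := by
  ext x; simp [radial_apply, polyFun, add_mul]

theorem radial_sub_left (Q R : MvPolynomial (Fin D) ℂ) (h : 𝓢(ℝ, ℂ)) :
    radial (Q - R) h = radial Q h - radial R h := by
  ext x; simp [radial_apply, polyFun, sub_mul]

theorem radial_smul_left (c : ℂ) (Q : MvPolynomial (Fin D) ℂ) (h : 𝓢(ℝ, ℂ)) :
    radial (c • Q) h = c • radial Q h := by
  ext x; simp [radial_apply, polyFun, mul_assoc]

theorem radial_zero_left (h : 𝓢(ℝ, ℂ)) : radial (0 : MvPolynomial (Fin D) ℂ) h = 0 := by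
  ext x; simp [radial_apply, polyFun]

theorem radial_sum_left {ι : Type*} (s : Finset ι) (Q : ι → MvPolynomial (Fin D) ℂ)
    (h : 𝓢(ℝ, ℂ)) : radial (∑ i ∈ s, Q i) h = ∑ i ∈ s, radial (Q i) h := by
  classical
  induction s using Finset.induction_on with
  | empty => simp [radial_zero_left]
  | insert a s ha ih => rw [Finset.sum_insert ha, Finset.sum_insert ha, radial_add_left, ih]

theorem radial_add_right (Q : MvPolynomial (Fin D) ℂ) (h₁ h₂ : 𝓢(ℝ, ℂ)) :
    radial Q (h₁ + h₂) = radial Q h₁ + radial Q h₂ := by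
  ext x; simp [radial_apply, mul_add]

theorem radial_sub_right (Q : MvPolynomial (Fin D) ℂ) (h₁ h₂ : 𝓢(ℝ, ℂ)) :
    radial Q (h₁ - h₂) = radial Q h₁ - radial Q h₂ := by
  ext x; simp [radial_apply, mul_sub]

theorem radial_smul_right (c : ℂ) (Q : MvPolynomial (Fin D) ℂ) (h : 𝓢(ℝ, ℂ)) :
    radial Q (c • h) = c • radial Q h := by
  ext x; simp [radial_apply]; ring

/-- Multiplication of a Schwartz function by a coordinate. -/
def mulCoord (μ : Fin D) : 𝓢(Space D, ℂ) →L[ℂ] 𝓢(Space D, ℂ) :=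
  SchwartzMap.smulLeftCLM ℂ (fun x : Space D => ((x μ : ℝ) : ℂ))

theorem mulCoord_apply (μ : Fin D) (f : 𝓢(Space D, ℂ)) (x : Space D) :
    mulCoord μ f x = (x μ : ℂ) * f x := by
  rw [mulCoord, SchwartzMap.smulLeftCLM_apply_apply (hasTemperateGrowth_coord μ)]; rfl

/-- The partial derivative of a Schwartz function. -/
def partialDeriv (μ : Fin D) : 𝓢(Space D, ℂ) →L[ℂ] 𝓢(Space D, ℂ) :=
  lineDerivOpCLM ℂ 𝓢(Space D, ℂ) (basisVec μ)

theorem partialDeriv_apply (μ : Fin D) (f : 𝓢(Space D, ℂ)) (x : Space D) :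
    partialDeriv μ f x = fderiv ℝ f x (basisVec μ) := by
  simp [partialDeriv, SchwartzMap.lineDerivOp_apply_eq_fderiv]

theorem mulCoord_radial (μ : Fin D) (Q : MvPolynomial (Fin D) ℂ) (h : 𝓢(ℝ, ℂ)) :
    mulCoord μ (radial Q h) = radial (X μ * Q) h := by
  ext x; simp [mulCoord_apply, radial_apply, polyFun, mul_assoc]

/-- The derivative of a Schwartz function on the line. -/
abbrev derivS : 𝓢(ℝ, ℂ) →L[ℂ] 𝓢(ℝ, ℂ) := SchwartzMap.derivCLM ℂ ℂ

theorem partialDeriv_radial (μ : Fin D) (Q : MvPolynomial (Fin D) ℂ) (h : 𝓢(ℝ, ℂ)) :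
    partialDeriv μ (radial Q h) =
      radial (pderiv μ Q) h + (2 : ℂ) • radial (X μ * Q) (derivS h) := by
  ext x
  obtain ⟨L, hL, hL'⟩ := hasFDerivAt_polyFun Q x
  have h1 : HasFDerivAt (fun x : Space D => ‖x‖ ^ 2) (2 • (innerSL ℝ x)) x :=
    (hasStrictFDerivAt_norm_sq x).hasFDerivAt
  have h2 := (h.hasDerivAt (‖x‖ ^ 2)).hasFDerivAt.comp x h1
  have h3 := hL.mul h2
  have h4 : (radial Q h : Space D → ℂ) = polyFun Q * (⇑h ∘ fun x : Space D => ‖x‖ ^ 2) := by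
    ext y; simp [radial_apply]
  rw [partialDeriv_apply, h4, h3.fderiv]
  simp [hL', radial_apply, polyFun, EuclideanSpace.inner_single_right]
  ring

/-- Multiplication of a Schwartz function on the line by the variable. -/
def mulVar : 𝓢(ℝ, ℂ) →L[ℂ] 𝓢(ℝ, ℂ) :=
  SchwartzMap.smulLeftCLM ℂ (fun u : ℝ => (u : ℂ))

theorem mulVar_apply (h : 𝓢(ℝ, ℂ)) (u : ℝ) : mulVar h u = u * h u := by
  rw [mulVar, SchwartzMap.smulLeftCLM_apply_apply Function.Complex.hasTemperateGrowth_ofReal]; rfl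

/-- The polynomial `∑ X_μ ^ 2`. -/
def rsq (D : ℕ) : MvPolynomial (Fin D) ℂ := ∑ μ, X μ * X μ

theorem polyFun_rsq (x : Space D) : polyFun (rsq D) x = ((‖x‖ ^ 2 : ℝ) : ℂ) := by
  rw [EuclideanSpace.norm_sq_eq]
  simp [polyFun, rsq, pow_two]

theorem radial_rsq_mul (Q : MvPolynomial (Fin D) ℂ) (h : 𝓢(ℝ, ℂ)) :
    radial (rsq D * Q) h = radial Q (mulVar h) := by
  ext x
  have : polyFun (rsq D * Q) x = polyFun (rsq D) x * polyFun Q x := by simp [polyFun]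
  rw [radial_apply, radial_apply, this, polyFun_rsq, mulVar_apply]
  ring

theorem derivS_mulVar (h : 𝓢(ℝ, ℂ)) : derivS (mulVar h) = h + mulVar (derivS h) := by
  ext u
  have h1 : (mulVar h : ℝ → ℂ) = fun u : ℝ => (u : ℂ) * h u := by ext u; exact mulVar_apply h u
  have h2 : HasDerivAt (fun u : ℝ => (u : ℂ)) 1 u := Complex.ofRealCLM.hasDerivAt
  have h3 := (h2.mul (h.hasDerivAt u)).deriv
  rw [SchwartzMap.derivCLM_apply, h1]
  change deriv (fun u : ℝ => (u : ℂ) * h u) u = _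
  have h3' : deriv (fun u : ℝ => (u : ℂ) * h u) u = _ := h3
  rw [h3']
  simp [mulVar_apply]

/-- The Euler operator `∑ x_μ ∂_μ`. -/
def euler (f : 𝓢(Space D, ℂ)) : 𝓢(Space D, ℂ) := ∑ μ, mulCoord μ (partialDeriv μ f)

/-- The Laplace operator on Schwartz functions. -/
def lapS (f : 𝓢(Space D, ℂ)) : 𝓢(Space D, ℂ) := ∑ μ, partialDeriv μ (partialDeriv μ f)

/-- Multiplication by `‖x‖ ^ 2`, as a sum over the coordinates. -/
def normSqS (f : 𝓢(Space D, ℂ)) : 𝓢(Space D, ℂ) := ∑ μ, mulCoord μ (mulCoord μ f)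

/-- The Laplace operator on polynomials. -/
def lap (Q : MvPolynomial (Fin D) ℂ) : MvPolynomial (Fin D) ℂ := ∑ μ, pderiv μ (pderiv μ Q)

theorem normSqS_radial (Q : MvPolynomial (Fin D) ℂ) (h : 𝓢(ℝ, ℂ)) :
    normSqS (radial Q h) = radial Q (mulVar h) := by
  rw [← radial_rsq_mul, normSqS, rsq, Finset.sum_mul, radial_sum_left]
  simp_rw [mulCoord_radial, mul_assoc]

theorem euler_radial {n : ℕ} {P : MvPolynomial (Fin D) ℂ} (hP : P.IsHomogeneous n)
    (h : 𝓢(ℝ, ℂ)) :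
    euler (radial P h) = radial P ((n : ℂ) • h + (2 : ℂ) • mulVar (derivS h)) := by
  simp_rw [euler, partialDeriv_radial, map_add, map_smul, mulCoord_radial]
  rw [Finset.sum_add_distrib, ← radial_sum_left, hP.sum_X_mul_pderiv, ← Finset.smul_sum]
  simp_rw [← mul_assoc]
  rw [← radial_sum_left, ← Finset.sum_mul, ← rsq, radial_rsq_mul, radial_add_right,
    radial_smul_right, radial_smul_right, ← Nat.cast_smul_eq_nsmul ℂ, radial_smul_left]

/-- Harmonicity removes the term without derivatives of `h`, and Euler's identity turns the cross
terms into multiples of `P`. What is left is an ordinary differential operator in u = ‖x‖². -/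
theorem lapS_radial {n : ℕ} {P : MvPolynomial (Fin D) ℂ} (hP : P.IsHomogeneous n)
    (hP' : lap P = 0) (h : 𝓢(ℝ, ℂ)) :
    lapS (radial P h) = radial P ((4 * n + 2 * D : ℂ) • derivS h
      + (4 : ℂ) • mulVar (derivS (derivS h))) := by
  have h1 : ∑ μ, pderiv μ (X μ * P) = (D : ℂ) • P + (n : ℂ) • P := by
    have : ∀ μ, pderiv μ (X μ * P) = P + X μ * pderiv μ P := fun μ => by
      rw [Derivation.leibniz]; simp [add_comm]
    simp_rw [this]
    rw [Finset.sum_add_distrib, hP.sum_X_mul_pderiv]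
    simp [← Nat.cast_smul_eq_nsmul ℂ]
  simp_rw [lapS, partialDeriv_radial, map_add, map_smul, partialDeriv_radial]
  simp_rw [Finset.sum_add_distrib, ← Finset.smul_sum, Finset.sum_add_distrib, ← Finset.smul_sum,
    ← radial_sum_left]
  simp_rw [← mul_assoc]
  rw [← lap, hP', radial_zero_left, hP.sum_X_mul_pderiv, h1, ← Finset.sum_mul, ← rsq,
    radial_rsq_mul]
  rw [radial_add_right, radial_add_left, radial_smul_left, radial_smul_left, radial_smul_right,
    radial_smul_right, ← Nat.cast_smul_eq_nsmul ℂ, radial_smul_left]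
  module

theorem mulCoord_partialDeriv_comm (μ : Fin D) (f : 𝓢(Space D, ℂ)) :
    partialDeriv μ (mulCoord μ f) = f + mulCoord μ (partialDeriv μ f) := by
  ext x
  have h1 : (mulCoord μ f : Space D → ℂ) = (fun x : Space D => ((x μ : ℝ) : ℂ)) * f := by
    ext y; exact mulCoord_apply μ f y
  have h2 := (hasFDerivAt_coord μ x).mul (f.hasFDerivAt x)
  rw [partialDeriv_apply, h1, h2.fderiv]
  simp [mulCoord_apply, partialDeriv_apply]
  ring

/-- On functions H is the Euler operator plus D/2; this symmetrized form is antisymmetric under the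
bilinear pairing, whence the minus sign. -/
theorem dilatation_apply (ψ : State D) (f : 𝓢(Space D, ℂ)) :
    dilatation D ψ f = -ψ (euler f + (D / 2 : ℂ) • f) := by
  have h1 : ∀ μ, (position μ (momentum μ ψ)) f = Complex.I * ψ (f + mulCoord μ (partialDeriv μ f)) := by
    intro μ
    rw [← mulCoord_partialDeriv_comm]
    simp only [position, momentum, TemperedDistribution.smulLeftCLM_apply_apply]
    simp only [mulCoord, partialDeriv]
    simp [TemperedDistribution.lineDerivOp_apply_apply]
  have h2 : ∀ μ, (momentum μ (position μ ψ)) f = Complex.I * ψ (mulCoord μ (partialDeriv μ f)) := by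
    intro μ
    simp only [position, momentum]
    simp [TemperedDistribution.lineDerivOp_apply_apply,
      TemperedDistribution.smulLeftCLM_apply_apply, mulCoord, partialDeriv]
  simp only [dilatation, euler]
  simp [h1, h2, map_sum, map_add, ← Finset.mul_sum, Finset.sum_add_distrib]
  linear_combination (D * ψ f / 2 + ∑ μ, ψ (mulCoord μ (partialDeriv μ f))) * Complex.I_mul_I

theorem positionSq_apply (ψ : State D) (f : 𝓢(Space D, ℂ)) :
    positionSq D ψ f = ψ (normSqS f) := by
  simp [positionSq, normSqS, position, mulCoord, TemperedDistribution.smulLeftCLM_apply_apply]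

theorem momentumSq_apply (ψ : State D) (f : 𝓢(Space D, ℂ)) :
    momentumSq D ψ f = -ψ (lapS f) := by
  have : ∀ μ, momentum μ (momentum μ ψ) f = - ψ (partialDeriv μ (partialDeriv μ f)) := by
    intro μ
    simp [momentum, partialDeriv, TemperedDistribution.lineDerivOp_apply_apply]
    rw [← mul_assoc, Complex.I_mul_I]; ring
  simp [momentumSq, lapS, this]

/-- In the variable u all three terms are second order operators on the profile; the parts
containing h' and h'' cancel and a scalar depending only on n + D/2 survives. -/
theorem casimir_radial (ψ : State D) {n : ℕ} {P : MvPolynomial (Fin D) ℂ}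
    (hP : P.IsHomogeneous n) (hP' : lap P = 0) (h : 𝓢(ℝ, ℂ)) :
    casimir D ψ (radial P h) = ((n + D / 2 : ℂ) * (n + D / 2 - 2)) * ψ (radial P h) := by
  have h1 : (momentumSq D (positionSq D ψ)) (radial P h) =
      - ψ (normSqS (lapS (radial P h))) := by
    rw [momentumSq_apply, positionSq_apply]
  have h2 : (positionSq D (momentumSq D ψ)) (radial P h) =
      - ψ (lapS (normSqS (radial P h))) := by
    rw [positionSq_apply, momentumSq_apply]
  have h3 : (dilatation D (dilatation D ψ)) (radial P h) =
      ψ (euler (euler (radial P h) + (D / 2 : ℂ) • radial P h)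
        + (D / 2 : ℂ) • (euler (radial P h) + (D / 2 : ℂ) • radial P h)) := by
    rw [dilatation_apply, dilatation_apply, neg_neg]
  rw [lapS_radial hP hP', normSqS_radial] at h1
  rw [normSqS_radial, lapS_radial hP hP'] at h2
  rw [euler_radial hP, ← radial_smul_right, ← radial_add_right, euler_radial hP,
    ← radial_smul_right, ← radial_add_right] at h3
  have h4 : casimir D ψ (radial P h) = (1 / 2 : ℂ) *
      ((momentumSq D (positionSq D ψ)) (radial P h) + (positionSq D (momentumSq D ψ)) (radial P h))
      + (dilatation D (dilatation D ψ)) (radial P h) := by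
    simp [casimir, mul_add]
  rw [h4, h1, h2, h3]
  simp only [map_add, map_smul, derivS_mulVar, radial_add_right, radial_smul_right, smul_eq_mul]
  ring

end LadderOperators

end

/-! ### Moments on the half-line and the equation u h' + κ h = g -/

noncomputable section

namespace LadderOperators

open MvPolynomial LineDeriv MeasureTheory Set Filter Topology
open scoped ContDiff

/-- A smooth function on the line which decays rapidly on the positive half-line agrees there with a
Schwartz function. -/
theorem exists_schwartz_eqOn {f : ℝ → ℂ} (hf : ContDiff ℝ ∞ f)
    (hd : ∀ k n : ℕ, ∃ C : ℝ, ∀ u : ℝ, 0 ≤ u → ‖u‖ ^ k * ‖iteratedDeriv n f u‖ ≤ C) :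
    ∃ H : 𝓢(ℝ, ℂ), ∀ u : ℝ, -1 < u → H u = f u := by
  -- This cutoff is 0 for u ≤ -2 and 1 for u ≥ -1, so the two functions agree near every point of
  -- the closed half-line, with all derivatives.
  set s : ℝ → ℝ := fun u => Real.smoothTransition (u + 2) with hs
  have hsm : ContDiff ℝ ∞ s := Real.smoothTransition.contDiff.comp (contDiff_id.add contDiff_const)
  have hF : ContDiff ℝ ∞ (fun u => s u • f u) := hsm.smul hf
  have heq : ∀ u : ℝ, -1 < u → (fun u => s u • f u) =ᶠ[𝓝 u] f := by
    intro u hu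
    filter_upwards [lt_mem_nhds hu] with v hv
    simp [hs, Real.smoothTransition.one_of_one_le (show 1 ≤ v + 2 by linarith)]
  have hzero : ∀ u : ℝ, u < -2 → (fun u => s u • f u) =ᶠ[𝓝 u] fun _ => 0 := by
    intro u hu
    filter_upwards [gt_mem_nhds hu] with v hv
    simp [hs, Real.smoothTransition.zero_of_nonpos (show v + 2 ≤ 0 by linarith)]
  refine ⟨⟨fun u => s u • f u, hF, fun k n => ?_⟩, fun u hu => (heq u hu).eq_of_nhds⟩
  obtain ⟨C, hC⟩ := hd k n
  have hcont : Continuous fun u : ℝ => ‖u‖ ^ k * ‖iteratedDeriv n (fun u => s u • f u) u‖ :=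
    (continuous_norm.pow k).mul (hF.continuous_iteratedDeriv n (mod_cast le_top)).norm
  obtain ⟨B, hB⟩ := (isCompact_Icc (a := (-2 : ℝ)) (b := 0)).bddAbove_image hcont.continuousOn
  refine ⟨max 0 (max C B), fun u => ?_⟩
  rw [norm_iteratedFDeriv_eq_norm_iteratedDeriv]
  rcases lt_or_ge u (-2) with h1 | h1
  · rw [(hzero u h1).iteratedDeriv_eq n]
    simp
  rcases le_or_gt u 0 with h2 | h2
  · exact (hB (mem_image_of_mem _ ⟨h1, h2⟩)).trans (by simp)
  · rw [(heq u (by linarith)).iteratedDeriv_eq n]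
    exact (hC u h2.le).trans (by simp)

/-- The moment `∫ u ^ (κ - 1) g(u) du` over the positive half-line. -/
def moment (g : 𝓢(ℝ, ℂ)) (κ : ℂ) : ℂ := ∫ u in Ioi (0 : ℝ), (u : ℂ) ^ (κ - 1) * g u

theorem integrableOn_moment (g : 𝓢(ℝ, ℂ)) {κ : ℂ} (hκ : 0 < κ.re) :
    IntegrableOn (fun u : ℝ => (u : ℂ) ^ (κ - 1) * g u) (Ioi 0) := by
  have h := mellinConvergent_of_isBigO_rpow (f := g) (s := κ) (a := κ.re + 1) (b := 0)
    (g.continuous.locallyIntegrable.locallyIntegrableOn _) ?_ (by linarith) ?_ hκ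
  · simpa [MellinConvergent] using h
  · refine ((g.isBigO_cocompact_rpow (-(κ.re + 1))).mono atTop_le_cocompact).trans ?_
    refine (Asymptotics.isBigO_refl _ _).congr' ?_ EventuallyEq.rfl
    filter_upwards [eventually_ge_atTop 0] with x hx
    rw [Real.norm_of_nonneg hx]
  · simp only [neg_zero, Real.rpow_zero]
    exact (g.continuous.continuousAt.tendsto.mono_left nhdsWithin_le_nhds).isBigO_one ℝ

/-- The averaging operator `g ↦ ∫_0^1 t ^ (κ - 1) g(t u) dt`. -/
def average (κ : ℂ) (g : 𝓢(ℝ, ℂ)) (u : ℝ) : ℂ :=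
  ∫ t in (0 : ℝ)..1, (t : ℂ) ^ (κ - 1) * g (t * u)

theorem intervalIntegrable_average (g : 𝓢(ℝ, ℂ)) {κ : ℂ} (hκ : 0 < κ.re) (u : ℝ) (a b : ℝ) :
    IntervalIntegrable (fun t : ℝ => (t : ℂ) ^ (κ - 1) * g (t * u)) volume a b :=
  (intervalIntegral.intervalIntegrable_cpow' (by simpa using hκ)).mul_continuousOn
    (by fun_prop)

/-- The inner derivative contributes a factor t, which raises κ by one; averages are thus closed
under differentiation. -/
theorem hasDerivAt_average (g : 𝓢(ℝ, ℂ)) {κ : ℂ} (hκ : 0 < κ.re) (u : ℝ) :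
    HasDerivAt (average κ g) (average (κ + 1) (derivS g) u) u := by
  have hb : ∀ v, ‖derivS g v‖ ≤ SchwartzMap.seminorm ℝ 0 0 (derivS g) :=
    fun v => SchwartzMap.norm_le_seminorm ℝ _ v
  refine (intervalIntegral.hasDerivAt_integral_of_dominated_loc_of_deriv_le
    (F := fun u t => (t : ℂ) ^ (κ - 1) * g (t * u))
    (F' := fun u t => (t : ℂ) ^ (κ + 1 - 1) * derivS g (t * u))
    (bound := fun t => t ^ κ.re * SchwartzMap.seminorm ℝ 0 0 (derivS g))
    (univ_mem) ?_ ?_ ?_ ?_ ?_ ?_).2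
  · exact Eventually.of_forall fun v => (intervalIntegrable_average g hκ v 0 1).def'.1
  · exact intervalIntegrable_average g hκ u 0 1
  · exact (intervalIntegrable_average (derivS g) (κ := κ + 1) (by simp; linarith) u 0 1).def'.1
  · refine Eventually.of_forall fun t ht v _ => ?_
    rw [uIoc_of_le zero_le_one] at ht
    rw [norm_mul, Complex.norm_cpow_eq_rpow_re_of_pos ht.1]
    simp only [add_sub_cancel_right]
    exact mul_le_mul_of_nonneg_left (hb _) (Real.rpow_nonneg ht.1.le _)
  · exact (intervalIntegral.intervalIntegrable_rpow' (by linarith)).mul_const _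
  · refine Eventually.of_forall fun t ht v _ => ?_
    rw [uIoc_of_le zero_le_one] at ht
    have h1 : HasDerivAt (fun v : ℝ => t * v) t v := by simpa using (hasDerivAt_id v).const_mul t
    have h2 := ((g.hasDerivAt (t * v)).scomp v h1).const_mul ((t : ℂ) ^ (κ - 1))
    refine h2.congr_deriv ?_
    rw [add_sub_cancel_right, Complex.real_smul, SchwartzMap.derivCLM_apply, ← mul_assoc,
      Complex.cpow_sub _ _ (by simpa using ht.1.ne'), Complex.cpow_one]
    field_simp [show (t : ℂ) ≠ 0 by simpa using ht.1.ne']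

/-- Integrate the derivative of t^κ g(tu) over [0, 1]; the boundary term at 0 vanishes because Re κ
> 0. -/
theorem average_ode (g : 𝓢(ℝ, ℂ)) {κ : ℂ} (hκ : 0 < κ.re) (u : ℝ) :
    u * average (κ + 1) (derivS g) u + κ * average κ g u = g u := by
  have h0 : κ ≠ 0 := by rintro rfl; simp at hκ
  have key := intervalIntegral.integral_eq_sub_of_hasDerivAt_of_le (a := 0) (b := 1) zero_le_one
    (f := fun t : ℝ => (t : ℂ) ^ κ * g (t * u))
    (f' := fun t : ℝ => u * ((t : ℂ) ^ (κ + 1 - 1) * derivS g (t * u))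
      + κ * ((t : ℂ) ^ (κ - 1) * g (t * u))) ?_ ?_ ?_
  · rw [intervalIntegral.integral_add, intervalIntegral.integral_const_mul,
      intervalIntegral.integral_const_mul] at key
    · simpa [average, h0] using key
    · exact (intervalIntegrable_average (derivS g) (by simp; linarith) u 0 1).const_mul _
    · exact (intervalIntegrable_average g hκ u 0 1).const_mul _
  · exact ((Complex.continuous_ofReal_cpow_const hκ).mul (by fun_prop)).continuousOn
  · intro t ht
    have h1 : HasDerivAt (fun v : ℝ => v * u) u t := by simpa using (hasDerivAt_id t).mul_const u
    have h2 := (g.hasDerivAt (t * u)).scomp t h1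
    have h3 : HasDerivAt (fun t : ℝ => (t : ℂ) ^ κ) (κ * (t : ℂ) ^ (κ - 1)) t := by
      exact hasDerivAt_ofReal_cpow_const ht.1.ne' h0
    refine (h3.mul h2).congr_deriv ?_
    rw [Complex.real_smul, SchwartzMap.derivCLM_apply, add_sub_cancel_right]
    simp only [Function.comp]
    ring
  · exact ((intervalIntegrable_average (derivS g) (by simp; linarith) u 0 1).const_mul _).add
      ((intervalIntegrable_average g hκ u 0 1).const_mul _)

theorem continuous_average (g : 𝓢(ℝ, ℂ)) {κ : ℂ} (hκ : 0 < κ.re) : Continuous (average κ g) :=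
  continuous_iff_continuousAt.2 fun u => (hasDerivAt_average g hκ u).continuousAt

theorem average_eq (g : 𝓢(ℝ, ℂ)) (κ : ℂ) {u : ℝ} (hu : 0 < u) :
    average κ g u = (u : ℂ) ^ (-κ) * ∫ v in (0 : ℝ)..u, (v : ℂ) ^ (κ - 1) * g v := by
  have h := intervalIntegral.integral_comp_mul_left (a := 0) (b := 1) (c := u)
    (fun v : ℝ => (v : ℂ) ^ (κ - 1) * g v) hu.ne'
  simp only [mul_zero, mul_one] at h
  have hu' : (u : ℂ) ≠ 0 := by simpa using hu.ne'
  have h2 : ∫ t in (0 : ℝ)..1, ((u * t : ℝ) : ℂ) ^ (κ - 1) * g (u * t) =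
      (u : ℂ) ^ (κ - 1) * average κ g u := by
    rw [average, ← intervalIntegral.integral_const_mul]
    refine intervalIntegral.integral_congr fun t ht => ?_
    rw [uIcc_of_le zero_le_one] at ht
    simp only [Complex.ofReal_mul]
    rw [Complex.mul_cpow_ofReal_nonneg hu.le ht.1, mul_assoc, mul_comm u t]
  rw [h2] at h
  have h3 : (u : ℂ) ^ (-κ) * ∫ v in (0 : ℝ)..u, (v : ℂ) ^ (κ - 1) * g v
      = (u : ℂ) ^ (-κ) * (u * (u⁻¹ • ∫ v in (0 : ℝ)..u, (v : ℂ) ^ (κ - 1) * g v)) := by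
    rw [Complex.real_smul, Complex.ofReal_inv, mul_inv_cancel_left₀ hu']
  rw [h3, ← h, ← mul_assoc, ← mul_assoc]
  nth_rewrite 2 [← Complex.cpow_one (u : ℂ)]
  rw [← Complex.cpow_add _ _ hu', ← Complex.cpow_add _ _ hu']
  simp

/-- In general the average decays only like u^(-κ). Vanishing of the moment replaces the integral
over (0, u) by minus the tail over (u, ∞), which decays rapidly. -/
theorem average_decay_aux (g : 𝓢(ℝ, ℂ)) {κ : ℂ} (hκ : 0 < κ.re) (hg : moment g κ = 0) (k : ℕ) :
    ∃ C, ∀ u : ℝ, 1 ≤ u → ‖u‖ ^ k * ‖average κ g u‖ ≤ C := by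
  -- With this `m` the tail integral converges, the division by m - Re κ ≥ 1 does no harm, and the
  -- total exponent k - m is nonpositive.
  obtain ⟨m, hm⟩ := exists_nat_gt (κ.re + k + 1)
  obtain ⟨C, hC⟩ := g.decay' m 0
  have hC0 : 0 ≤ C := le_trans (by positivity) (hC 0)
  refine ⟨C, fun u hu => ?_⟩
  have hu0 : 0 < u := by linarith
  have h1 : ∫ v in (0 : ℝ)..u, (v : ℂ) ^ (κ - 1) * g v =
      - ∫ v in Ioi u, (v : ℂ) ^ (κ - 1) * g v := by
    have hi := integrableOn_moment g hκ
    rw [intervalIntegral.integral_of_le hu0.le, eq_neg_iff_add_eq_zero,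
      ← setIntegral_union (Ioc_disjoint_Ioi le_rfl) measurableSet_Ioi
        (hi.mono_set Ioc_subset_Ioi_self) (hi.mono_set (Ioi_subset_Ioi hu0.le)),
      Ioc_union_Ioi_eq_Ioi hu0.le]
    exact hg
  have h2 : ‖∫ v in Ioi u, (v : ℂ) ^ (κ - 1) * g v‖ ≤
      ∫ v in Ioi u, C * v ^ (κ.re - 1 - m) := by
    refine norm_integral_le_of_norm_le ?_ ?_
    · exact (integrableOn_Ioi_rpow_of_lt (by linarith) hu0).const_mul _
    · filter_upwards [ae_restrict_mem measurableSet_Ioi] with v hv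
      have hv0 : 0 < v := hu0.trans hv
      have h3 := hC v
      rw [norm_iteratedFDeriv_zero, Real.norm_of_nonneg hv0.le] at h3
      rw [norm_mul, Complex.norm_cpow_eq_rpow_re_of_pos hv0]
      have h4 : ‖g v‖ ≤ C * v ^ (-(m : ℝ)) := by
        change v ^ m * ‖g v‖ ≤ C at h3
        rw [Real.rpow_neg hv0.le, Real.rpow_natCast, ← div_eq_mul_inv, le_div_iff₀ (by positivity)]
        linarith
      calc v ^ (κ - 1).re * ‖g v‖ ≤ v ^ (κ - 1).re * (C * v ^ (-(m : ℝ))) := by gcongr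
        _ = C * (v ^ (κ.re - 1) * v ^ (-(m : ℝ))) := by simp; ring
        _ = _ := by rw [← Real.rpow_add hv0]; ring_nf
  rw [integral_const_mul, integral_Ioi_rpow_of_lt (by linarith) hu0] at h2
  rw [average_eq g κ hu0, h1, norm_mul, norm_neg, Complex.norm_cpow_eq_rpow_re_of_pos hu0,
    Real.norm_of_nonneg hu0.le, Complex.neg_re, ← Real.rpow_natCast]
  have h5 : -u ^ (κ.re - 1 - ↑m + 1) / (κ.re - 1 - ↑m + 1) ≤ u ^ (κ.re - m) := by
    have e1 : κ.re - 1 - (m : ℝ) + 1 = κ.re - m := by ring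
    rw [e1, neg_div, ← div_neg]
    refine div_le_self (by positivity) ?_
    have : (0 : ℝ) ≤ k := by positivity
    linarith
  calc u ^ (k : ℝ) * (u ^ (-κ.re) * ‖∫ v in Ioi u, (v : ℂ) ^ (κ - 1) * g v‖)
      ≤ u ^ (k : ℝ) * (u ^ (-κ.re) * (C * u ^ (κ.re - m))) := by
        gcongr
        exact h2.trans (by gcongr)
    _ = C * u ^ ((k : ℝ) + (-κ.re + (κ.re - m))) := by
        rw [Real.rpow_add hu0, Real.rpow_add hu0]; ring
    _ ≤ C * 1 := by
        gcongr
        refine Real.rpow_le_one_of_one_le_of_nonpos hu ?_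
        linarith
    _ = C := mul_one C

theorem average_decay_of_one_le (g : 𝓢(ℝ, ℂ)) {κ : ℂ} (hκ : 0 < κ.re) {k : ℕ}
    (h : ∃ C, ∀ u : ℝ, 1 ≤ u → ‖u‖ ^ k * ‖average κ g u‖ ≤ C) :
    ∃ C, ∀ u : ℝ, 0 ≤ u → ‖u‖ ^ k * ‖average κ g u‖ ≤ C := by
  obtain ⟨C, hC⟩ := h
  have hcont : Continuous fun u : ℝ => ‖u‖ ^ k * ‖average κ g u‖ :=
    (continuous_norm.pow k).mul (continuous_average g hκ).norm
  obtain ⟨B, hB⟩ := (isCompact_Icc (a := (0 : ℝ)) (b := 1)).bddAbove_image hcont.continuousOn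
  refine ⟨max C B, fun u hu => ?_⟩
  rcases le_or_gt u 1 with h2 | h2
  · exact (hB (mem_image_of_mem _ ⟨hu, h2⟩)).trans (le_max_right _ _)
  · exact (hC u h2.le).trans (le_max_left _ _)

/-- The differential equation expresses u times the next average through the previous one, so for u
≥ 1 decay passes from each derivative to the next without further moment conditions. -/
theorem average_decay (g : 𝓢(ℝ, ℂ)) {κ : ℂ} (hκ : 0 < κ.re) (hg : moment g κ = 0) (n k : ℕ) :
    ∃ C, ∀ u : ℝ, 0 ≤ u → ‖u‖ ^ k * ‖average (κ + n) (derivS^[n] g) u‖ ≤ C := by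
  induction n with
  | zero =>
    simpa using average_decay_of_one_le g hκ (average_decay_aux g hκ hg k)
  | succ n ih =>
    obtain ⟨C, hC⟩ := ih
    set G := derivS^[n] g
    have hκn : 0 < (κ + n).re := by
      have : (0 : ℝ) ≤ n := by positivity
      simp; linarith
    have hκn1 : 0 < (κ + n + 1).re := by rw [Complex.add_re]; simp at hκn ⊢; linarith
    have e1 : κ + ((n + 1 : ℕ) : ℂ) = κ + n + 1 := by push_cast; ring
    rw [Function.iterate_succ_apply', e1]
    refine average_decay_of_one_le _ hκn1 ?_
    obtain ⟨B, hB⟩ := G.decay' k 0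
    refine ⟨B + ‖κ + n‖ * C, fun u hu => ?_⟩
    have h1 := average_ode G hκn u
    have h2 := hC u (by linarith)
    have h3 := hB u
    rw [norm_iteratedFDeriv_zero] at h3
    change ‖u‖ ^ k * ‖G u‖ ≤ B at h3
    have h4 : (u : ℂ) * average (κ + n + 1) (derivS G) u = G u - (κ + n) * average (κ + n) G u := by
      linear_combination h1
    have h5 : ‖average (κ + n + 1) (derivS G) u‖ ≤ ‖G u‖ + ‖κ + n‖ * ‖average (κ + n) G u‖ := by
      calc ‖average (κ + n + 1) (derivS G) u‖
          ≤ ‖(u : ℂ)‖ * ‖average (κ + n + 1) (derivS G) u‖ := by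
            refine le_mul_of_one_le_left (norm_nonneg _) ?_
            rw [Complex.norm_real, Real.norm_of_nonneg (by linarith)]; exact hu
        _ = ‖G u - (κ + n) * average (κ + n) G u‖ := by rw [← norm_mul, h4]
        _ ≤ _ := (norm_sub_le _ _).trans (by rw [norm_mul])
    calc ‖u‖ ^ k * ‖average (κ + n + 1) (derivS G) u‖
        ≤ ‖u‖ ^ k * (‖G u‖ + ‖κ + n‖ * ‖average (κ + n) G u‖) := by gcongr
      _ = ‖u‖ ^ k * ‖G u‖ + ‖κ + n‖ * (‖u‖ ^ k * ‖average (κ + n) G u‖) := by ring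
      _ ≤ _ := by gcongr

theorem iteratedDeriv_average (g : 𝓢(ℝ, ℂ)) {κ : ℂ} (hκ : 0 < κ.re) (n : ℕ) :
    iteratedDeriv n (average κ g) = average (κ + n) (derivS^[n] g) := by
  induction n with
  | zero => simp
  | succ n ih =>
    have hκn : 0 < (κ + n).re := by
      have : (0 : ℝ) ≤ n := by positivity
      simp; linarith
    rw [iteratedDeriv_succ, ih, Function.iterate_succ_apply']
    ext u
    rw [(hasDerivAt_average _ hκn u).deriv]
    push_cast; ring_nf

/-- Solvability of `u h' + κ h = g` among Schwartz functions on the positive half-line. -/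
theorem exists_schwartz_ode (g : 𝓢(ℝ, ℂ)) {κ : ℂ} (hκ : 0 < κ.re) (hg : moment g κ = 0) :
    ∃ h : 𝓢(ℝ, ℂ), ∀ u : ℝ, 0 ≤ u → (mulVar (derivS h) + κ • h) u = g u := by
  have hsm : ContDiff ℝ ∞ (average κ g) := by
    refine contDiff_of_differentiable_iteratedDeriv fun m _ => ?_
    rw [iteratedDeriv_average g hκ]
    have hκn : 0 < (κ + m).re := by
      have : (0 : ℝ) ≤ m := by positivity
      simp; linarith
    exact fun u => (hasDerivAt_average _ hκn u).differentiableAt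
  obtain ⟨h, hh⟩ := exists_schwartz_eqOn hsm fun k n => by
    rw [iteratedDeriv_average g hκ]; exact average_decay g hκ hg n k
  refine ⟨h, fun u hu => ?_⟩
  have h1 : h =ᶠ[𝓝 u] average κ g := by
    filter_upwards [lt_mem_nhds (show -1 < u by linarith)] with v hv using hh v hv
  simp only [add_apply, smul_apply, mulVar_apply, smul_eq_mul,
    SchwartzMap.derivCLM_apply]
  rw [h1.deriv_eq, h1.eq_of_nhds, (hasDerivAt_average g hκ u).deriv]
  exact average_ode g hκ u

theorem exists_schwartz_exp (b : ℝ) (hb : 0 < b) :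
    ∃ H : 𝓢(ℝ, ℂ), ∀ u : ℝ, -1 < u → H u = Complex.exp (-(b * u : ℝ)) := by
  have hit : ∀ n : ℕ, iteratedDeriv n (fun u : ℝ => Complex.exp (-(b * u : ℝ))) =
      fun u : ℝ => (-b : ℂ) ^ n * Complex.exp (-(b * u : ℝ)) := by
    intro n
    induction n with
    | zero => simp
    | succ n ih =>
      rw [iteratedDeriv_succ, ih]
      ext u
      have h1 : HasDerivAt (fun u : ℝ => -((b * u : ℝ) : ℂ)) (-b : ℂ) u := by
        have h2 : HasDerivAt (fun u : ℝ => b * u) b u := by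
          simpa using (hasDerivAt_id u).const_mul b
        simpa using h2.ofReal_comp.fun_neg
      have h3 := (h1.cexp.const_mul ((-b : ℂ) ^ n)).deriv
      rw [h3]; ring
  refine exists_schwartz_eqOn ?_ fun k n => ?_
  · refine ContDiff.cexp (ContDiff.neg ?_)
    exact Complex.ofRealCLM.contDiff.comp (contDiff_const.mul contDiff_id)
  · rw [hit]
    refine ⟨b ^ n * (k.factorial / b ^ k), fun u hu => ?_⟩
    have h1 : (b * u) ^ k / k.factorial ≤ Real.exp (b * u) :=
      Real.pow_div_factorial_le_exp _ (by positivity) k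
    have h2 : ‖Complex.exp (-(b * u : ℝ))‖ = (Real.exp (b * u))⁻¹ := by
      rw [← Complex.ofReal_neg, Complex.norm_exp_ofReal, Real.exp_neg]
    rw [norm_mul, h2, norm_pow, norm_neg, Complex.norm_real, Real.norm_of_nonneg hb.le,
      Real.norm_of_nonneg hu]
    have h3 : u ^ k * (Real.exp (b * u))⁻¹ ≤ k.factorial / b ^ k := by
      rw [← div_eq_mul_inv, div_le_div_iff₀ (Real.exp_pos _) (by positivity)]
      rw [div_le_iff₀ (by positivity), mul_pow] at h1
      linarith
    calc u ^ k * (b ^ n * (Real.exp (b * u))⁻¹) = b ^ n * (u ^ k * (Real.exp (b * u))⁻¹) := by ring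
      _ ≤ _ := by gcongr

/-- A Schwartz function on the line which equals `exp (-π b u)` for `u > -1`. -/
def expS (b : ℝ) (hb : 0 < b) : 𝓢(ℝ, ℂ) :=
  (exists_schwartz_exp (Real.pi * b) (mul_pos Real.pi_pos hb)).choose

theorem expS_apply (b : ℝ) (hb : 0 < b) {u : ℝ} (hu : -1 < u) :
    expS b hb u = Complex.exp (-(Real.pi * b * u : ℝ)) :=
  (exists_schwartz_exp (Real.pi * b) (mul_pos Real.pi_pos hb)).choose_spec u hu

theorem derivS_expS (b : ℝ) (hb : 0 < b) {u : ℝ} (hu : -1 < u) :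
    derivS (expS b hb) u = (-(Real.pi * b) : ℂ) * expS b hb u := by
  have h1 : HasDerivAt (fun u : ℝ => -((Real.pi * b * u : ℝ) : ℂ)) (-(Real.pi * b) : ℂ) u := by
    have h2 : HasDerivAt (fun u : ℝ => Real.pi * b * u) (Real.pi * b) u := by
      simpa using (hasDerivAt_id u).const_mul (Real.pi * b)
    simpa using h2.ofReal_comp.fun_neg
  have h2 : expS b hb =ᶠ[𝓝 u] fun u : ℝ => Complex.exp (-(Real.pi * b * u : ℝ)) := by
    filter_upwards [lt_mem_nhds hu] with v hv using expS_apply b hb hv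
  rw [SchwartzMap.derivCLM_apply, h2.deriv_eq, h2.eq_of_nhds, h1.cexp.deriv]
  ring

theorem moment_expS (b : ℝ) (hb : 0 < b) {κ : ℂ} (hκ : 0 < κ.re) :
    moment (expS b hb) κ = (1 / ((Real.pi * b : ℝ) : ℂ)) ^ κ * Complex.Gamma κ := by
  rw [← Complex.integral_cpow_mul_exp_neg_mul_Ioi hκ (mul_pos Real.pi_pos hb), moment]
  refine setIntegral_congr_fun measurableSet_Ioi fun u hu => ?_
  have hu' : (0 : ℝ) < u := hu
  rw [expS_apply b hb (by linarith)]
  simp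

/-- On functions `P(x) g(‖x‖ ^ 2)` with `P` homogeneous, a homogeneous distribution is a multiple of
a moment of `g`. -/
theorem apply_radial_eq {D : ℕ} (ψ : State D) {c : ℂ} (hψ : ∀ f, ψ (euler f) = c * ψ f) {n : ℕ}
    {P : MvPolynomial (Fin D) ℂ} (hP : P.IsHomogeneous n) {κ : ℂ} (hκ : 2 * κ = n - c)
    (hκ0 : 0 < κ.re) (g : 𝓢(ℝ, ℂ)) :
    ψ (radial P g) = ψ (radial P (expS 1 one_pos)) * (Real.pi : ℂ) ^ κ / Complex.Gamma κ *
      moment g κ := by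
  -- For g = u h' + κ h, the function P g is half of (Euler operator - c) applied to P h, and ψ
  -- annihilates its image.
  have hz : ∀ g : 𝓢(ℝ, ℂ), moment g κ = 0 → ψ (radial P g) = 0 := by
    intro g hg
    obtain ⟨h, hh⟩ := exists_schwartz_ode g hκ0 hg
    rw [← radial_congr P hh]
    have h1 := hψ (radial P h)
    rw [euler_radial hP] at h1
    simp only [radial_add_right, radial_smul_right, map_add, map_smul, smul_eq_mul] at h1 ⊢
    linear_combination h1 / 2 + ψ (radial P h) * hκ / 2
  have hlin : ∀ a : ℂ, moment (g - a • expS 1 one_pos) κ =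
      moment g κ - a * moment (expS 1 one_pos) κ := by
    intro a
    rw [moment, moment, moment, ← integral_const_mul, ← integral_sub (integrableOn_moment g hκ0)
      ((integrableOn_moment _ hκ0).const_mul a)]
    congr 1; ext u
    simp only [sub_apply, smul_apply, smul_eq_mul]; ring
  have hG := Complex.Gamma_ne_zero_of_re_pos hκ0
  have hpi : (Real.pi : ℂ) ≠ 0 := by simp
  have hpk : (Real.pi : ℂ) ^ κ ≠ 0 := by simp [Complex.cpow_eq_zero_iff, hpi]
  have hm : moment (expS 1 one_pos) κ = ((Real.pi : ℂ) ^ κ)⁻¹ * Complex.Gamma κ := by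
    rw [moment_expS 1 one_pos hκ0, mul_one, one_div, Complex.inv_cpow]
    rw [Complex.arg_ofReal_of_nonneg Real.pi_pos.le]; exact Real.pi_pos.ne
  -- A general `g` is reduced to zero moment by subtracting a multiple of the Gaussian profile,
  -- whose moment is a nonzero Gamma value.
  have h := hz (g - (moment g κ / moment (expS 1 one_pos) κ) • expS 1 one_pos) (by
    rw [hlin, div_mul_cancel₀, sub_self]
    rw [hm]; exact mul_ne_zero (inv_ne_zero hpk) hG)
  rw [radial_sub_right, radial_smul_right, map_sub, map_smul, smul_eq_mul, sub_eq_zero, hm] at h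
  rw [h]
  field_simp

end LadderOperators

end

/-! ### Harmonic polynomials -/

noncomputable section

namespace LadderOperators

open MvPolynomial LineDeriv

variable {D : ℕ}

theorem pderiv_lap (μ : Fin D) (Q : MvPolynomial (Fin D) ℂ) :
    pderiv μ (lap Q) = lap (pderiv μ Q) := by
  have hc : ∀ (ν : Fin D) (R : MvPolynomial (Fin D) ℂ),
      pderiv μ (pderiv ν R) = pderiv ν (pderiv μ R) := by
    intro ν R
    induction R using MvPolynomial.induction_on with
    | C a => simp
    | add p q hp hq => simp [hp, hq]
    | mul_X p i hp =>
      simp only [Derivation.leibniz, map_add, smul_eq_mul, hp, pderiv_X, Pi.single_apply]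
      split_ifs <;> simp <;> ring
  simp [lap, map_sum, hc]

theorem lap_add (Q R : MvPolynomial (Fin D) ℂ) : lap (Q + R) = lap Q + lap R := by
  simp [lap, Finset.sum_add_distrib]

theorem lap_smul (c : ℂ) (Q : MvPolynomial (Fin D) ℂ) : lap (c • Q) = c • lap Q := by
  simp [lap, Finset.smul_sum]

theorem lap_zero : lap (0 : MvPolynomial (Fin D) ℂ) = 0 := by simp [lap]

theorem isHomogeneous_rsq : (rsq D).IsHomogeneous 2 :=
  IsHomogeneous.sum _ _ _ fun μ _ => (isHomogeneous_X ℂ μ).mul (isHomogeneous_X ℂ μ)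

theorem isHomogeneous_lap {n : ℕ} {Q : MvPolynomial (Fin D) ℂ} (hQ : Q.IsHomogeneous n) :
    (lap Q).IsHomogeneous (n - 2) :=
  IsHomogeneous.sum _ _ _ fun _ _ => hQ.pderiv.pderiv

theorem lap_eq_zero_of_lt {n : ℕ} {Q : MvPolynomial (Fin D) ℂ} (hQ : Q.IsHomogeneous n)
    (hn : n < 2) : lap Q = 0 := by
  have h0 : ∀ (R : MvPolynomial (Fin D) ℂ), R.IsHomogeneous 0 → ∀ μ, pderiv μ R = 0 := by
    intro R hR μ
    rw [totalDegree_eq_zero_iff_eq_C.1 (Nat.le_zero.1 hR.totalDegree_le)]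
    simp
  refine Finset.sum_eq_zero fun μ _ => h0 _ ?_ μ
  have := hQ.pderiv (i := μ)
  rwa [show n - 1 = 0 by omega] at this

theorem lap_rsq_mul {m : ℕ} {S : MvPolynomial (Fin D) ℂ} (hS : S.IsHomogeneous m) :
    lap (rsq D * S) = rsq D * lap S + (4 * m + 2 * D : ℂ) • S := by
  have h1 : ∀ μ, pderiv μ (rsq D) = 2 * X μ := by
    intro μ
    simp [rsq, map_sum, Derivation.leibniz, pderiv_X, Pi.single_apply, Finset.sum_add_distrib]
    ring
  have h2 : ∀ μ, pderiv μ (pderiv μ (rsq D * S)) =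
      rsq D * pderiv μ (pderiv μ S) + 4 * (X μ * pderiv μ S) + 2 * S := by
    intro μ
    have h3 : pderiv μ (2 * X μ : MvPolynomial (Fin D) ℂ) = 2 := by
      rw [show (2 : MvPolynomial (Fin D) ℂ) = C 2 from (map_ofNat C 2).symm, Derivation.leibniz]
      simp
    simp only [Derivation.leibniz, h1, h3, map_add, smul_eq_mul]
    ring
  simp_rw [lap, h2, Finset.sum_add_distrib, ← Finset.mul_sum, hS.sum_X_mul_pderiv]
  simp only [Finset.sum_const, Finset.card_univ, Fintype.card_fin, nsmul_eq_mul,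
    MvPolynomial.smul_eq_C_mul]
  have h2 : (C 2 : MvPolynomial (Fin D) ℂ) = 2 := map_ofNat C 2
  have h4 : (C 4 : MvPolynomial (Fin D) ℂ) = 4 := map_ofNat C 4
  simp [h2, h4]
  ring

theorem lap_rsq_pow_mul {m : ℕ} {S : MvPolynomial (Fin D) ℂ} (hS : S.IsHomogeneous m) (i : ℕ) :
    lap (rsq D ^ (i + 1) * S) = rsq D ^ (i + 1) * lap S +
      (2 * (i + 1) * (2 * i + D + 2 * m) : ℂ) • (rsq D ^ i * S) := by
  induction i with
  | zero => simp [lap_rsq_mul hS]; ring_nf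
  | succ i ih =>
    rw [pow_succ' (rsq D) (i + 1), mul_assoc,
      lap_rsq_mul (((isHomogeneous_rsq (D := D)).pow (i + 1)).mul hS), ih]
    push_cast
    simp only [MvPolynomial.smul_eq_C_mul]
    have h2 : (C 2 : MvPolynomial (Fin D) ℂ) = 2 := map_ofNat C 2
    have h4 : (C 4 : MvPolynomial (Fin D) ℂ) = 4 := map_ofNat C 4
    simp [h2, h4]
    ring

theorem isHomogeneous_iterate_lap {n : ℕ} {Q : MvPolynomial (Fin D) ℂ} (hQ : Q.IsHomogeneous n)
    (i : ℕ) : (lap^[i] Q).IsHomogeneous (n - 2 * i) ∧ (n < 2 * i → lap^[i] Q = 0) := by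
  induction i with
  | zero => simpa using hQ
  | succ i ih =>
    rw [Function.iterate_succ_apply']
    refine ⟨?_, fun h => ?_⟩
    · have := isHomogeneous_lap ih.1
      rwa [show n - 2 * (i + 1) = n - 2 * i - 2 by omega]
    · rcases lt_or_ge n (2 * i) with h1 | h1
      · rw [ih.2 h1, lap_zero]
      · exact lap_eq_zero_of_lt ih.1 (by omega)

/-- The decomposition of a homogeneous polynomial into a harmonic one and a multiple of `rsq`. -/
theorem exists_harmonic_add (hD : 1 ≤ D) {n : ℕ} {Q : MvPolynomial (Fin D) ℂ}
    (hQ : Q.IsHomogeneous n) :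
    ∃ P R : MvPolynomial (Fin D) ℂ, P.IsHomogeneous n ∧ lap P = 0 ∧ Q = P + rsq D * R ∧
      R.IsHomogeneous (n - 2) ∧ (n < 2 → R = 0) := by
  -- The factor in `lap_rsq_pow_mul` for the (i+1)-st iterated Laplacian of `Q`. The subtraction is
  -- truncated, but D ≥ 1 keeps the factor nonzero for all `i`.
  let k : ℕ → ℂ := fun i => 2 * (i + 1) * (2 * i + D + 2 * ((n - 2 * (i + 1) : ℕ) : ℂ))
  have hk : ∀ i, k i ≠ 0 := by
    intro i
    have h : k i = ((2 * (i + 1) * (2 * i + D + 2 * (n - 2 * (i + 1))) : ℕ) : ℂ) := by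
      simp only [k]; push_cast; ring
    rw [h, Nat.cast_ne_zero]
    have : 0 < 2 * i + D + 2 * (n - 2 * (i + 1)) := by omega
    positivity
  -- Chosen so that the Laplacian of ∑ cᵢ rⁱ Δⁱ Q, with r = ‖x‖², telescopes; its last term vanishes
  -- for degree reasons.
  let c : ℕ → ℂ := fun i => Nat.rec 1 (fun i ci => -ci / k i) i
  have hc : ∀ i, c (i + 1) * k i = -c i := fun i => div_mul_cancel₀ _ (hk i)
  let T : ℕ → MvPolynomial (Fin D) ℂ := fun i => c i • (rsq D ^ i * lap^[i] Q)
  have hlapT : ∀ N, lap (∑ i ∈ Finset.range (N + 1), T i) = c N • (rsq D ^ N * lap^[N + 1] Q) := by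
    intro N
    induction N with
    | zero => simp [T, c]
    | succ N ih =>
      rw [Finset.sum_range_succ, lap_add, ih]
      simp only [T]
      rw [lap_smul, lap_rsq_pow_mul (isHomogeneous_iterate_lap hQ (N + 1)).1 N, smul_add, smul_smul]
      have h2 : c (N + 1) * (2 * (N + 1) * (2 * N + D + 2 * ((n - 2 * (N + 1) : ℕ) : ℂ))) = -c N :=
        hc N
      rw [h2, ← Function.iterate_succ_apply' lap (N + 1)]
      simp
  -- The case j = 0 gives the degree of the harmonic part, j = 1 that of the cofactor of `rsq`.
  have hdeg : ∀ i j, j ≤ i → j ≤ 1 → (rsq D ^ (i - j) * lap^[i] Q).IsHomogeneous (n - 2 * j) := by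
    intro i j hj hj1
    have h := isHomogeneous_iterate_lap hQ i
    rcases lt_or_ge n (2 * i) with h1 | h1
    · rw [h.2 h1, mul_zero]; exact isHomogeneous_zero _ _ _
    · have := ((isHomogeneous_rsq (D := D)).pow (i - j)).mul h.1
      rwa [show 2 * (i - j) + (n - 2 * i) = n - 2 * j by omega] at this
  refine ⟨∑ i ∈ Finset.range (n + 1), T i,
    -∑ i ∈ Finset.range n, c (i + 1) • (rsq D ^ i * lap^[i + 1] Q), ?_, ?_, ?_, ?_, ?_⟩
  · refine IsHomogeneous.sum _ _ _ fun i _ => ?_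
    simp only [T]
    have := hdeg i 0 (Nat.zero_le _) (by norm_num)
    rw [MvPolynomial.smul_eq_C_mul]
    simpa using (isHomogeneous_C _ (c i)).mul this
  · rw [hlapT, (isHomogeneous_iterate_lap hQ (n + 1)).2 (by omega)]
    simp
  · rw [Finset.sum_range_succ', mul_neg, Finset.mul_sum]
    have h : ∀ i ∈ Finset.range n, T (i + 1) = rsq D * c (i + 1) • (rsq D ^ i * lap^[i + 1] Q) := by
      intro i _
      simp only [T]
      rw [mul_smul_comm, pow_succ', mul_assoc]
    rw [Finset.sum_congr rfl h]
    simp [T, c]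
  · refine (IsHomogeneous.sum _ _ _ fun i _ => ?_).neg
    have := hdeg (i + 1) 1 (by omega) le_rfl
    rw [MvPolynomial.smul_eq_C_mul]
    simpa using (isHomogeneous_C _ (c (i + 1))).mul this
  · intro hn
    rw [Finset.sum_eq_zero, neg_zero]
    intro i _
    rw [(isHomogeneous_iterate_lap hQ (i + 1)).2 (by omega)]
    simp

/-- A distribution which vanishes on all products of a harmonic polynomial and a radial function
vanishes on all products of a polynomial and a radial function. -/
theorem apply_radial_eq_zero_of_harmonic (hD : 1 ≤ D) (ψ : State D)
    (hψ : ∀ (n : ℕ) (P : MvPolynomial (Fin D) ℂ) (h : 𝓢(ℝ, ℂ)), P.IsHomogeneous n → lap P = 0 →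
      ψ (radial P h) = 0) (Q : MvPolynomial (Fin D) ℂ) (h : 𝓢(ℝ, ℂ)) : ψ (radial Q h) = 0 := by
  have key : ∀ (n : ℕ) (Q : MvPolynomial (Fin D) ℂ), Q.IsHomogeneous n → ∀ h : 𝓢(ℝ, ℂ),
      ψ (radial Q h) = 0 := by
    intro n
    induction n using Nat.strong_induction_on with
    | _ n ih =>
      intro Q hQ h
      obtain ⟨P, R, hP, hP', rfl, hR, hR0⟩ := exists_harmonic_add hD hQ
      rw [radial_add_left, map_add, hψ n P h hP hP', zero_add]
      rcases lt_or_ge n 2 with hn | hn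
      · rw [hR0 hn, mul_zero, radial_zero_left, map_zero]
      -- The factor ‖x‖² is absorbed into the radial profile, so the degree of the polynomial drops
      -- by two.
      · rw [radial_rsq_mul]
        exact ih (n - 2) (by omega) R hR _
  rw [← MvPolynomial.sum_homogeneousComponent Q, radial_sum_left, map_sum]
  exact Finset.sum_eq_zero fun i _ => key i _ (homogeneousComponent_isHomogeneous i Q) h

/-! ### Fourier transforms of polynomials times Gaussians -/

theorem fourier_mulCoord (μ : Fin D) (f : 𝓢(Space D, ℂ)) :
    𝓕 (mulCoord μ f) = (Complex.I / (2 * Real.pi)) • partialDeriv μ (𝓕 f) := by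
  have h1 : SchwartzMap.smulLeftCLM ℂ (fun x : Space D => inner ℝ x (basisVec μ)) f =
      mulCoord μ f := by
    ext x
    rw [SchwartzMap.smulLeftCLM_apply_apply
      (Function.hasTemperateGrowth_inner_left (H := Space D) (basisVec μ)), mulCoord_apply]
    simp [EuclideanSpace.inner_single_right]
  have h2 := SchwartzMap.lineDerivOp_fourier_eq f (basisVec μ)
  rw [h1, FourierTransform.fourier_smul] at h2
  simp only [partialDeriv, lineDerivOpCLM_apply]
  rw [h2, smul_smul]
  have hpi : (Real.pi : ℂ) ≠ 0 := by simp
  have : Complex.I / (2 * Real.pi) * -(2 * Real.pi * Complex.I) = 1 := by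
    field_simp
    linear_combination -Complex.I_sq
  rw [this, one_smul]

theorem partialDeriv_radial_expS (μ : Fin D) (Q : MvPolynomial (Fin D) ℂ) (b : ℝ) (hb : 0 < b) :
    partialDeriv μ (radial Q (expS b hb)) =
      radial (pderiv μ Q - (2 * Real.pi * b : ℂ) • (X μ * Q)) (expS b hb) := by
  have h : radial (X μ * Q) (derivS (expS b hb)) =
      radial (X μ * Q) ((-(Real.pi * b) : ℂ) • expS b hb) :=
    radial_congr _ fun u hu => by
      rw [derivS_expS b hb (by linarith)]; rfl
  rw [partialDeriv_radial, h, radial_sub_left, radial_smul_left, radial_smul_right, smul_smul]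
  module

theorem radial_expS_apply (Q : MvPolynomial (Fin D) ℂ) (b : ℝ) (hb : 0 < b) (x : Space D) :
    radial Q (expS b hb) x = polyFun Q x * Complex.exp (-(Real.pi * b * ‖x‖ ^ 2 : ℝ)) := by
  rw [radial_apply, expS_apply]
  have : 0 ≤ ‖x‖ ^ 2 := by positivity
  linarith

theorem fourier_radial_C (a : ℂ) (b : ℝ) (hb : 0 < b) :
    𝓕 (radial (C a : MvPolynomial (Fin D) ℂ) (expS b hb)) =
      ((b ^ (-(D / 2 : ℝ)) : ℝ) : ℂ) • radial (C a) (expS b⁻¹ (inv_pos.2 hb)) := by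
  have h0 : radial (C a : MvPolynomial (Fin D) ℂ) (expS b hb) = a • radial (C 1) (expS b hb) := by
    rw [← radial_smul_left, MvPolynomial.smul_eq_C_mul]; simp
  have h0' : radial (C a : MvPolynomial (Fin D) ℂ) (expS b⁻¹ (inv_pos.2 hb)) =
      a • radial (C 1) (expS b⁻¹ (inv_pos.2 hb)) := by
    rw [← radial_smul_left, MvPolynomial.smul_eq_C_mul]; simp
  rw [h0, h0', FourierTransform.fourier_smul, smul_comm]
  congr 1
  ext ξ
  rw [SchwartzMap.fourier_coe]
  have h1 : (radial (C 1 : MvPolynomial (Fin D) ℂ) (expS b hb) : Space D → ℂ) =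
      fun x => Complex.exp (-((Real.pi * b : ℝ) : ℂ) * ‖x‖ ^ 2) := by
    ext x
    rw [radial_expS_apply]
    simp [polyFun]
  have hpi : (Real.pi : ℂ) ≠ 0 := by simp
  rw [h1, fourier_gaussian_innerProductSpace (by simpa using mul_pos Real.pi_pos hb), smul_apply,
    radial_expS_apply]
  have h2 : (Real.pi / ((Real.pi * b : ℝ) : ℂ)) = ((b⁻¹ : ℝ) : ℂ) := by
    push_cast; field_simp
  have h3 : ((Module.finrank ℝ (Space D) : ℂ) / 2) = ((D / 2 : ℝ) : ℂ) := by simp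
  rw [h2, h3, ← Complex.ofReal_cpow (inv_pos.2 hb).le, Real.inv_rpow hb.le, ← Real.rpow_neg hb.le]
  have hbc : (b : ℂ) ≠ 0 := by simpa using hb.ne'
  simp only [polyFun, map_one, one_mul, smul_eq_mul]
  congr 2
  push_cast
  field_simp

/-- The Fourier transform of the product of a harmonic polynomial and a Gaussian. -/
theorem fourier_radial_harmonic (b : ℝ) (hb : 0 < b) {n : ℕ} {P : MvPolynomial (Fin D) ℂ}
    (hP : P.IsHomogeneous n) (hP' : lap P = 0) :
    𝓕 (radial P (expS b hb)) =
      ((-Complex.I) ^ n * ((b ^ (-(n + D / 2 : ℝ)) : ℝ) : ℂ)) •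
        radial P (expS b⁻¹ (inv_pos.2 hb)) := by
  induction n generalizing P with
  | zero =>
    rw [totalDegree_eq_zero_iff_eq_C.1 (Nat.le_zero.1 hP.totalDegree_le), fourier_radial_C]
    simp
  | succ n ih =>
    have hn : ((n + 1 : ℕ) : ℂ) ≠ 0 := Nat.cast_ne_zero.2 (Nat.succ_ne_zero n)
    have hbc : (b : ℂ) ≠ 0 := by simpa using hb.ne'
    have hpi : (Real.pi : ℂ) ≠ 0 := by simp
    -- Euler's identity writes (n+1)P as ∑ X_μ ∂_μ P. Each ∂_μ P is harmonic of degree n, so the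
    -- induction hypothesis applies to it.
    have hEuler : ∀ (c : ℝ) (hc : 0 < c), ((n + 1 : ℕ) : ℂ) • radial P (expS c hc) =
        ∑ μ, mulCoord μ (radial (pderiv μ P) (expS c hc)) := by
      intro c hc
      simp_rw [mulCoord_radial]
      rw [← radial_sum_left, hP.sum_X_mul_pderiv, ← Nat.cast_smul_eq_nsmul ℂ, radial_smul_left]
    set K : ℂ := (-Complex.I) ^ n * ((b ^ (-(n + D / 2 : ℝ)) : ℝ) : ℂ) with hK
    have h1 : ∀ μ, 𝓕 (mulCoord μ (radial (pderiv μ P) (expS b hb))) =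
        (Complex.I / (2 * Real.pi) * K) • radial (pderiv μ (pderiv μ P) -
          (2 * Real.pi * (b⁻¹ : ℝ) : ℂ) • (X μ * pderiv μ P)) (expS b⁻¹ (inv_pos.2 hb)) := by
      intro μ
      rw [fourier_mulCoord, ih (by simpa using hP.pderiv (i := μ))
        (by rw [← pderiv_lap, hP', map_zero]), map_smul, partialDeriv_radial_expS, smul_smul]
    have h2 : ((n + 1 : ℕ) : ℂ) • 𝓕 (radial P (expS b hb)) =
        (Complex.I / (2 * Real.pi) * K) • radial (∑ μ, (pderiv μ (pderiv μ P) -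
          (2 * Real.pi * (b⁻¹ : ℝ) : ℂ) • (X μ * pderiv μ P))) (expS b⁻¹ (inv_pos.2 hb)) := by
      rw [← FourierTransform.fourier_smul, hEuler, radial_sum_left, Finset.smul_sum]
      simp_rw [← h1]
      exact map_sum (SchwartzMap.fourierTransformCLM ℂ) _ _
    rw [Finset.sum_sub_distrib, ← lap, hP', ← Finset.smul_sum, hP.sum_X_mul_pderiv, zero_sub,
      ← Nat.cast_smul_eq_nsmul ℂ, smul_smul, ← neg_smul, radial_smul_left, smul_smul] at h2
    have h3 : (b ^ (-((n + 1 : ℕ) + D / 2 : ℝ)) : ℝ) = b ^ (-(n + D / 2 : ℝ)) * b⁻¹ := by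
      rw [← Real.rpow_neg_one b, ← Real.rpow_add hb]; push_cast; ring_nf
    have h4 : 𝓕 (radial P (expS b hb)) = ((n + 1 : ℕ) : ℂ)⁻¹ •
        (((n + 1 : ℕ) : ℂ) • 𝓕 (radial P (expS b hb))) := by
      rw [smul_smul, inv_mul_cancel₀ hn, one_smul]
    rw [h4, h2, smul_smul]
    congr 1
    rw [h3, hK, pow_succ]
    push_cast at hn ⊢
    field_simp

theorem exists_fourier_radial_expS (b : ℝ) (hb : 0 < b) (Q : MvPolynomial (Fin D) ℂ) :
    ∃ R : MvPolynomial (Fin D) ℂ,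
      𝓕 (radial Q (expS b hb)) = radial R (expS b⁻¹ (inv_pos.2 hb)) := by
  induction Q using MvPolynomial.induction_on with
  | C a => exact ⟨_, by rw [fourier_radial_C, ← radial_smul_left]⟩
  | add p q hp hq =>
    obtain ⟨R, hR⟩ := hp
    obtain ⟨S, hS⟩ := hq
    exact ⟨R + S, by rw [radial_add_left, FourierTransform.fourier_add, hR, hS, radial_add_left]⟩
  | mul_X p μ hp =>
    obtain ⟨R, hR⟩ := hp
    exact ⟨_, by rw [mul_comm p, ← mulCoord_radial, fourier_mulCoord, hR, partialDeriv_radial_expS,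
      ← radial_smul_left]⟩

end LadderOperators

end

/-! ### Density of compactly supported functions and of multiples of the Gaussian -/

noncomputable section

namespace LadderOperators

open MvPolynomial MeasureTheory Set Filter Topology
open scoped ContDiff

variable {D : ℕ}

/-- A family of Schwartz functions whose seminorms are dominated by `N` is mapped by a tempered
distribution to numbers dominated by `N`. -/
theorem exists_norm_apply_le (ψ : State D) {X : Type*} (F : X → 𝓢(Space D, ℂ)) (N : X → ℝ)
    (hN : ∀ x, 0 ≤ N x)
    (hF : ∀ k l : ℕ, ∃ C : ℝ, 0 ≤ C ∧ ∀ x, SchwartzMap.seminorm ℂ k l (F x) ≤ C * N x) :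
    ∃ C : ℝ, ∀ x, ‖ψ (F x)‖ ≤ C * N x := by
  let L : 𝓢(Space D, ℂ) →ₗ[ℂ] ℂ :=
    { toFun := fun f => ψ f, map_add' := map_add ψ, map_smul' := map_smul ψ }
  have hL : Continuous L := ψ.continuous
  obtain ⟨s, C, -, hC⟩ := Seminorm.bound_of_continuous (schwartz_withSeminorms ℂ (Space D) ℂ)
    ((normSeminorm ℂ ℂ).comp L) (continuous_norm.comp hL)
  choose B hB0 hB using hF
  refine ⟨C * ∑ i ∈ s, B i.1 i.2, fun x => ?_⟩
  have h1 : ‖ψ (F x)‖ ≤ C * (s.sup (schwartzSeminormFamily ℂ (Space D) ℂ)) (F x) := hC (F x)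
  refine h1.trans ?_
  rw [mul_assoc]
  refine mul_le_mul_of_nonneg_left ?_ C.2
  refine Seminorm.finset_sup_apply_le
    (mul_nonneg (Finset.sum_nonneg fun i _ => hB0 _ _) (hN x)) fun i hi => ?_
  refine (hB i.1 i.2 x).trans (mul_le_mul_of_nonneg_right ?_ (hN x))
  exact Finset.single_le_sum (f := fun i => B i.1 i.2) (fun i _ => hB0 _ _) hi

/-- The standard Gaussian. -/
def gaussian (D : ℕ) : 𝓢(Space D, ℂ) := radial 1 (expS 1 one_pos)

theorem gaussian_apply (x : Space D) :
    gaussian D x = Complex.exp (-(Real.pi * ‖x‖ ^ 2 : ℝ)) := by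
  rw [gaussian, radial_expS_apply]; simp [polyFun]

/-- Multiplication by the standard Gaussian. -/
def mulGaussian (D : ℕ) : 𝓢(Space D, ℂ) →L[ℂ] 𝓢(Space D, ℂ) :=
  SchwartzMap.smulLeftCLM ℂ (gaussian D)

theorem mulGaussian_apply (f : 𝓢(Space D, ℂ)) (x : Space D) :
    mulGaussian D f x = gaussian D x * f x := by
  rw [mulGaussian, SchwartzMap.smulLeftCLM_apply_apply (gaussian D).hasTemperateGrowth]; rfl

/-- A function of compact support may be divided by the Gaussian. -/
theorem apply_eq_zero_of_hasCompactSupport (Λ : State D) (hΛ : ∀ f, Λ (mulGaussian D f) = 0)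
    (f : 𝓢(Space D, ℂ)) (hf : HasCompactSupport f) : Λ f = 0 := by
  have h1 : HasCompactSupport fun x : Space D => Complex.exp ((Real.pi * ‖x‖ ^ 2 : ℝ)) * f x :=
    hf.mul_left
  have h2 : ContDiff ℝ ∞ fun x : Space D => Complex.exp ((Real.pi * ‖x‖ ^ 2 : ℝ)) * f x :=
    (Complex.ofRealCLM.contDiff.comp (contDiff_const.mul (contDiff_norm_sq ℝ))).cexp.mul (f.smooth ⊤)
  have h3 : f = mulGaussian D (h1.toSchwartzMap h2) := by
    ext x
    rw [mulGaussian_apply, gaussian_apply]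
    change f x = _ * (Complex.exp ((Real.pi * ‖x‖ ^ 2 : ℝ)) * f x)
    rw [← mul_assoc, ← Complex.exp_add]
    simp
  rw [h3, hΛ]

theorem exists_cutoff (D : ℕ) : ∃ u : Space D → ℝ, ContDiff ℝ ∞ u ∧ HasCompactSupport u ∧
    ∀ x, ‖x‖ ≤ 1 → u x = 1 := by
  let b : ContDiffBump (0 : Space D) := ⟨1, 2, one_pos, one_lt_two⟩
  exact ⟨b, b.contDiff, b.hasCompactSupport, fun x hx =>
    b.one_of_mem_closedBall (by simpa using hx)⟩

/-- Schwartz functions of compact support are dense. -/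
theorem exists_hasCompactSupport_seminorm_le (f : 𝓢(Space D, ℂ)) :
    ∃ f' : ℕ → 𝓢(Space D, ℂ), (∀ m, HasCompactSupport (f' m)) ∧
      ∀ k l : ℕ, ∃ C : ℝ, 0 ≤ C ∧ ∀ m : ℕ,
        SchwartzMap.seminorm ℂ k l (f' m - f) ≤ C * ((m : ℝ) + 1)⁻¹ := by
  obtain ⟨u, hu, hus, hu1⟩ := exists_cutoff D
  let v : ℕ → Space D → ℝ := fun m x => u (((m : ℝ) + 1)⁻¹ • x)
  have hv : ∀ m, ContDiff ℝ ∞ (v m) := fun m => hu.comp (contDiff_const_smul _)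
  have hvs : ∀ m, HasCompactSupport (v m) := fun m =>
    hus.comp_smul (inv_ne_zero (by positivity))
  have hfm : ∀ m, HasCompactSupport fun x => v m x • f x := fun m => (hvs m).smul_right
  have hfs : ∀ m, ContDiff ℝ ∞ fun x => v m x • f x := fun m => (hv m).smul (f.smooth ⊤)
  refine ⟨fun m => (hfm m).toSchwartzMap (hfs m), hfm, ?_⟩
  have hF : ∀ m, (((hfm m).toSchwartzMap (hfs m) - f : 𝓢(Space D, ℂ)) : Space D → ℂ) =
      fun x => (v m x - 1) • f x := by
    intro m; ext x
    change v m x • f x - f x = _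
    rw [sub_smul, one_smul]
  have hbound : ∀ i : ℕ, ∃ C : ℝ, 0 ≤ C ∧ ∀ m x, ‖iteratedFDeriv ℝ i (fun x => v m x - 1) x‖ ≤ C := by
    intro i
    obtain ⟨C, hC⟩ := (hus.iteratedFDeriv (𝕜 := ℝ) i).exists_bound_of_continuous
      (hu.continuous_iteratedFDeriv (m := i) (mod_cast le_top))
    have hC0 : 0 ≤ C := (norm_nonneg _).trans (hC 0)
    refine ⟨C + 1, by positivity, fun m x => ?_⟩
    have h1 : ‖iteratedFDeriv ℝ i (v m) x‖ ≤ C := by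
      simp only [v]
      rw [iteratedFDeriv_comp_const_smul _ (hu.of_le (mod_cast le_top)), norm_smul, norm_pow,
        norm_inv, Real.norm_of_nonneg (by positivity)]
      refine (mul_le_mul (pow_le_one₀ (by positivity) (inv_le_one_of_one_le₀ (by simp)))
        (hC _) (norm_nonneg _) zero_le_one).trans (one_mul C).le
    rcases Nat.eq_zero_or_pos i with rfl | hi
    · rw [norm_iteratedFDeriv_zero] at h1 ⊢
      exact (norm_sub_le _ _).trans (by simpa using h1)
    · have h2 : iteratedFDeriv ℝ i (fun x => v m x - 1) = iteratedFDeriv ℝ i (v m) := by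
        have h3 := fun x => iteratedFDeriv_sub_apply (𝕜 := ℝ) (i := i) (f := v m)
          (g := fun _ : Space D => (1 : ℝ)) (x := x)
          ((hv m).of_le (mod_cast le_top)).contDiffAt contDiffAt_const
        ext1 x
        have h4 := h3 x
        rw [iteratedFDeriv_const_of_ne hi.ne'] at h4
        have h5 : iteratedFDeriv ℝ i (v m - fun _ => 1) x = iteratedFDeriv ℝ i (v m) x := by
          simpa using h4
        exact h5
      rw [h2]; linarith
  · intro k l
    choose C hC0 hC using hbound
    refine ⟨∑ i ∈ Finset.range (l + 1), (l.choose i : ℝ) * C i *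
      SchwartzMap.seminorm ℝ (k + 1) (l - i) f, ?_, fun m => ?_⟩
    · exact Finset.sum_nonneg fun i _ => mul_nonneg (mul_nonneg (by positivity) (hC0 i))
        (apply_nonneg _ _)
    · have hm : (0 : ℝ) < (m : ℝ) + 1 := by positivity
      refine SchwartzMap.seminorm_le_bound ℂ k l _ (mul_nonneg (Finset.sum_nonneg fun i _ =>
        mul_nonneg (mul_nonneg (by positivity) (hC0 i)) (apply_nonneg _ _)) (by positivity))
        fun x => ?_
      rw [hF]
      -- Inside the ball of radius m + 1 the difference vanishes locally; outside, one extra power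
      -- of ‖x‖ in the seminorm of `f` pays for the factor 1/(m + 1).
      rcases lt_or_ge ‖x‖ ((m : ℝ) + 1) with hx | hx
      · have h0 : (fun x => (v m x - 1) • f x) =ᶠ[𝓝 x] fun _ => 0 := by
          have : ∀ᶠ y in 𝓝 x, ‖y‖ < (m : ℝ) + 1 :=
            (continuous_norm.tendsto x).eventually (gt_mem_nhds hx)
          filter_upwards [this] with y hy
          have : v m y = 1 := hu1 _ (by
            rw [norm_smul, norm_inv, Real.norm_of_nonneg hm.le, inv_mul_le_iff₀ hm]
            linarith)
          simp [this]
        rw [(h0.iteratedFDeriv (𝕜 := ℝ) l).eq_of_nhds]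
        simp only [iteratedFDeriv_fun_zero, Pi.zero_apply, norm_zero, mul_zero]
        exact mul_nonneg (Finset.sum_nonneg fun i _ =>
          mul_nonneg (mul_nonneg (by positivity) (hC0 i)) (apply_nonneg _ _)) (by positivity)
      · have h1 := norm_iteratedFDeriv_smul_le (𝕜 := ℝ) (f := fun x => v m x - 1) (g := f)
          (N := ∞) ((hv m).sub contDiff_const) (f.smooth ⊤) x (n := l) (mod_cast le_top)
        have h2 : ∀ i, ‖x‖ ^ k * ‖iteratedFDeriv ℝ (l - i) f x‖ ≤
            SchwartzMap.seminorm ℝ (k + 1) (l - i) f * ((m : ℝ) + 1)⁻¹ := by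
          intro i
          have h3 := SchwartzMap.le_seminorm ℝ (k + 1) (l - i) f x
          rw [← div_eq_mul_inv, le_div_iff₀ hm]
          refine le_trans ?_ h3
          rw [pow_succ]
          nlinarith [mul_nonneg (pow_nonneg (norm_nonneg x) k)
            (norm_nonneg (iteratedFDeriv ℝ (l - i) f x))]
        calc ‖x‖ ^ k * ‖iteratedFDeriv ℝ l (fun x => (v m x - 1) • f x) x‖
            ≤ ‖x‖ ^ k * ∑ i ∈ Finset.range (l + 1), (l.choose i : ℝ) *
              ‖iteratedFDeriv ℝ i (fun x => v m x - 1) x‖ * ‖iteratedFDeriv ℝ (l - i) f x‖ := by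
              gcongr
          _ = ∑ i ∈ Finset.range (l + 1), ((l.choose i : ℝ) *
              ‖iteratedFDeriv ℝ i (fun x => v m x - 1) x‖) *
                (‖x‖ ^ k * ‖iteratedFDeriv ℝ (l - i) f x‖) := by
              rw [Finset.mul_sum]; refine Finset.sum_congr rfl fun i _ => by ring
          _ ≤ ∑ i ∈ Finset.range (l + 1), ((l.choose i : ℝ) * C i) *
                (SchwartzMap.seminorm ℝ (k + 1) (l - i) f * ((m : ℝ) + 1)⁻¹) := by
              refine Finset.sum_le_sum fun i _ => ?_
              exact mul_le_mul (mul_le_mul_of_nonneg_left (hC i m x) (by positivity)) (h2 i)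
                (by positivity) (mul_nonneg (by positivity) (hC0 i))
          _ = _ := by
              rw [Finset.sum_mul]; refine Finset.sum_congr rfl fun i _ => by ring

/-- Multiples of the Gaussian are dense. -/
theorem eq_zero_of_apply_mulGaussian (Λ : State D) (hΛ : ∀ f, Λ (mulGaussian D f) = 0)
    (f : 𝓢(Space D, ℂ)) : Λ f = 0 := by
  obtain ⟨f', hf', hF⟩ := exists_hasCompactSupport_seminorm_le f
  obtain ⟨C, hC⟩ := exists_norm_apply_le Λ (fun m => f' m - f) (fun m : ℕ => ((m : ℝ) + 1)⁻¹)
    (fun m => by positivity) hF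
  have hΛF : ∀ m, Λ (f' m - f) = -Λ f := by
    intro m
    rw [map_sub, apply_eq_zero_of_hasCompactSupport Λ hΛ _ (hf' m), zero_sub]
  simp_rw [hΛF, norm_neg] at hC
  have ht : Tendsto (fun m : ℕ => C * ((m : ℝ) + 1)⁻¹) atTop (𝓝 0) := by
    simpa using (tendsto_one_div_add_atTop_nhds_zero_nat (𝕜 := ℝ)).const_mul C
  exact norm_le_zero_iff.1 (ge_of_tendsto' ht hC)

end LadderOperators

end

/-! ### Completeness of polynomials times radial functions -/

noncomputable section

namespace LadderOperators

open MvPolynomial MeasureTheory Set Filter Topology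
open scoped ContDiff

variable {D : ℕ}

theorem integral_norm_mul_le (φ : 𝓢(Space D, ℂ)) (p : ℕ) :
    ∫ v, ‖v‖ ^ p * ‖mulGaussian D φ v‖ ≤
      (∫ v, (‖v‖ ^ p * ‖gaussian D v‖) ^ (2 : ℝ)) ^ (1 / 2 : ℝ) *
        ‖φ.toLp 2 (volume : Measure (Space D))‖ := by
  have h1 : MemLp (fun v : Space D => ‖v‖ ^ p * ‖gaussian D v‖) (ENNReal.ofReal 2) := by
    have hE : ENNReal.ofReal 2 = 2 := by simp
    rw [hE, memLp_two_iff_integrable_sq_norm]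
    · have h2 : Integrable (fun v : Space D => ‖v‖ ^ (2 * p) * ‖gaussian D v‖) :=
        (gaussian D).integrable_pow_mul volume (2 * p)
      obtain ⟨C, hC⟩ := (gaussian D).decay 0 0
      refine (h2.mul_const C).mono' (by fun_prop) (Eventually.of_forall fun v => ?_)
      have h3 := hC.2 v
      simp only [pow_zero, one_mul, norm_iteratedFDeriv_zero] at h3
      rw [norm_pow, norm_norm, norm_mul, norm_pow, norm_norm, norm_norm, mul_pow, ← pow_mul,
        mul_comm p 2, pow_two, ← mul_assoc]
      gcongr
    · fun_prop
  have h2 : MemLp (fun v : Space D => ‖φ v‖) (ENNReal.ofReal 2) := by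
    have hE : ENNReal.ofReal 2 = 2 := by simp
    rw [hE]; exact (φ.memLp 2).norm
  have h3 := integral_mul_le_Lp_mul_Lq_of_nonneg Real.HolderConjugate.two_two
    (Eventually.of_forall fun v => by positivity) (Eventually.of_forall fun v => norm_nonneg _) h1 h2
  rw [SchwartzMap.norm_toLp' (by simp) (by simp)]
  refine le_trans (le_of_eq ?_) (h3.trans (le_of_eq ?_))
  · refine integral_congr_ae (Eventually.of_forall fun v => ?_)
    simp [mulGaussian_apply, mul_assoc]
  · simp

/-- By Leibniz the Gaussian supplies all the decay, so unweighted bounds on the derivatives of `f`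
control every Schwartz seminorm. -/
theorem seminorm_mulGaussian_le (k l : ℕ) : ∃ B : ℕ → ℝ, (∀ i, 0 ≤ B i) ∧ ∀ f : 𝓢(Space D, ℂ),
    ∀ M : ℕ → ℝ, (∀ i x, ‖iteratedFDeriv ℝ i f x‖ ≤ M i) →
      SchwartzMap.seminorm ℂ k l (mulGaussian D f) ≤ ∑ i ∈ Finset.range (l + 1), B i * M (l - i) := by
  refine ⟨fun i => (l.choose i : ℝ) * SchwartzMap.seminorm ℝ k i (gaussian D),
    fun i => mul_nonneg (by positivity) (apply_nonneg _ _), fun f M hM => ?_⟩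
  have hM0 : ∀ i, 0 ≤ M i := fun i => (norm_nonneg _).trans (hM i 0)
  refine SchwartzMap.seminorm_le_bound ℂ k l _ (Finset.sum_nonneg fun i _ =>
    mul_nonneg (mul_nonneg (by positivity) (apply_nonneg _ _)) (hM0 _)) fun x => ?_
  have h1 := norm_iteratedFDeriv_mul_le (𝕜 := ℝ) (f := gaussian D) (g := f)
    (N := ∞) ((gaussian D).smooth ⊤) (f.smooth ⊤) x (n := l) (mod_cast le_top)
  have h2 : (mulGaussian D f : Space D → ℂ) = fun y => gaussian D y * f y := by
    ext y; exact mulGaussian_apply f y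
  rw [h2]
  calc ‖x‖ ^ k * ‖iteratedFDeriv ℝ l (fun y => gaussian D y * f y) x‖
      ≤ ‖x‖ ^ k * ∑ i ∈ Finset.range (l + 1), (l.choose i : ℝ) *
        ‖iteratedFDeriv ℝ i (gaussian D) x‖ * ‖iteratedFDeriv ℝ (l - i) f x‖ := by gcongr
    _ = ∑ i ∈ Finset.range (l + 1), ((l.choose i : ℝ) *
        (‖x‖ ^ k * ‖iteratedFDeriv ℝ i (gaussian D) x‖)) * ‖iteratedFDeriv ℝ (l - i) f x‖ := by
        rw [Finset.mul_sum]; refine Finset.sum_congr rfl fun i _ => by ring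
    _ ≤ _ := by
        refine Finset.sum_le_sum fun i _ => ?_
        refine mul_le_mul (mul_le_mul_of_nonneg_left (SchwartzMap.le_seminorm ℝ k i _ x)
          (by positivity)) (hM _ x) (norm_nonneg _) (mul_nonneg (by positivity) (apply_nonneg _ _))

/-- Derivatives of a Fourier transform are bounded by weighted L¹ norms of the function, and by
Cauchy–Schwarz the Gaussian turns these into the L² norm. -/
theorem norm_iteratedFDeriv_fourier_mulGaussian_le (j : ℕ) : ∃ B : ℝ, 0 ≤ B ∧
    ∀ (φ : 𝓢(Space D, ℂ)) (x : Space D), ‖iteratedFDeriv ℝ j (𝓕 (mulGaussian D φ) : 𝓢(Space D, ℂ)) x‖ ≤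
      B * ‖φ.toLp 2 (volume : Measure (Space D))‖ := by
  refine ⟨(2 * Real.pi) ^ j * ∑ p ∈ Finset.range (j + 1),
    (∫ v, (‖v‖ ^ p * ‖gaussian D v‖) ^ (2 : ℝ)) ^ (1 / 2 : ℝ), ?_, fun φ x => ?_⟩
  · exact mul_nonneg (by positivity) (Finset.sum_nonneg fun p _ =>
      Real.rpow_nonneg (integral_nonneg fun v => by positivity) _)
  · have h := Real.pow_mul_norm_iteratedFDeriv_fourier_le (K := ⊤) (N := ⊤)
      ((mulGaussian D φ).smooth ⊤) (fun k n _ _ =>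
        (mulGaussian D φ).integrable_pow_mul_iteratedFDeriv volume k n) (k := j) (n := 0)
        le_top le_top x
    rw [← SchwartzMap.fourier_coe] at h
    simp only [pow_zero, one_mul, mul_one, zero_add, Finset.range_one, Finset.product_singleton,
      Finset.sum_map, Function.Embedding.coeFn_mk, norm_iteratedFDeriv_zero] at h
    refine h.trans ?_
    rw [mul_assoc, Finset.sum_mul]
    gcongr with p hp
    exact integral_norm_mul_le φ p

/-- The distribution `φ ↦ ψ (G 𝓕 (G φ))` is given by a square integrable function. -/
theorem exists_memLp_eq (ψ : State D) : ∃ g : Space D → ℂ, MemLp g 2 ∧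
    ∀ φ : 𝓢(Space D, ℂ), ψ (mulGaussian D (𝓕 (mulGaussian D φ))) = ∫ x, g x * φ x := by
  have hb : ∃ C : ℝ, ∀ φ : 𝓢(Space D, ℂ), ‖ψ (mulGaussian D (𝓕 (mulGaussian D φ)))‖ ≤
      C * ‖φ.toLp 2 (volume : Measure (Space D))‖ := by
    refine exists_norm_apply_le ψ (fun φ : 𝓢(Space D, ℂ) => mulGaussian D (𝓕 (mulGaussian D φ)))
      (fun φ => ‖φ.toLp 2 (volume : Measure (Space D))‖) (fun _ => norm_nonneg _) fun k l => ?_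
    obtain ⟨B, hB0, hB⟩ := seminorm_mulGaussian_le (D := D) k l
    choose A hA0 hA using norm_iteratedFDeriv_fourier_mulGaussian_le (D := D)
    refine ⟨∑ i ∈ Finset.range (l + 1), B i * A (l - i),
      Finset.sum_nonneg fun i _ => mul_nonneg (hB0 _) (hA0 _), fun φ => ?_⟩
    refine (hB _ (fun j => A j * ‖φ.toLp 2 (volume : Measure (Space D))‖)
      fun j x => hA j φ x).trans (le_of_eq ?_)
    rw [Finset.sum_mul]
    exact Finset.sum_congr rfl fun i _ => by ring
  let T : 𝓢(Space D, ℂ) →ₗ[ℂ] ℂ :=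
    { toFun := fun φ => ψ (mulGaussian D (𝓕 (mulGaussian D φ)))
      map_add' := fun a b => by rw [map_add, FourierTransform.fourier_add, map_add, map_add]
      map_smul' := fun a b => by
        rw [map_smul, FourierTransform.fourier_smul, map_smul, map_smul]; rfl }
  let e : 𝓢(Space D, ℂ) →ₗ[ℂ] Lp ℂ 2 (volume : Measure (Space D)) :=
    (SchwartzMap.toLpCLM ℂ ℂ 2 (volume : Measure (Space D))).toLinearMap
  have hdense : DenseRange e :=
    SchwartzMap.denseRange_toLpCLM (E := Space D) (F := ℂ) (p := 2) (μ := volume) (by simp)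
  have hT : ∀ φ, T.extendOfNorm e (e φ) = T φ := LinearMap.extendOfNorm_eq hdense hb
  -- The functional is bounded for the L² norm, so it extends to L² and Riesz represents it; the
  -- conjugate is taken afterwards because the pairing is bilinear.
  let g₀ := (InnerProductSpace.toDual ℂ (Lp ℂ 2 (volume : Measure (Space D)))).symm
    (T.extendOfNorm e)
  refine ⟨fun x => starRingEnd ℂ (g₀ x), (Lp.memLp g₀).star, fun φ => ?_⟩
  have h1 : inner ℂ g₀ (e φ) = T φ := by
    rw [InnerProductSpace.toDual_symm_apply, hT]
  rw [L2.inner_def] at h1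
  change T φ = _
  rw [← h1]
  refine integral_congr_ae ?_
  filter_upwards [φ.coeFn_toLp 2 (volume : Measure (Space D))] with x hx
  have : (e φ : Space D → ℂ) x = φ x := hx
  rw [this]
  simp [mul_comm]

/-- A square integrable function whose product with the Gaussian is orthogonal to all polynomials
is orthogonal to all multiples of the Gaussian. -/
theorem integral_mulGaussian_eq_zero {g : Space D → ℂ} (hg : MemLp g 2)
    (hgQ : ∀ Q : MvPolynomial (Fin D) ℂ, ∫ x, g x * radial Q (expS 1 one_pos) x = 0)
    (f : 𝓢(Space D, ℂ)) : ∫ x, g x * mulGaussian D f x = 0 := by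
  set h : Space D → ℂ := fun x => g x * gaussian D x with hh
  have hint : Integrable h := hg.integrable_mul ((gaussian D).memLp 2)
  -- Half of the Gaussian exponent absorbs exp(c‖x‖) by completing the square; the other half still
  -- makes the product with `g` integrable.
  have hexp : ∀ c : ℝ, Integrable fun x => ‖h x‖ * Real.exp (c * ‖x‖) := by
    intro c
    have h1 : Integrable (fun x => g x * radial 1 (expS (1 / 2) one_half_pos) x) :=
      hg.integrable_mul ((radial 1 (expS (1 / 2) one_half_pos)).memLp 2)
    refine (h1.norm.mul_const (Real.exp (c ^ 2 / (2 * Real.pi)))).mono' ?_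
      (Eventually.of_forall fun x => ?_)
    · exact hint.1.norm.mul (by fun_prop)
    · simp only [hh, norm_mul, radial_expS_apply, gaussian_apply,
        ← Complex.ofReal_neg, Complex.norm_exp_ofReal, Real.norm_eq_abs, Real.abs_exp]
      have h2 : ‖polyFun (1 : MvPolynomial (Fin D) ℂ) x‖ = 1 := by simp [polyFun]
      rw [h2, one_mul, abs_norm, mul_assoc, mul_assoc, ← Real.exp_add, ← Real.exp_add]
      refine mul_le_mul_of_nonneg_left (Real.exp_le_exp.2 ?_) (norm_nonneg (g x))
      have hpi := Real.pi_pos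
      have h3 : c ^ 2 / (2 * Real.pi) - c * ‖x‖ + Real.pi / 2 * ‖x‖ ^ 2 =
          (c - Real.pi * ‖x‖) ^ 2 / (2 * Real.pi) := by field_simp; ring
      have h4 : 0 ≤ (c - Real.pi * ‖x‖) ^ 2 / (2 * Real.pi) := by positivity
      linarith
  -- The exponential moments justify expanding the Fourier kernel in its power series under the
  -- integral; each term is a polynomial, to which `h` is orthogonal.
  have hF : ∀ y : Space D, 𝓕 h y = 0 := by
    intro y
    let q : MvPolynomial (Fin D) ℂ := ∑ μ, C (y μ : ℂ) * X μ
    have hq : ∀ x : Space D, polyFun q x = ((inner ℝ x y : ℝ) : ℂ) := by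
      intro x
      simp [q, polyFun, PiLp.inner_apply, mul_comm]
    have h1 := hasSum_integral_of_dominated_convergence (μ := (volume : Measure (Space D)))
      (F := fun (k : ℕ) x => h x * ((-(2 * Real.pi * Complex.I) * (inner ℝ x y : ℝ)) ^ k / k.factorial))
      (f := fun x => h x * Complex.exp (-(2 * Real.pi * Complex.I) * (inner ℝ x y : ℝ)))
      (fun k x => ‖h x‖ * ((2 * Real.pi * ‖y‖ * ‖x‖) ^ k / k.factorial)) ?_ ?_ ?_ ?_ ?_
    · have h2 : ∀ k : ℕ, ∫ x, h x * ((-(2 * Real.pi * Complex.I) * (inner ℝ x y : ℝ)) ^ k /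
          k.factorial) = 0 := by
        intro k
        have h3 := hgQ (C ((-(2 * Real.pi * Complex.I)) ^ k / k.factorial) * q ^ k)
        rw [← h3]
        refine integral_congr_ae (Eventually.of_forall fun x => ?_)
        have h4 : polyFun (C ((-(2 * Real.pi * Complex.I)) ^ k / k.factorial) * q ^ k) x =
            (-(2 * Real.pi * Complex.I)) ^ k / k.factorial * polyFun q x ^ k := by
          simp [polyFun]
        simp only [hh]
        rw [radial_expS_apply, h4, hq, gaussian_apply, mul_pow, mul_one]
        ring
      simp_rw [h2] at h1
      have h5 := h1.unique hasSum_zero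
      rw [Real.fourier_eq', ← h5]
      refine integral_congr_ae (Eventually.of_forall fun x => ?_)
      simp only [smul_eq_mul]
      rw [mul_comm]
      congr 2
      push_cast; ring
    · intro k
      exact hint.1.mul (by fun_prop)
    · intro k
      refine Eventually.of_forall fun x => ?_
      have hn : ‖-(2 * Real.pi * Complex.I) * ((inner ℝ x y : ℝ) : ℂ)‖ ≤
          2 * Real.pi * ‖y‖ * ‖x‖ := by
        have h1 := norm_inner_le_norm (𝕜 := ℝ) x y
        simp only [norm_mul, norm_neg, Complex.norm_ofNat, Complex.norm_real, Complex.norm_I,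
          mul_one, Real.norm_of_nonneg Real.pi_pos.le]
        rw [mul_assoc _ ‖y‖, mul_comm ‖y‖]
        gcongr
      rw [norm_mul (h x), norm_div, norm_pow, Complex.norm_natCast]
      gcongr
    · refine Eventually.of_forall fun x => (Real.summable_pow_div_factorial _).mul_left _
    · refine (hexp (2 * Real.pi * ‖y‖)).congr (Eventually.of_forall fun x => ?_)
      simp only
      rw [tsum_mul_left, Real.exp_eq_exp_ℝ, NormedSpace.exp_eq_tsum_div]
    · refine Eventually.of_forall fun x => ?_
      refine HasSum.mul_left _ ?_
      rw [Complex.exp_eq_exp_ℂ]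
      exact NormedSpace.expSeries_div_hasSum_exp _
  have hswap := VectorFourier.integral_fourierIntegral_smul_eq_flip (L := innerₗ (Space D))
    Real.continuous_fourierChar continuous_inner hint (𝓕⁻ f).integrable (ν := volume)
  have h1 : ∫ x, h x * f x = 0 := by
    have h2 : ∫ ξ, 𝓕 h ξ • (𝓕⁻ f : 𝓢(Space D, ℂ)) ξ =
        ∫ x, h x • 𝓕 ((𝓕⁻ f : 𝓢(Space D, ℂ)) : Space D → ℂ) x := by
      rw [flip_innerₗ] at hswap
      exact hswap
    rw [← SchwartzMap.fourier_coe, FourierTransform.fourier_fourierInv_eq] at h2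
    simp only [smul_eq_mul] at h2
    rw [← h2]
    simp [hF]
  rw [← h1]
  refine integral_congr_ae (Eventually.of_forall fun x => ?_)
  simp only [hh, mulGaussian_apply, mul_assoc]

theorem mulGaussian_radial (Q : MvPolynomial (Fin D) ℂ) (h : 𝓢(ℝ, ℂ)) :
    mulGaussian D (radial Q h) = radial Q (SchwartzMap.smulLeftCLM ℂ (expS 1 one_pos) h) := by
  ext x
  rw [mulGaussian_apply, radial_apply, radial_apply,
    SchwartzMap.smulLeftCLM_apply_apply (expS 1 one_pos).hasTemperateGrowth, gaussian, radial_apply]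
  simp [polyFun]; ring

/-- A tempered distribution which vanishes on all products of a polynomial and a radial function is
zero. -/
theorem eq_zero_of_apply_radial (ψ : State D)
    (hψ : ∀ (Q : MvPolynomial (Fin D) ℂ) (h : 𝓢(ℝ, ℂ)), ψ (radial Q h) = 0) : ψ = 0 := by
  obtain ⟨g, hg, hgφ⟩ := exists_memLp_eq ψ
  have hgQ : ∀ Q : MvPolynomial (Fin D) ℂ, ∫ x, g x * radial Q (expS 1 one_pos) x = 0 := by
    intro Q
    have h1 : mulGaussian D (radial Q (expS 1 one_pos)) = radial Q (expS 2 two_pos) := by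
      rw [mulGaussian_radial]
      refine radial_congr Q fun u hu => ?_
      rw [SchwartzMap.smulLeftCLM_apply_apply (expS 1 one_pos).hasTemperateGrowth,
        expS_apply _ _ (by linarith), expS_apply _ _ (by linarith), smul_eq_mul, ← Complex.exp_add]
      congr 1
      push_cast; ring
    obtain ⟨R, hR⟩ := exists_fourier_radial_expS 2 two_pos Q
    rw [← hgφ, h1, hR, mulGaussian_radial, hψ]
  have h1 : ∀ f, ψ (mulGaussian D (𝓕 (mulGaussian D (mulGaussian D f)))) = 0 := fun f => by
    rw [hgφ, integral_mulGaussian_eq_zero hg hgQ]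
  -- The Gaussian factors are now removed one after another by density, with the inversion of the
  -- Fourier transform in between.
  let Λ : State D := 𝓕 (TemperedDistribution.smulLeftCLM ℂ (gaussian D) ψ)
  have hΛ : ∀ f, Λ f = ψ (mulGaussian D (𝓕 f)) := fun f => rfl
  have h2 : ∀ f, Λ (mulGaussian D f) = 0 := fun f =>
    eq_zero_of_apply_mulGaussian (TemperedDistribution.smulLeftCLM ℂ (gaussian D) Λ)
      (fun f => h1 f) f
  have h3 : ∀ f, ψ (mulGaussian D f) = 0 := fun f => by
    have := eq_zero_of_apply_mulGaussian Λ h2 (𝓕⁻ f)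
    rwa [hΛ, FourierTransform.fourier_fourierInv_eq] at this
  ext f
  exact eq_zero_of_apply_mulGaussian ψ h3 f

end LadderOperators

end

/-! ### Flat sums of exponentials and their Mellin transforms -/

noncomputable section

namespace LadderOperators

open MeasureTheory Set Filter Topology
open scoped ContDiff

variable {ι : Type*} {a : ι → ℝ} {w : ι → ℂ}

/-- The function `∑ wᵢ exp (-π aᵢ u)`. -/
def expSum (a : ι → ℝ) (w : ι → ℂ) (u : ℝ) : ℂ := ∑' i, w i * Complex.exp (-(Real.pi * a i * u : ℝ))

/-- The weights `w` decay rapidly with respect to the positive numbers `a`, and all derivatives of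
`expSum a w` vanish at `0`. -/
structure IsFlat (a : ι → ℝ) (w : ι → ℂ) : Prop where
  pos : ∀ i, 0 < a i
  summable : ∀ r : ℝ, Summable fun i => ‖w i‖ * a i ^ r
  tsum_eq_zero : ∀ m : ℕ, ∑' i, w i * (a i : ℂ) ^ m = 0

/-- Differentiating `expSum` multiplies the weights by -π aᵢ; flatness survives, which makes
induction on the order of the derivative possible. -/
theorem IsFlat.mul (h : IsFlat a w) : IsFlat a fun i => w i * a i where
  pos := h.pos
  summable r := by
    refine (h.summable (r + 1)).congr fun i => ?_
    rw [norm_mul, Complex.norm_real, Real.norm_of_nonneg (h.pos i).le, mul_assoc,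
      Real.rpow_add_one (h.pos i).ne', mul_comm (a i)]
  tsum_eq_zero m := by
    rw [← h.tsum_eq_zero (m + 1)]
    exact tsum_congr fun i => by ring

theorem IsFlat.summable_pow (h : IsFlat a w) (n : ℕ) : Summable fun i => ‖w i‖ * a i ^ n := by
  simpa using h.summable n

/-- For x ≤ 1 this is the Taylor remainder, with e ≤ 3; for x ≥ 1 each of the N + 1 terms is at most
x^N. -/
theorem norm_exp_neg_sub_sum_le (N : ℕ) {x : ℝ} (hx : 0 ≤ x) :
    ‖Complex.exp (-(x : ℝ)) - ∑ m ∈ Finset.range N, (-(x : ℂ)) ^ m / m.factorial‖ ≤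
      (N + 3) * x ^ N := by
  rcases le_total x 1 with h1 | h1
  · refine (Complex.norm_exp_sub_sum_le_norm_mul_exp _ N).trans ?_
    rw [norm_neg, Complex.norm_real, Real.norm_of_nonneg hx, mul_comm]
    have : Real.exp x ≤ 3 := (Real.exp_le_exp.2 h1).trans Real.exp_one_lt_three.le
    have h0 : (0 : ℝ) ≤ N := by positivity
    gcongr
    linarith
  · refine (norm_sub_le _ _).trans ?_
    have h2 : ‖Complex.exp (-(x : ℝ))‖ ≤ x ^ N := by
      rw [← Complex.ofReal_neg, Complex.norm_exp_ofReal]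
      exact (Real.exp_le_one_iff.2 (by linarith)).trans (one_le_pow₀ h1)
    have h3 : ‖∑ m ∈ Finset.range N, (-(x : ℂ)) ^ m / m.factorial‖ ≤ N * x ^ N := by
      refine (norm_sum_le_of_le (f := fun m : ℕ => (-(x : ℂ)) ^ m / m.factorial)
        (n := fun _ => x ^ N) _ fun m hm => ?_).trans (by simp)
      rw [norm_div, norm_pow, norm_neg, Complex.norm_real, Real.norm_of_nonneg hx,
        Complex.norm_natCast]
      refine (div_le_self (by positivity) (mod_cast m.factorial_pos)).trans ?_
      exact pow_le_pow_right₀ h1 (Finset.mem_range.1 hm).le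
    have h4 : 0 ≤ x ^ N := by positivity
    linarith

theorem IsFlat.summable_exp (h : IsFlat a w) {u : ℝ} (hu : 0 ≤ u) :
    Summable fun i => w i * Complex.exp (-(Real.pi * a i * u : ℝ)) := by
  refine .of_norm_bounded (h.summable_pow 0) fun i => ?_
  rw [norm_mul, ← Complex.ofReal_neg, Complex.norm_exp_ofReal, pow_zero]
  have := h.pos i
  gcongr
  exact Real.exp_le_one_iff.2 (neg_nonpos.2 (by positivity))

/-- Since ∑ wᵢ aᵢ^m = 0, subtracting the Taylor polynomial from each exponential does not change the
sum. -/
theorem IsFlat.norm_expSum_le_pow (h : IsFlat a w) (N : ℕ) :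
    ∃ C, 0 ≤ C ∧ ∀ u : ℝ, 0 < u → ‖expSum a w u‖ ≤ C * u ^ N := by
  have hpos := h.pos
  refine ⟨∑' i, ‖w i‖ * a i ^ N * ((N + 3) * Real.pi ^ N), tsum_nonneg fun i => by
    have := h.pos i; positivity, fun u hu => ?_⟩
  have h1 : HasSum (fun i => w i * ∑ m ∈ Finset.range N,
      (-((Real.pi * a i * u : ℝ) : ℂ)) ^ m / m.factorial) 0 := by
    have h2 : HasSum (fun i => ∑ m ∈ Finset.range N,
        (w i * (a i : ℂ) ^ m) * ((-(Real.pi * u)) ^ m / m.factorial)) (∑ m ∈ Finset.range N,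
          0 * ((-(Real.pi * u : ℂ)) ^ m / m.factorial)) := by
      refine hasSum_sum fun m _ => ?_
      refine HasSum.mul_right _ ?_
      rw [← h.tsum_eq_zero m]
      refine (Summable.of_norm ((h.summable_pow m).congr fun i => ?_)).hasSum
      rw [norm_mul, norm_pow, Complex.norm_real, Real.norm_of_nonneg (h.pos i).le]
    simp only [zero_mul, Finset.sum_const_zero] at h2
    refine h2.congr_fun ?_
    intro i
    rw [Finset.mul_sum]
    refine Finset.sum_congr rfl fun m _ => ?_
    push_cast
    rw [show (-(Real.pi * a i * u) : ℂ) = a i * (-(Real.pi * u)) by ring, mul_pow]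
    ring
  have h3 := (h.summable_exp hu.le).hasSum.sub h1
  rw [sub_zero] at h3
  rw [expSum, ← h3.tsum_eq, ← tsum_mul_right]
  refine tsum_of_norm_bounded (((h.summable_pow N).mul_right _).mul_right _).hasSum fun i => ?_
  rw [← mul_sub, norm_mul]
  have h4 := norm_exp_neg_sub_sum_le N (x := Real.pi * a i * u) (by have := h.pos i; positivity)
  calc _ ≤ ‖w i‖ * ((N + 3) * (Real.pi * a i * u) ^ N) := by gcongr
    _ = _ := by rw [mul_pow, mul_pow]; ring

theorem IsFlat.norm_expSum_le_inv_pow (h : IsFlat a w) (N : ℕ) :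
    ∃ C, 0 ≤ C ∧ ∀ u : ℝ, 0 < u → ‖expSum a w u‖ ≤ C * (u ^ N)⁻¹ := by
  refine ⟨∑' i, ‖w i‖ * a i ^ (-N : ℝ) * (N.factorial * (Real.pi ^ N)⁻¹), tsum_nonneg fun i => by
    have := h.pos i; positivity, fun u hu => ?_⟩
  rw [expSum, ← tsum_mul_right]
  refine tsum_of_norm_bounded (((h.summable _).mul_right _).mul_right _).hasSum fun i => ?_
  rw [norm_mul, ← Complex.ofReal_neg, Complex.norm_exp_ofReal, Real.rpow_neg (h.pos i).le,
    Real.rpow_natCast, Real.exp_neg]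
  have hpos := h.pos i
  have h4 := Real.pow_div_factorial_le_exp (Real.pi * a i * u) (by positivity) N
  calc _ ≤ ‖w i‖ * ((Real.pi * a i * u) ^ N / N.factorial)⁻¹ := by
        gcongr
    _ = _ := by rw [mul_pow, mul_pow]; field_simp

theorem IsFlat.norm_expSum_le_rpow (h : IsFlat a w) (r : ℝ) :
    ∃ C, 0 ≤ C ∧ ∀ u : ℝ, 0 < u → ‖expSum a w u‖ ≤ C * u ^ r := by
  obtain ⟨N, hN⟩ := exists_nat_ge |r|
  obtain ⟨C, hC0, hC⟩ := h.norm_expSum_le_pow N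
  obtain ⟨C', hC'0, hC'⟩ := h.norm_expSum_le_inv_pow N
  refine ⟨C + C', by positivity, fun u hu => ?_⟩
  rw [add_mul]
  rcases le_total u 1 with h1 | h1
  · refine (hC u hu).trans ?_
    rw [← Real.rpow_natCast]
    have : u ^ (N : ℝ) ≤ u ^ r := Real.rpow_le_rpow_of_exponent_ge hu h1 ((le_abs_self r).trans hN)
    have : 0 ≤ C' * u ^ r := by positivity
    nlinarith
  · refine (hC' u hu).trans ?_
    rw [← Real.rpow_natCast, ← Real.rpow_neg hu.le]
    have : u ^ (-N : ℝ) ≤ u ^ r := Real.rpow_le_rpow_of_exponent_le h1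
      (by have := neg_abs_le r; linarith)
    have : 0 ≤ C * u ^ r := by positivity
    nlinarith

theorem IsFlat.hasDerivAt_expSum (h : IsFlat a w) {u : ℝ} (hu : 0 < u) :
    HasDerivAt (expSum a w) (-Real.pi * expSum a (fun i => w i * a i) u) u := by
  have h1 := hasDerivAt_tsum_of_isPreconnected (t := Ioi (0 : ℝ)) (y₀ := u) (y := u)
    (g := fun i u => w i * Complex.exp (-(Real.pi * a i * u : ℝ)))
    (g' := fun i u => -Real.pi * (w i * a i * Complex.exp (-(Real.pi * a i * u : ℝ))))
    ((h.summable_pow 1).mul_left Real.pi) isOpen_Ioi isPreconnected_Ioi ?_ ?_ hu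
    (h.summable_exp hu.le) hu
  · rwa [tsum_mul_left] at h1
  · intro i y _
    have h2 : HasDerivAt (fun y : ℝ => -((Real.pi * a i * y : ℝ) : ℂ))
        (-((Real.pi * a i : ℝ) : ℂ)) y := by
      have : HasDerivAt (fun y : ℝ => Real.pi * a i * y) (Real.pi * a i) y := by
        simpa using (hasDerivAt_id y).const_mul (Real.pi * a i)
      exact this.ofReal_comp.neg
    exact (h2.cexp.const_mul (w i)).congr_deriv (by push_cast; ring)
  · intro i y hy
    have hy' : (0 : ℝ) < y := hy
    have := h.pos i
    simp only [norm_mul, norm_neg, Complex.norm_real, Real.norm_of_nonneg Real.pi_pos.le,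
      ← Complex.ofReal_neg, Complex.norm_exp_ofReal, Real.norm_of_nonneg this.le, pow_one]
    have h3 : Real.exp (-(Real.pi * a i * y)) ≤ 1 :=
      Real.exp_le_one_iff.2 (neg_nonpos.2 (by positivity))
    calc _ ≤ Real.pi * (‖w i‖ * a i * 1) := by gcongr
      _ = _ := by ring

/-- The function `u ^ β ∑ wᵢ exp (-π aᵢ u)` on `u > 0`, extended by zero. -/
def powExpSum (a : ι → ℝ) (w : ι → ℂ) (β : ℂ) (u : ℝ) : ℂ :=
  if 0 < u then (u : ℂ) ^ β * expSum a w u else 0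

theorem powExpSum_of_pos (β : ℂ) {u : ℝ} (hu : 0 < u) :
    powExpSum a w β u = (u : ℂ) ^ β * expSum a w u := if_pos hu

theorem powExpSum_of_nonpos (β : ℂ) {u : ℝ} (hu : u ≤ 0) : powExpSum a w β u = 0 :=
  if_neg hu.not_gt

theorem IsFlat.norm_powExpSum_le (h : IsFlat a w) (β : ℂ) (k : ℕ) :
    ∃ C, 0 ≤ C ∧ ∀ u : ℝ, ‖powExpSum a w β u‖ ≤ C * |u| ^ k := by
  obtain ⟨C, hC0, hC⟩ := h.norm_expSum_le_rpow (k - β.re)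
  refine ⟨C, hC0, fun u => ?_⟩
  rcases lt_or_ge 0 u with hu | hu
  · rw [powExpSum_of_pos β hu, norm_mul, Complex.norm_cpow_eq_rpow_re_of_pos hu, abs_of_pos hu]
    calc _ ≤ u ^ β.re * (C * u ^ (k - β.re)) := by gcongr; exact hC u hu
      _ = C * (u ^ β.re * u ^ (k - β.re)) := by ring
      _ = _ := by rw [← Real.rpow_add hu, add_sub_cancel, Real.rpow_natCast]
  · rw [powExpSum_of_nonpos β hu, norm_zero]; positivity

theorem IsFlat.pow_mul_norm_powExpSum_le (h : IsFlat a w) (β : ℂ) (k : ℕ) :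
    ∃ C, ∀ u : ℝ, ‖u‖ ^ k * ‖powExpSum a w β u‖ ≤ C := by
  obtain ⟨C, hC0, hC⟩ := h.norm_expSum_le_rpow (-k - β.re)
  refine ⟨C, fun u => ?_⟩
  rcases lt_or_ge 0 u with hu | hu
  · rw [powExpSum_of_pos β hu, norm_mul, Complex.norm_cpow_eq_rpow_re_of_pos hu,
      Real.norm_of_nonneg hu.le]
    calc _ ≤ u ^ k * (u ^ β.re * (C * u ^ (-k - β.re))) := by gcongr; exact hC u hu
      _ = C * (u ^ (k : ℝ) * u ^ β.re * u ^ (-k - β.re)) := by rw [Real.rpow_natCast]; ring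
      _ = C := by rw [← Real.rpow_add hu, ← Real.rpow_add hu]; simp
  · rw [powExpSum_of_nonpos β hu, norm_zero, mul_zero]; positivity

theorem IsFlat.hasDerivAt_powExpSum (h : IsFlat a w) (β : ℂ) (u : ℝ) :
    HasDerivAt (powExpSum a w β) (β * powExpSum a w (β - 1) u -
      Real.pi * powExpSum a (fun i => w i * a i) β u) u := by
  rcases lt_trichotomy 0 u with hu | rfl | hu
  · have h1 : HasDerivAt (fun y : ℝ => (y : ℂ) ^ β) (β * (u : ℂ) ^ (β - 1)) u := by
      have := (hasDerivAt_id (u : ℂ)).cpow_const (c := β)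
        (Or.inl (by simpa using hu))
      simpa using this.comp_ofReal
    have h2 := h1.mul (h.hasDerivAt_expSum hu)
    rw [powExpSum_of_pos _ hu, powExpSum_of_pos _ hu]
    refine (h2.congr_of_eventuallyEq ?_).congr_deriv (by ring)
    filter_upwards [lt_mem_nhds hu] with y hy
    exact powExpSum_of_pos β hy
  · rw [powExpSum_of_nonpos _ le_rfl, powExpSum_of_nonpos _ le_rfl, mul_zero, mul_zero, sub_zero]
    -- A quadratic bound at the origin already gives derivative 0 there, whatever β is.
    obtain ⟨C, hC0, hC⟩ := h.norm_powExpSum_le β 2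
    rw [hasDerivAt_iff_isLittleO_nhds_zero]
    have h1 : (fun u : ℝ => powExpSum a w β (0 + u) - powExpSum a w β 0 - u • (0 : ℂ)) =O[𝓝 0]
        fun u : ℝ => u ^ 2 := by
      refine .of_bound C (Eventually.of_forall fun u => ?_)
      simp only [zero_add, smul_zero, sub_zero, powExpSum_of_nonpos β le_rfl, norm_pow,
        Real.norm_eq_abs]
      exact hC u
    exact h1.trans_isLittleO (Asymptotics.isLittleO_pow_id one_lt_two)
  · rw [powExpSum_of_nonpos _ hu.le, powExpSum_of_nonpos _ hu.le, mul_zero, mul_zero, sub_zero]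
    refine (hasDerivAt_const u (0 : ℂ)).congr_of_eventuallyEq ?_
    filter_upwards [gt_mem_nhds hu] with y hy
    exact powExpSum_of_nonpos β (le_of_lt hy)

theorem IsFlat.deriv_powExpSum (h : IsFlat a w) (β : ℂ) :
    deriv (powExpSum a w β) = β • powExpSum a w (β - 1) -
      (Real.pi : ℂ) • powExpSum a (fun i => w i * a i) β :=
  funext fun u => (h.hasDerivAt_powExpSum β u).deriv

theorem IsFlat.contDiff_powExpSum (n : ℕ) : ∀ {w : ι → ℂ}, IsFlat a w → ∀ β : ℂ,
    ContDiff ℝ n (powExpSum a w β) := by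
  induction n with
  | zero =>
    intro w h β
    refine contDiff_zero.2 (continuous_iff_continuousAt.2 fun u => ?_)
    exact (h.hasDerivAt_powExpSum β u).continuousAt
  | succ n ih =>
    intro w h β
    push_cast
    refine contDiff_succ_iff_deriv.2 ⟨fun u => (h.hasDerivAt_powExpSum β u).differentiableAt,
      by simp, ?_⟩
    rw [h.deriv_powExpSum]
    exact (contDiff_const.smul (ih h (β - 1))).sub (contDiff_const.smul (ih h.mul β))

theorem IsFlat.decay_powExpSum (k n : ℕ) : ∀ {w : ι → ℂ}, IsFlat a w → ∀ β : ℂ,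
    ∃ C, ∀ u : ℝ, ‖u‖ ^ k * ‖iteratedDeriv n (powExpSum a w β) u‖ ≤ C := by
  induction n with
  | zero =>
    intro w h β
    simpa using h.pow_mul_norm_powExpSum_le β k
  | succ n ih =>
    intro w h β
    obtain ⟨C, hC⟩ := ih h (β - 1)
    obtain ⟨C', hC'⟩ := ih h.mul β
    refine ⟨‖β‖ * C + Real.pi * C', fun u => ?_⟩
    rw [iteratedDeriv_succ', h.deriv_powExpSum]
    have h1 := (IsFlat.contDiff_powExpSum n h (β - 1)).contDiffAt (x := u)
    have h2 := (IsFlat.contDiff_powExpSum n h.mul β).contDiffAt (x := u)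
    have h5 : ContDiffAt ℝ n (β • powExpSum a w (β - 1)) u := contDiffAt_const.smul h1
    have h6 : ContDiffAt ℝ n ((Real.pi : ℂ) • powExpSum a (fun i => w i * a i) β) u :=
      contDiffAt_const.smul h2
    rw [iteratedDeriv_sub h5 h6, iteratedDeriv_const_smul h1 β, iteratedDeriv_const_smul h2]
    refine (mul_le_mul_of_nonneg_left (norm_sub_le _ _) (by positivity)).trans ?_
    rw [norm_smul, norm_smul, Complex.norm_real, Real.norm_of_nonneg Real.pi_pos.le]
    have h3 := mul_le_mul_of_nonneg_left (hC u) (norm_nonneg β)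
    have h4 := mul_le_mul_of_nonneg_left (hC' u) Real.pi_pos.le
    linarith

/-- `powExpSum` as a Schwartz function. -/
def IsFlat.powExpSumS (h : IsFlat a w) (β : ℂ) : 𝓢(ℝ, ℂ) where
  toFun := powExpSum a w β
  smooth' := contDiff_infty.2 fun n => IsFlat.contDiff_powExpSum n h β
  decay' k n := by
    simpa only [norm_iteratedFDeriv_eq_norm_iteratedDeriv] using IsFlat.decay_powExpSum k n h β

theorem IsFlat.powExpSumS_apply (h : IsFlat a w) (β : ℂ) (u : ℝ) :
    h.powExpSumS β u = powExpSum a w β u := rfl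

/-- The Mellin transform of `expSum`. -/
def mellinSum (a : ι → ℝ) (w : ι → ℂ) (s : ℂ) : ℂ := ∫ u : ℝ, powExpSum a w (s - 1) u

theorem powExpSum_eq_indicator (β : ℂ) : powExpSum a w β =
    (Ioi 0).indicator fun u : ℝ => (u : ℂ) ^ β * expSum a w u := by
  ext u
  simp [powExpSum, indicator_apply]

theorem mellinSum_eq (s : ℂ) :
    mellinSum a w s = ∫ u in Ioi (0 : ℝ), (u : ℂ) ^ (s - 1) * expSum a w u := by
  rw [mellinSum, powExpSum_eq_indicator, integral_indicator measurableSet_Ioi]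

theorem IsFlat.moment_powExpSumS (h : IsFlat a w) (β κ : ℂ) :
    moment (h.powExpSumS β) κ = mellinSum a w (κ + β) := by
  rw [mellinSum_eq, moment]
  refine setIntegral_congr_fun measurableSet_Ioi fun u hu => ?_
  have hu' : (0 : ℝ) < u := hu
  simp only [h.powExpSumS_apply, powExpSum_of_pos β hu']
  rw [← mul_assoc, ← Complex.cpow_add _ _ (by exact_mod_cast hu'.ne')]
  congr 2; ring

/-- Integration by parts; flatness removes the boundary terms for every complex `s`, so this shift
relation extends the Gamma formula to the left of Re s = 0. -/
theorem IsFlat.mul_mellinSum (h : IsFlat a w) (s : ℂ) :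
    s * mellinSum a w s = Real.pi * mellinSum a (fun i => w i * a i) (s + 1) := by
  have i1 : Integrable (powExpSum a w (s - 1)) := (h.powExpSumS (s - 1)).integrable
  have i2 : Integrable (powExpSum a (fun i => w i * a i) s) := (h.mul.powExpSumS s).integrable
  have h1 := integral_eq_zero_of_hasDerivAt_of_integrable (h.hasDerivAt_powExpSum s)
    ((i1.const_mul s).sub (i2.const_mul (Real.pi : ℂ))) (h.powExpSumS s).integrable
  rw [integral_sub (i1.const_mul s) (i2.const_mul (Real.pi : ℂ)), integral_const_mul,
    integral_const_mul] at h1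
  rw [mellinSum, mellinSum, add_sub_cancel_right]
  exact sub_eq_zero.1 h1

theorem IsFlat.mellinSum_of_re_pos [Countable ι] (h : IsFlat a w) {s : ℂ} (hs : 0 < s.re) :
    mellinSum a w s = Complex.Gamma s * (Real.pi : ℂ) ^ (-s) * ∑' i, w i * (a i : ℂ) ^ (-s) := by
  have hpa : ∀ i, 0 < Real.pi * a i := fun i => mul_pos Real.pi_pos (h.pos i)
  have hnorm : ∀ i (u : ℝ), u ∈ Ioi (0 : ℝ) →
      ‖(u : ℂ) ^ (s - 1) * (w i * Complex.exp (-(Real.pi * a i * u : ℝ)))‖ =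
      ‖w i‖ * (u ^ (s.re - 1) * Real.exp (-(Real.pi * a i * u))) := by
    intro i u hu
    rw [norm_mul, norm_mul, Complex.norm_cpow_eq_rpow_re_of_pos hu, ← Complex.ofReal_neg,
      Complex.norm_exp_ofReal, Complex.sub_re, Complex.one_re]
    ring
  have hval : ∀ i, ∫ u in Ioi (0 : ℝ), (u : ℂ) ^ (s - 1) *
      (w i * Complex.exp (-(Real.pi * a i * u : ℝ))) =
      Complex.Gamma s * (Real.pi : ℂ) ^ (-s) * (w i * (a i : ℂ) ^ (-s)) := by
    intro i
    have h1 := Complex.integral_cpow_mul_exp_neg_mul_Ioi hs (hpa i)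
    have h2 : (1 / ((Real.pi * a i : ℝ) : ℂ)) ^ s = (Real.pi : ℂ) ^ (-s) * (a i : ℂ) ^ (-s) := by
      rw [one_div, Complex.inv_cpow _ _ (by
        rw [Complex.arg_ofReal_of_nonneg (hpa i).le]; exact Real.pi_pos.ne), ← Complex.cpow_neg,
        Complex.ofReal_mul, Complex.mul_cpow_ofReal_nonneg Real.pi_pos.le (h.pos i).le]
    rw [h2] at h1
    rw [show Complex.Gamma s * (Real.pi : ℂ) ^ (-s) * (w i * (a i : ℂ) ^ (-s)) =
      w i * ((Real.pi : ℂ) ^ (-s) * (a i : ℂ) ^ (-s) * Complex.Gamma s) by ring, ← h1,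
      ← integral_const_mul]
    congr 1; ext u; push_cast; ring_nf
  have hint : ∀ i, IntegrableOn (fun u : ℝ => (u : ℂ) ^ (s - 1) *
      (w i * Complex.exp (-(Real.pi * a i * u : ℝ)))) (Ioi 0) := by
    intro i
    have h1 : IntegrableOn (fun u : ℝ => ‖w i‖ * (u ^ (s.re - 1) *
        Real.exp (-(Real.pi * a i * u)))) (Ioi 0) := by
      refine Integrable.const_mul ?_ _
      have := integrableOn_rpow_mul_exp_neg_mul_rpow (p := 1) (s := s.re - 1) (b := Real.pi * a i)
        (by linarith) one_pos (hpa i)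
      simpa [IntegrableOn] using this
    refine h1.mono' ?_ ((ae_restrict_mem measurableSet_Ioi).mono fun u hu => (hnorm i u hu).le)
    refine ContinuousOn.aestronglyMeasurable (fun u hu => ?_) measurableSet_Ioi
    have hu' : (0 : ℝ) < u := hu
    refine ContinuousAt.continuousWithinAt (ContinuousAt.mul ?_ (by fun_prop))
    exact (Complex.continuousAt_ofReal_cpow_const u (s - 1) (Or.inr hu'.ne'))
  have hsum : Summable fun i => ∫ u in Ioi (0 : ℝ), ‖(u : ℂ) ^ (s - 1) *
      (w i * Complex.exp (-(Real.pi * a i * u : ℝ)))‖ := by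
    refine ((h.summable (-s.re)).mul_right ((1 / Real.pi) ^ s.re * Real.Gamma s.re)).congr
      fun i => ?_
    rw [setIntegral_congr_fun measurableSet_Ioi (hnorm i), integral_const_mul,
      Real.integral_rpow_mul_exp_neg_mul_Ioi hs (hpa i), one_div, one_div, mul_inv,
      Real.mul_rpow (by positivity) (by have := h.pos i; positivity),
      Real.inv_rpow (h.pos i).le, Real.rpow_neg (h.pos i).le]
    ring
  have h1 := hasSum_integral_of_summable_integral_norm hint hsum
  rw [mellinSum_eq, ← tsum_mul_left]
  simp_rw [hval] at h1
  rw [h1.tsum_eq]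
  refine integral_congr_ae (Eventually.of_forall fun u => ?_)
  simp only [expSum, tsum_mul_left]

theorem IsFlat.mellinSum_eq_gamma [Countable ι] (k : ℕ) : ∀ {w : ι → ℂ}, IsFlat a w → ∀ {s : ℂ},
    0 < s.re + k → (∀ m : ℕ, s ≠ -m) →
    mellinSum a w s = Complex.Gamma s * (Real.pi : ℂ) ^ (-s) * ∑' i, w i * (a i : ℂ) ^ (-s) := by
  induction k with
  | zero => exact fun h s hs _ => h.mellinSum_of_re_pos (by simpa using hs)
  | succ k ih =>
    intro w h s hs hsm
    have hs0 : s ≠ 0 := by simpa using hsm 0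
    have h1 := ih h.mul (s := s + 1) (by push_cast at hs; simp; linarith) (fun m hm =>
      hsm (m + 1) (by push_cast; linear_combination hm))
    have h2 := h.mul_mellinSum s
    have h3 : ∀ i, w i * a i * (a i : ℂ) ^ (-(s + 1)) = w i * (a i : ℂ) ^ (-s) := fun i => by
      have : (a i : ℂ) ≠ 0 := by exact_mod_cast (h.pos i).ne'
      rw [show -s = -(s + 1) + 1 by ring, Complex.cpow_add _ _ this, Complex.cpow_one]; ring
    have hpi : (Real.pi : ℂ) ≠ 0 := by exact_mod_cast Real.pi_pos.ne'
    simp_rw [h3] at h1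
    rw [h1, Complex.Gamma_add_one s hs0] at h2
    refine mul_left_cancel₀ hs0 (h2.trans ?_)
    rw [show -s = -(s + 1) + 1 by ring, Complex.cpow_add _ _ hpi, Complex.cpow_one]; ring

theorem IsFlat.continuous_mellinSum (h : IsFlat a w) : Continuous (mellinSum a w) := by
  have hc : ContinuousOn (expSum a w) (Ioi 0) := fun u hu =>
    (h.hasDerivAt_expSum hu).continuousAt.continuousWithinAt
  have heq : mellinSum a w = mellin (expSum a w) := by
    ext s; rw [mellinSum_eq, mellin]; rfl
  rw [heq, continuous_iff_continuousAt]
  intro s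
  obtain ⟨C, _, hC⟩ := h.norm_expSum_le_rpow (-(s.re + 1))
  obtain ⟨C', _, hC'⟩ := h.norm_expSum_le_rpow (-(s.re - 1))
  refine (mellin_differentiableAt_of_isBigO_rpow (a := s.re + 1) (b := s.re - 1)
    (hc.locallyIntegrableOn measurableSet_Ioi) ?_ (by linarith) ?_ (by linarith)).continuousAt
  · refine .of_bound C ((eventually_gt_atTop 0).mono fun u hu => ?_)
    rw [Real.norm_of_nonneg (by positivity)]; exact hC u hu
  · refine .of_bound C' (eventually_mem_nhdsWithin.mono fun u hu => ?_)
    have hu' : (0 : ℝ) < u := hu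
    rw [Real.norm_of_nonneg (by positivity)]; exact hC' u hu'

end LadderOperators

end

/-! ### Fourier transforms of harmonic polynomials times flat sums -/

noncomputable section

namespace LadderOperators

open MeasureTheory Set Filter Topology MvPolynomial

variable {D : ℕ} {ι : Type*} {a : ι → ℝ} {w : ι → ℂ}

theorem polyFun_smul {n : ℕ} {P : MvPolynomial (Fin D) ℂ} (hP : P.IsHomogeneous n) (c : ℝ)
    (x : Space D) : polyFun P (c • x) = (c : ℂ) ^ n * polyFun P x := by
  rw [polyFun, polyFun, eval_eq, eval_eq, Finset.mul_sum]
  refine Finset.sum_congr rfl fun d hd => ?_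
  have h : d.degree = n := by
    rw [Finsupp.degree_eq_weight_one]
    exact hP (mem_support_iff.1 hd)
  rw [Finsupp.degree_apply] at h
  simp only [PiLp.smul_apply, smul_eq_mul, Complex.ofReal_mul, mul_pow, Finset.prod_mul_distrib,
    Finset.prod_pow_eq_pow_sum]
  rw [← h]
  ring

/-- Substitution x ↦ √b x. The resulting power of `b` is what `IsFlat.summable` controls when
integration and summation are interchanged. -/
theorem integral_norm_radial_expS {n : ℕ} {P : MvPolynomial (Fin D) ℂ} (hP : P.IsHomogeneous n)
    (b : ℝ) (hb : 0 < b) : ∫ x, ‖radial P (expS b hb) x‖ =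
      b ^ (-(n + D) / 2 : ℝ) * ∫ x, ‖radial P (expS 1 one_pos) x‖ := by
  have h := Measure.integral_comp_smul (volume : Measure (Space D))
    (fun x => ‖radial P (expS 1 one_pos) x‖) (Real.sqrt b)
  have h1 : ∀ x : Space D, ‖radial P (expS b hb) x‖ =
      b ^ (-n / 2 : ℝ) * ‖radial P (expS 1 one_pos) (Real.sqrt b • x)‖ := by
    intro x
    rw [radial_expS_apply, radial_expS_apply, polyFun_smul hP, norm_smul,
      Real.norm_of_nonneg (Real.sqrt_nonneg b), mul_pow, Real.sq_sqrt hb.le, mul_one, ← mul_assoc,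
      norm_mul, norm_mul, norm_mul, norm_pow, Complex.norm_real,
      Real.norm_of_nonneg (Real.sqrt_nonneg b), ← mul_assoc, ← mul_assoc]
    have h2 : b ^ (-n / 2 : ℝ) * Real.sqrt b ^ n = 1 := by
      rw [Real.sqrt_eq_rpow, ← Real.rpow_natCast, ← Real.rpow_mul hb.le, ← Real.rpow_add hb]
      simp [div_eq_inv_mul]
    rw [h2, one_mul]
  simp_rw [h1]
  rw [integral_const_mul, h, smul_eq_mul, ← mul_assoc, abs_of_nonneg (by positivity)]
  congr 1
  rw [finrank_euclideanSpace_fin, Real.sqrt_eq_rpow, ← Real.rpow_natCast, ← Real.rpow_mul hb.le,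
    ← Real.rpow_neg hb.le, ← Real.rpow_add hb]
  congr 1; ring

theorem IsFlat.radial_powExpSumS_zero (h : IsFlat a w) (P : MvPolynomial (Fin D) ℂ) (x : Space D) :
    radial P (h.powExpSumS 0) x = ∑' i, w i * radial P (expS (a i) (h.pos i)) x := by
  have h1 : ∀ i, w i * radial P (expS (a i) (h.pos i)) x =
      polyFun P x * (w i * Complex.exp (-(Real.pi * a i * (‖x‖ ^ 2) : ℝ))) := fun i => by
    rw [radial_expS_apply]; push_cast; ring
  simp_rw [h1]
  rw [tsum_mul_left, radial_apply, h.powExpSumS_apply]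
  congr 1
  -- At the origin `powExpSum` is 0 by definition, and the series agrees because its weights sum to
  -- 0.
  rcases eq_or_ne x 0 with rfl | hx
  · rw [powExpSum_of_nonpos _ (by simp)]
    simpa using (h.tsum_eq_zero 0).symm
  · rw [powExpSum_of_pos _ (by positivity), Complex.cpow_zero, one_mul, expSum]

/-- If the weights are symmetric under an involution of the index set which inverts `a`, the function
`radial P (h.powExpSumS 0)` is an eigenfunction of the Fourier transform. -/
theorem IsFlat.fourier_radial_powExpSumS [Countable ι] (h : IsFlat a w) {n : ℕ}
    {P : MvPolynomial (Fin D) ℂ} (hP : P.IsHomogeneous n) (hP' : lap P = 0) (e : ι ≃ ι)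
    (ha : ∀ i, a (e i) = (a i)⁻¹)
    (hw : ∀ i, w (e i) = w i * ((a i ^ (-(n + D / 2 : ℝ)) : ℝ) : ℂ)) :
    𝓕 (radial P (h.powExpSumS 0)) = ((-Complex.I) ^ n) • radial P (h.powExpSumS 0) := by
  ext ξ
  rw [SchwartzMap.fourier_coe, Real.fourier_eq, smul_apply, h.radial_powExpSumS_zero,
    smul_eq_mul]
  have h1 := hasSum_integral_of_summable_integral_norm (μ := (volume : Measure (Space D)))
    (F := fun i x => (Real.fourierChar (-inner ℝ x ξ) : Circle) •
      (w i * radial P (expS (a i) (h.pos i)) x)) ?_ ?_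
  · have h2 : ∀ i, ∫ x, (Real.fourierChar (-inner ℝ x ξ) : Circle) •
        (w i * radial P (expS (a i) (h.pos i)) x) =
        (-Complex.I) ^ n * (w (e i) * radial P (expS (a (e i)) (h.pos (e i))) ξ) := by
      intro i
      have h3 := congrArg (fun f : 𝓢(Space D, ℂ) => f ξ)
        (fourier_radial_harmonic (a i) (h.pos i) hP hP')
      simp only [SchwartzMap.fourier_coe, Real.fourier_eq, smul_apply,
        smul_eq_mul] at h3
      simp only [← mul_smul_comm]
      rw [integral_const_mul, h3, hw, radial_expS_apply, radial_expS_apply, ha]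
      ring
    simp_rw [h2] at h1
    -- The transform carries the i-th Gaussian to the one with index `e i`, with exactly its weight,
    -- so the series is only reordered.
    have h4 := (e.hasSum_iff (f := fun i => (-Complex.I) ^ n *
      (w i * radial P (expS (a i) (h.pos i)) ξ))).1 h1
    rw [← tsum_mul_left, h4.tsum_eq]
    refine integral_congr_ae (Eventually.of_forall fun x => ?_)
    simp only [h.radial_powExpSumS_zero, Circle.smul_def, smul_eq_mul, tsum_mul_left]
  · intro i
    have h5 : Integrable fun x => w i * radial P (expS (a i) (h.pos i)) x :=
      (SchwartzMap.integrable _).const_mul _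
    refine h5.norm.mono' ?_ (Eventually.of_forall fun x => by rw [Circle.norm_smul])
    refine Continuous.aestronglyMeasurable ?_
    fun_prop
  · refine ((h.summable (-(n + D) / 2)).mul_right
      (∫ x, ‖radial P (expS 1 one_pos) x‖)).congr fun i => ?_
    simp only [Circle.norm_smul, norm_mul, integral_const_mul]
    rw [integral_norm_radial_expS hP (a i), mul_assoc]

end LadderOperators

end

/-! ### Euler's product ∏ (1 - q^i x) and the self-dual weights -/

noncomputable section

namespace LadderOperators

open MeasureTheory Set Filter Topology

/-- The Taylor coefficients of the infinite product `∏ (1 - q ^ i * x)`. -/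
def qCoeff (q : ℝ) : ℕ → ℝ
  | 0 => 1
  | k + 1 => -qCoeff q k * q ^ k / (1 - q ^ (k + 1))

/-- The infinite product `∏ (1 - q ^ i * x)`, as a power series. -/
def qProd (q : ℝ) (x : ℂ) : ℂ := ∑' k, (qCoeff q k : ℂ) * x ^ k

section

variable {q : ℝ} (hq0 : 0 < q) (hq1 : q < 1)

include hq0 hq1

theorem qCoeff_ne_zero (k : ℕ) : qCoeff q k ≠ 0 := by
  induction k with
  | zero => exact one_ne_zero
  | succ k ih =>
    have : q ^ (k + 1) < 1 := pow_lt_one₀ hq0.le hq1 (by simp)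
    exact div_ne_zero (mul_ne_zero (neg_ne_zero.2 ih) (by positivity)) (by linarith)

theorem summable_qCoeff {R : ℝ} (hR : 0 < R) : Summable fun k => ‖(qCoeff q k : ℂ)‖ * R ^ k := by
  refine summable_of_ratio_test_tendsto_lt_one zero_lt_one (Eventually.of_forall fun k =>
    mul_ne_zero (norm_ne_zero_iff.2 (by exact_mod_cast qCoeff_ne_zero hq0 hq1 k)) (by positivity)) ?_
  have h1 : Tendsto (fun k : ℕ => q ^ k * R / (1 - q ^ (k + 1))) atTop (𝓝 0) := by
    have h2 := tendsto_pow_atTop_nhds_zero_of_lt_one hq0.le hq1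
    have h3 := (h2.mul_const R).div (((tendsto_add_atTop_iff_nat 1).2 h2).const_sub 1) (by simp)
    rw [zero_mul, zero_div] at h3
    exact h3
  refine h1.congr fun k => ?_
  have h4 : q ^ (k + 1) < 1 := pow_lt_one₀ hq0.le hq1 (by simp)
  have h5 : 0 < 1 - q ^ (k + 1) := by linarith
  have h6 := norm_ne_zero_iff.2 (qCoeff_ne_zero hq0 hq1 k)
  rw [norm_mul, norm_mul, norm_norm, norm_norm, Complex.norm_real, Complex.norm_real, qCoeff,
    norm_div, norm_mul, norm_neg, Real.norm_of_nonneg h5.le, norm_pow, norm_pow, norm_pow,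
    Real.norm_of_nonneg hq0.le, Real.norm_of_nonneg hR.le, pow_succ R]
  field_simp

theorem summable_qProd (x : ℂ) : Summable fun k => ‖(qCoeff q k : ℂ) * x ^ k‖ := by
  refine (summable_qCoeff hq0 hq1 (R := ‖x‖ + 1) (by positivity)).of_nonneg_of_le
    (fun _ => norm_nonneg _) fun k => ?_
  rw [norm_mul, norm_pow]
  gcongr
  linarith

theorem continuous_qProd : Continuous (qProd q) := by
  refine continuous_iff_continuousAt.2 fun x => ?_
  refine ContinuousOn.continuousAt (s := Metric.ball 0 (‖x‖ + 1)) ?_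
    (Metric.isOpen_ball.mem_nhds (by simp))
  refine continuousOn_tsum (fun k => by fun_prop)
    (summable_qCoeff hq0 hq1 (R := ‖x‖ + 1) (by positivity)) fun k y hy => ?_
  rw [norm_mul, norm_pow]
  have : ‖y‖ < ‖x‖ + 1 := by simpa using hy
  gcongr

/-- Comparing coefficients in this functional equation is precisely the recursion that defines
`qCoeff`. -/
theorem qProd_eq (x : ℂ) : qProd q x = (1 - x) * qProd q (q * x) := by
  have h1 := (summable_qProd hq0 hq1 x).of_norm
  have h2 := (summable_qProd hq0 hq1 (q * x)).of_norm
  have h3 : qProd q x - qProd q (q * x) = -x * qProd q (q * x) := by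
    rw [qProd, qProd, ← h1.tsum_sub h2, (h1.sub h2).tsum_eq_zero_add, ← tsum_mul_left]
    simp only [pow_zero, sub_self, zero_add]
    refine tsum_congr fun k => ?_
    have h4 : q ^ (k + 1) < 1 := pow_lt_one₀ hq0.le hq1 (by simp)
    have h5 : ((1 : ℂ) - q ^ (k + 1)) ≠ 0 := by
      have : (1 : ℝ) - q ^ (k + 1) ≠ 0 := by linarith
      exact_mod_cast this
    rw [qCoeff]
    push_cast
    rw [mul_pow, mul_pow]
    field_simp
    ring
  linear_combination h3

theorem qProd_eq_prod (x : ℂ) (n : ℕ) :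
    qProd q x = (∏ i ∈ Finset.range n, (1 - q ^ i * x)) * qProd q (q ^ n * x) := by
  induction n with
  | zero => simp
  | succ n ih =>
    rw [ih, Finset.prod_range_succ, qProd_eq hq0 hq1 (q ^ n * x)]
    ring_nf

theorem qProd_eq_zero {x : ℂ} {m : ℕ} (h : (q : ℂ) ^ m * x = 1) : qProd q x = 0 := by
  rw [qProd_eq_prod hq0 hq1 x (m + 1), Finset.prod_range_succ, h]
  simp

/-- After splitting off n nonzero factors, the remaining value at q^n x tends to the value 1 at the
origin. -/
theorem qProd_ne_zero {x : ℂ} (h : ∀ m : ℕ, (q : ℂ) ^ m * x ≠ 1) : qProd q x ≠ 0 := by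
  have h0 : qProd q 0 = 1 := by
    rw [qProd, tsum_eq_single 0 (fun k hk => by simp [hk])]
    simp [qCoeff]
  have h1 : Tendsto (fun n : ℕ => qProd q ((q : ℂ) ^ n * x)) atTop (𝓝 1) := by
    have h2 : Tendsto (fun n : ℕ => (q : ℂ) ^ n * x) atTop (𝓝 0) := by
      have := tendsto_pow_atTop_nhds_zero_of_norm_lt_one (x := (q : ℂ))
        (by rwa [Complex.norm_real, Real.norm_of_nonneg hq0.le])
      simpa using this.mul_const x
    rw [← h0]
    exact ((continuous_qProd hq0 hq1).tendsto 0).comp h2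
  obtain ⟨n, hn⟩ := (h1.eventually_ne one_ne_zero).exists
  rw [qProd_eq_prod hq0 hq1 x n]
  exact mul_ne_zero (Finset.prod_ne_zero_iff.2 fun i _ => sub_ne_zero.2 (h i).symm) hn

theorem qProd_ofReal_ne_zero {x : ℝ} (hx0 : 0 ≤ x) (hx : x < 1) : qProd q x ≠ 0 := by
  refine qProd_ne_zero hq0 hq1 fun m hm => ?_
  have h1 : q ^ m * x = 1 := by exact_mod_cast hm
  have : q ^ m ≤ 1 := pow_le_one₀ hq0.le hq1.le
  nlinarith

end

/-- The exponents of the self-dual sum of Gaussians. -/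
def dualExp (ε : ℝ) (i : ℕ × ℕ) : ℝ := Real.exp (ε * (i.1 - i.2))

/-- The weights of the self-dual sum of Gaussians. -/
def dualWeight (ε N : ℝ) (i : ℕ × ℕ) : ℂ :=
  (qCoeff (Real.exp (-ε)) i.1 : ℂ) * ((qCoeff (Real.exp (-ε)) i.2 : ℂ) *
    ((Real.exp (-(ε * N * i.2)) : ℝ) : ℂ))

theorem dualExp_cpow (ε : ℝ) (i : ℕ × ℕ) (s : ℂ) :
    (dualExp ε i : ℂ) ^ s = Complex.exp (ε * (i.1 - i.2) * s) := by
  rw [dualExp, Complex.cpow_def_of_ne_zero (by exact_mod_cast (Real.exp_pos _).ne'),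
    ← Complex.ofReal_log (Real.exp_pos _).le, Real.log_exp]
  push_cast; rfl

section

variable {ε : ℝ} (hε : 0 < ε) (N : ℝ)

include hε

theorem summable_dualWeight (r : ℝ) :
    Summable fun i => ‖dualWeight ε N i‖ * dualExp ε i ^ r := by
  have hq0 := Real.exp_pos (-ε)
  have hq1 : Real.exp (-ε) < 1 := Real.exp_lt_one_iff.2 (by linarith)
  have h1 := summable_qCoeff hq0 hq1 (Real.exp_pos (ε * r))
  have h2 := summable_qCoeff hq0 hq1 (Real.exp_pos (-(ε * (N + r))))
  refine (h1.mul_of_nonneg h2 (fun _ => by positivity) fun _ => by positivity).congr fun i => ?_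
  have h3 : Real.exp (ε * r) ^ i.1 * Real.exp (-(ε * (N + r))) ^ i.2 =
      Real.exp (-(ε * N * i.2)) * dualExp ε i ^ r := by
    rw [← Real.exp_nat_mul, ← Real.exp_nat_mul, dualExp, ← Real.exp_mul, ← Real.exp_add,
      ← Real.exp_add]
    congr 1; ring
  rw [dualWeight, norm_mul, norm_mul, Complex.norm_real (Real.exp _), Real.norm_of_nonneg
    (Real.exp_pos _).le]
  linear_combination ‖(qCoeff (Real.exp (-ε)) i.1 : ℂ)‖ * ‖(qCoeff (Real.exp (-ε)) i.2 : ℂ)‖ * h3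

/-- The double series factors. With q = e^(-ε), the two factors are the Euler product at q^s and at
q^(N-s), so the result is symmetric under s ↦ N - s and vanishes at s = -m and s = N + m. -/
theorem tsum_dualWeight (s : ℂ) : ∑' i, dualWeight ε N i * (dualExp ε i : ℂ) ^ (-s) =
    qProd (Real.exp (-ε)) (Complex.exp (-(ε * s))) *
      qProd (Real.exp (-ε)) (Complex.exp (-(ε * (N - s)))) := by
  have hq0 := Real.exp_pos (-ε)
  have hq1 : Real.exp (-ε) < 1 := Real.exp_lt_one_iff.2 (by linarith)
  rw [qProd, qProd, tsum_mul_tsum_of_summable_norm (summable_qProd hq0 hq1 _)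
    (summable_qProd hq0 hq1 _)]
  refine tsum_congr fun i => ?_
  have h3 : Complex.exp (-(ε * s)) ^ i.1 * Complex.exp (-(ε * (N - s))) ^ i.2 =
      ((Real.exp (-(ε * N * i.2)) : ℝ) : ℂ) * (dualExp ε i : ℂ) ^ (-s) := by
    rw [← Complex.exp_nat_mul, ← Complex.exp_nat_mul, dualExp_cpow, Complex.ofReal_exp,
      ← Complex.exp_add, ← Complex.exp_add]
    congr 1; push_cast; ring
  rw [dualWeight]
  linear_combination -(qCoeff (Real.exp (-ε)) i.1 : ℂ) * (qCoeff (Real.exp (-ε)) i.2 : ℂ) * h3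

theorem qProd_exp_nat (m : ℕ) : qProd (Real.exp (-ε)) (Complex.exp (ε * m)) = 0 := by
  have hq1 : Real.exp (-ε) < 1 := Real.exp_lt_one_iff.2 (by linarith)
  refine qProd_eq_zero (Real.exp_pos _) hq1 (m := m) ?_
  rw [Complex.ofReal_exp, ← Complex.exp_nat_mul, ← Complex.exp_add, ← Complex.exp_zero]
  congr 1; push_cast; ring

theorem isFlat_dualWeight : IsFlat (dualExp ε) (dualWeight ε N) where
  pos i := Real.exp_pos _
  summable := summable_dualWeight hε N
  tsum_eq_zero m := by
    have h := tsum_dualWeight hε N (-m)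
    simp only [neg_neg, Complex.cpow_natCast] at h
    rw [h, show -(ε * -(m : ℂ)) = ε * m by ring, qProd_exp_nat hε, zero_mul]

theorem mellinSum_dualWeight {s : ℂ} (hs : ∀ m : ℕ, s ≠ -m) :
    mellinSum (dualExp ε) (dualWeight ε N) s = Complex.Gamma s * (Real.pi : ℂ) ^ (-s) *
      (qProd (Real.exp (-ε)) (Complex.exp (-(ε * s))) *
        qProd (Real.exp (-ε)) (Complex.exp (-(ε * (N - s))))) := by
  obtain ⟨k, hk⟩ := exists_nat_gt (-s.re)
  rw [(isFlat_dualWeight hε N).mellinSum_eq_gamma k (by linarith) hs, tsum_dualWeight hε N]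

end

/-- The limit hypothesis says that the Dirichlet series has a simple zero at -m. At m = 0 it cancels
the pole, Γ(t)S(t) = Γ(t+1)S(t)/t, and continuity of the Mellin transform gives the value `l`;
larger m are shifted to 0 by `IsFlat.mul_mellinSum`. -/
theorem IsFlat.mellinSum_neg_nat_ne_zero {ι : Type*} [Countable ι] {a : ι → ℝ} (m : ℕ) :
    ∀ {w : ι → ℂ}, IsFlat a w → ∀ {l : ℂ}, l ≠ 0 →
    Tendsto (fun t : ℝ => (∑' i, w i * (a i : ℂ) ^ (-(t - m : ℂ))) / t) (𝓝[>] 0) (𝓝 l) →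
    mellinSum a w (-m) ≠ 0 := by
  induction m with
  | zero =>
    intro w h l hl ht
    have hpi : (Real.pi : ℂ) ≠ 0 := by exact_mod_cast Real.pi_pos.ne'
    have h0 : Tendsto (fun t : ℝ => (t : ℂ)) (𝓝[>] 0) (𝓝 0) := by
      have : Tendsto (fun t : ℝ => (t : ℂ)) (𝓝 0) (𝓝 ((0 : ℝ) : ℂ)) :=
        Complex.continuous_ofReal.tendsto 0
      exact (by simpa using this : Tendsto (fun t : ℝ => (t : ℂ)) (𝓝 0) (𝓝 0)).mono_left
        nhdsWithin_le_nhds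
    have h1 : Tendsto (fun t : ℝ => mellinSum a w t) (𝓝[>] 0) (𝓝 (mellinSum a w 0)) :=
      (h.continuous_mellinSum.tendsto 0).comp h0
    have h2 : Tendsto (fun t : ℝ => Complex.Gamma (t + 1) * (Real.pi : ℂ) ^ (-(t : ℂ)) *
        ((∑' i, w i * (a i : ℂ) ^ (-(t - (0 : ℕ) : ℂ))) / t)) (𝓝[>] 0) (𝓝 (1 * 1 * l)) := by
      refine Tendsto.mul (Tendsto.mul ?_ ?_) ht
      · have h3 : ContinuousAt Complex.Gamma (0 + 1) := by
          refine (Complex.differentiableAt_Gamma _ fun m hm => ?_).continuousAt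
          have := congrArg Complex.re hm
          simp at this
          have : (0 : ℝ) ≤ m := by positivity
          linarith
        have h4 := h3.tendsto.comp (h0.add_const 1)
        rwa [zero_add, Complex.Gamma_one] at h4
      · have h3 : Continuous fun z : ℂ => (Real.pi : ℂ) ^ (-z) :=
          continuous_const.cpow continuous_neg fun _ => Or.inl (by simpa using Real.pi_pos)
        have h4 := (h3.tendsto 0).comp h0
        simpa using! h4
    have h5 := tendsto_nhds_unique h1 (h2.congr' ?_)
    · simpa [h5] using hl
    · refine eventually_mem_nhdsWithin.mono fun t ht => ?_
      have ht' : (0 : ℝ) < t := ht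
      have htc : (t : ℂ) ≠ 0 := by exact_mod_cast ht'.ne'
      beta_reduce
      rw [h.mellinSum_of_re_pos (by simpa using ht'), Complex.Gamma_add_one _ htc]
      simp only [Nat.cast_zero, sub_zero]
      field_simp
  | succ m ih =>
    intro w h l hl ht h0
    have h1 : ∀ (i) (t : ℝ), w i * a i * (a i : ℂ) ^ (-(t - m : ℂ)) =
        w i * (a i : ℂ) ^ (-(t - (m + 1 : ℕ) : ℂ)) := fun i t => by
      have : (a i : ℂ) ≠ 0 := by exact_mod_cast (h.pos i).ne'
      rw [show (-(t - (m + 1 : ℕ) : ℂ)) = -(t - m : ℂ) + 1 by push_cast; ring,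
        Complex.cpow_add _ _ this, Complex.cpow_one]
      ring
    refine ih h.mul hl (ht.congr fun t => ?_) ?_
    · simp_rw [h1]
    · have h2 := h.mul_mellinSum (-(m + 1 : ℕ) : ℂ)
      rw [h0, mul_zero] at h2
      have hpi : (Real.pi : ℂ) ≠ 0 := by exact_mod_cast Real.pi_pos.ne'
      have h3 := (mul_eq_zero.1 h2.symm).resolve_left hpi
      rwa [show (-(m + 1 : ℕ) : ℂ) + 1 = -m by push_cast; ring] at h3

section

variable {ε : ℝ} (hε : 0 < ε) {N : ℝ} (hN : 0 < N)

include hε hN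

theorem mellinSum_dualWeight_neg_nat (m : ℕ) :
    mellinSum (dualExp ε) (dualWeight ε N) (-m) ≠ 0 := by
  have hq0 := Real.exp_pos (-ε)
  have hq1 : Real.exp (-ε) < 1 := Real.exp_lt_one_iff.2 (by linarith)
  set q := Real.exp (-ε) with hq
  have hqc : (q : ℂ) = Complex.exp (-ε) := by rw [hq]; push_cast; rfl
  -- The value of the Dirichlet series at t - m with its vanishing factor 1 - e^(-εt) removed.
  let R : ℝ → ℂ := fun t => (∏ i ∈ Finset.range m,
    (1 - (q : ℂ) ^ i * Complex.exp (-(ε * (t - m))))) * qProd q (Complex.exp (-(ε * (t + 1)))) *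
      qProd q (Complex.exp (-(ε * (N - (t - m)))))
  have hRc : Continuous R := by
    have := continuous_qProd hq0 hq1
    fun_prop
  have hR0 : R 0 ≠ 0 := by
    refine mul_ne_zero (mul_ne_zero (Finset.prod_ne_zero_iff.2 fun i hi => ?_) ?_) ?_
    · rw [hqc, ← Complex.exp_nat_mul, ← Complex.exp_add, sub_ne_zero]
      have hi' : (i : ℝ) < m := by exact_mod_cast Finset.mem_range.1 hi
      have h1 : Real.exp (ε * (m - i)) ≠ 1 := by
        have : 0 < ε * (m - i) := mul_pos hε (by linarith)
        exact (Real.one_lt_exp_iff.2 this).ne'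
      intro h2
      apply h1
      rw [← Complex.ofReal_inj, Complex.ofReal_exp, Complex.ofReal_one, h2]
      congr 1; push_cast; ring
    · have h1 : Complex.exp (-(ε * ((0 : ℝ) + 1))) = (q : ℂ) := by rw [hqc]; simp
      rw [h1]
      exact qProd_ofReal_ne_zero hq0 hq1 hq0.le hq1
    · have h1 : Complex.exp (-(ε * (N - ((0 : ℝ) - m)))) = ((Real.exp (-(ε * (N + m))) : ℝ) : ℂ) := by
        push_cast; congr 1; ring
      rw [h1]
      have : 0 < ε * (N + m) := by positivity
      exact qProd_ofReal_ne_zero hq0 hq1 (Real.exp_pos _).le (Real.exp_lt_one_iff.2 (by linarith))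
  have hslope : Tendsto (fun t : ℝ => (1 - Complex.exp (-(ε * t))) / t) (𝓝[>] 0) (𝓝 (ε : ℂ)) := by
    have h1 : HasDerivAt (fun t : ℝ => 1 - Complex.exp (-((ε * t : ℝ) : ℂ))) (ε : ℂ) 0 := by
      have h2 : HasDerivAt (fun t : ℝ => -((ε * t : ℝ) : ℂ)) (-(ε : ℂ)) 0 := by
        have : HasDerivAt (fun t : ℝ => ε * t) ε 0 := by
          simpa using (hasDerivAt_id (0 : ℝ)).const_mul ε
        exact this.ofReal_comp.neg
      exact (h2.cexp.const_sub 1).congr_deriv (by simp)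
    have h3 := h1.tendsto_slope_zero_right
    refine h3.congr fun t => ?_
    simp [div_eq_inv_mul]
  refine (isFlat_dualWeight hε N).mellinSum_neg_nat_ne_zero m
    (mul_ne_zero (show (ε : ℂ) ≠ 0 by exact_mod_cast hε.ne') hR0)
    ((hslope.mul ((hRc.tendsto 0).mono_left nhdsWithin_le_nhds)).congr fun t => ?_)
  rw [tsum_dualWeight hε N, qProd_eq_prod hq0 hq1 _ (m + 1), Finset.prod_range_succ]
  have h1 : (q : ℂ) ^ m * Complex.exp (-(ε * (t - m))) = Complex.exp (-(ε * t)) := by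
    rw [hqc, ← Complex.exp_nat_mul, ← Complex.exp_add]
    congr 1; ring
  have h2 : (q : ℂ) ^ (m + 1) * Complex.exp (-(ε * (t - m))) = Complex.exp (-(ε * (t + 1))) := by
    rw [hqc, ← Complex.exp_nat_mul, ← Complex.exp_add]
    congr 1; push_cast; ring
  rw [h1, h2]
  ring

theorem mellinSum_dualWeight_add_nat (m : ℕ) :
    mellinSum (dualExp ε) (dualWeight ε N) (N + m) = 0 := by
  rw [mellinSum_dualWeight hε, show -(ε * (N - (N + m : ℂ))) = ε * m by ring, qProd_exp_nat hε,
    mul_zero, mul_zero]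
  intro k hk
  have h1 : N + m = -(k : ℝ) := by exact_mod_cast hk
  have : (0 : ℝ) ≤ m := by positivity
  have : (0 : ℝ) ≤ k := by positivity
  linarith

end

/-- A zero requires ε(s + m) ∈ 2πiℤ. Small ε excludes the nonreal periods, leaving only s = -m. -/
theorem qProd_exp_ne_zero {ε : ℝ} (hε : 0 < ε) {s : ℂ} (hεs : ε * |s.im| < 1)
    (hs : ∀ m : ℕ, s ≠ -m) : qProd (Real.exp (-ε)) (Complex.exp (-(ε * s))) ≠ 0 := by
  refine qProd_ne_zero (Real.exp_pos _) (Real.exp_lt_one_iff.2 (by linarith)) fun m hm => ?_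
  rw [Complex.ofReal_exp, ← Complex.exp_nat_mul, ← Complex.exp_add, Complex.exp_eq_one_iff] at hm
  obtain ⟨n, hn⟩ := hm
  have him := congrArg Complex.im hn
  simp at him
  have hn0 : n = 0 := by
    by_contra hne
    have h1 : (1 : ℝ) ≤ |(n : ℝ)| := by exact_mod_cast Int.one_le_abs hne
    have h2 : |(n : ℝ)| * (2 * Real.pi) < 1 := by
      calc _ = |n * (2 * Real.pi)| := by rw [abs_mul, abs_of_pos Real.two_pi_pos]
        _ = ε * |s.im| := by rw [← him, abs_neg, abs_mul, abs_of_pos hε]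
        _ < 1 := hεs
    have := Real.pi_gt_three
    nlinarith
  rw [hn0] at hn
  push_cast at hn
  have hεc : (ε : ℂ) ≠ 0 := by exact_mod_cast hε.ne'
  have h3 : (ε : ℂ) * (s + m) = 0 := by linear_combination -hn
  exact hs m (eq_neg_of_add_eq_zero_left ((mul_eq_zero.1 h3).resolve_left hεc))

end LadderOperators

end

/-! ### The eigenvalue equation on the self-dual test function -/

noncomputable section

namespace LadderOperators

open MeasureTheory Set Filter Topology MvPolynomial

variable {D : ℕ}

theorem fourier_partialDeriv (μ : Fin D) (f : 𝓢(Space D, ℂ)) :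
    𝓕 (partialDeriv μ f) = (2 * Real.pi * Complex.I) • mulCoord μ (𝓕 f) := by
  have h1 : SchwartzMap.smulLeftCLM ℂ (fun x : Space D => inner ℝ x (basisVec μ)) (𝓕 f) =
      mulCoord μ (𝓕 f) := by
    ext x
    rw [SchwartzMap.smulLeftCLM_apply_apply
      (Function.hasTemperateGrowth_inner_left (H := Space D) (basisVec μ)), mulCoord_apply]
    simp [EuclideanSpace.inner_single_right]
  rw [← h1]
  exact SchwartzMap.fourier_lineDerivOp_eq f (basisVec μ)

/-- The Fourier transform exchanges coordinates and derivatives; commuting them back yields the term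
with `D`. Thus Euler operator + D/2 changes sign, and ν with it. -/
theorem fourier_euler (f : 𝓢(Space D, ℂ)) : 𝓕 (euler f) = -(euler (𝓕 f) + (D : ℂ) • 𝓕 f) := by
  have h1 : ∀ μ, 𝓕 (mulCoord μ (partialDeriv μ f)) = -(𝓕 f + mulCoord μ (partialDeriv μ (𝓕 f))) := by
    intro μ
    rw [fourier_mulCoord, fourier_partialDeriv, map_smul, mulCoord_partialDeriv_comm, smul_smul,
      show Complex.I / (2 * Real.pi) * (2 * Real.pi * Complex.I) = -1 by
        have : (Real.pi : ℂ) ≠ 0 := by exact_mod_cast Real.pi_pos.ne'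
        field_simp
        exact Complex.I_sq, neg_one_smul]
  have h2 : 𝓕 (∑ μ : Fin D, mulCoord μ (partialDeriv μ f)) =
      ∑ μ : Fin D, 𝓕 (mulCoord μ (partialDeriv μ f)) :=
    map_sum (FourierTransform.fourierCLM ℂ 𝓢(Space D, ℂ)) _ _
  rw [euler, h2, euler]
  simp_rw [h1]
  rw [Finset.sum_neg_distrib, Finset.sum_add_distrib, add_comm]
  simp [Nat.cast_smul_eq_nsmul]

theorem fourierInv_euler (f : 𝓢(Space D, ℂ)) :
    𝓕⁻ (euler f) = -(euler (𝓕⁻ f) + (D : ℂ) • 𝓕⁻ f) := by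
  have h := congrArg (fun g : 𝓢(Space D, ℂ) => 𝓕⁻ g) (fourier_euler (𝓕⁻ f))
  have hadd : ∀ g k : 𝓢(Space D, ℂ), (𝓕⁻ (-(g + k)) : 𝓢(Space D, ℂ)) = -(𝓕⁻ g + 𝓕⁻ k) :=
    fun g k => by
      have := map_neg (FourierTransform.fourierInvCLM ℂ 𝓢(Space D, ℂ)) (g + k)
      rw [map_add] at this
      exact this
  simp only [FourierTransform.fourierInv_fourier_eq, FourierTransform.fourier_fourierInv_eq, hadd,
    FourierTransform.fourierInv_smul] at h
  rw [h]; abel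

theorem apply_euler_of_dilatation {ψ : State D} {ν : ℝ}
    (hH : dilatation D ψ = (-2 * Complex.I * (ν : ℂ)) • ψ) (f : 𝓢(Space D, ℂ)) :
    ψ (euler f) = (2 * Complex.I * ν - D / 2) * ψ f := by
  have h := congrArg (fun T : State D => T f) hH
  simp only [dilatation_apply, map_add, map_smul, smul_eq_mul] at h
  change _ = (-2 * Complex.I * (ν : ℂ)) * ψ f at h
  linear_combination -h

theorem fourierInv_apply_euler_of_dilatation {ψ : State D} {ν : ℝ}
    (hH : dilatation D ψ = (-2 * Complex.I * (ν : ℂ)) • ψ) (f : 𝓢(Space D, ℂ)) :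
    (𝓕⁻ ψ) (euler f) = (-2 * Complex.I * ν - D / 2) * (𝓕⁻ ψ) f := by
  rw [TemperedDistribution.fourierInv_apply, TemperedDistribution.fourierInv_apply,
    fourierInv_euler, map_neg, map_add, map_smul, apply_euler_of_dilatation hH, smul_eq_mul]
  ring

/-- A nonzero tempered distribution does not vanish on all products of a harmonic homogeneous
polynomial and a radial function. -/
theorem exists_harmonic_apply_ne_zero (hD : 1 ≤ D) {ψ : State D} (hψ : ψ ≠ 0) :
    ∃ (n : ℕ) (P : MvPolynomial (Fin D) ℂ) (h : 𝓢(ℝ, ℂ)), P.IsHomogeneous n ∧ lap P = 0 ∧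
      ψ (radial P h) ≠ 0 := by
  by_contra! H
  exact hψ (eq_zero_of_apply_radial ψ (apply_radial_eq_zero_of_harmonic hD ψ H))

theorem IsFlat.isPositionPow_radial {ι : Type*} {a : ι → ℝ} {w : ι → ℂ} (h : IsFlat a w)
    (P : MvPolynomial (Fin D) ℂ) (β : ℂ) :
    IsPositionPow β (radial P (h.powExpSumS 0)) (radial P (h.powExpSumS β)) := by
  intro x hx
  have : 0 < ‖x‖ ^ 2 := by positivity
  simp only [radial_apply, h.powExpSumS_apply, powExpSum_of_pos _ this, Complex.cpow_zero]
  ring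

theorem dualExp_swap (ε : ℝ) (i : ℕ × ℕ) : dualExp ε i.swap = (dualExp ε i)⁻¹ := by
  rw [dualExp, dualExp, ← Real.exp_neg]
  congr 1; simp only [Prod.fst_swap, Prod.snd_swap]; ring

theorem dualWeight_swap (ε N : ℝ) (i : ℕ × ℕ) :
    dualWeight ε N i.swap = dualWeight ε N i * ((dualExp ε i ^ (-N) : ℝ) : ℂ) := by
  have h : Real.exp (-(ε * N * i.1)) = Real.exp (-(ε * N * i.2)) * dualExp ε i ^ (-N) := by
    rw [dualExp, ← Real.exp_mul, ← Real.exp_add]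
    congr 1; ring
  simp only [dualWeight, Prod.fst_swap, Prod.snd_swap, h, Complex.ofReal_mul]
  ring

/-- The eigenvalue equation of `H_β`, tested on the self-dual sum of Gaussians. -/
theorem mellinSum_eq_of_isEigen {ψ : State D} {ν : ℝ}
    (hH : dilatation D ψ = (-2 * Complex.I * (ν : ℂ)) • ψ) {n : ℕ} {P : MvPolynomial (Fin D) ℂ}
    (hP : P.IsHomogeneous n) (hP' : lap P = 0) {J : ℝ} (hJ : 2 * J = n + D / 2) (hJ0 : 0 < J)
    (h0 : ψ (radial P (expS 1 one_pos)) ≠ 0) {β t : ℂ} (hE : IsEigen β t ψ) {ε : ℝ} (hε : 0 < ε) :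
    (Real.pi : ℂ) ^ (J - Complex.I * ν : ℂ) / Complex.Gamma (J - Complex.I * ν) *
        mellinSum (dualExp ε) (dualWeight ε (2 * J)) (J - Complex.I * ν + β) =
      t * ((((2 * Real.pi) ^ 2 : ℝ) : ℂ) ^ (-β) * ((Real.pi : ℂ) ^ (J + Complex.I * ν : ℂ) /
        Complex.Gamma (J + Complex.I * ν) *
        mellinSum (dualExp ε) (dualWeight ε (2 * J)) (J + Complex.I * ν - β))) := by
  have hF := isFlat_dualWeight hε (2 * J)
  have hJc : (2 : ℂ) * J = n + D / 2 := by
    have h1 := congrArg Complex.ofReal hJ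
    push_cast at h1
    exact h1
  have hdual : 𝓕 (radial P (hF.powExpSumS 0)) =
      ((-Complex.I) ^ n) • radial P (hF.powExpSumS 0) := by
    refine hF.fourier_radial_powExpSumS hP hP' (Equiv.prodComm ℕ ℕ) (dualExp_swap ε) fun i => ?_
    rw [← hJ]
    exact dualWeight_swap ε (2 * J) i
  have hI : (-Complex.I) ^ n * Complex.I ^ n = 1 := by
    rw [← mul_pow]; simp
  -- The standard Gaussian times `P` is its own transform up to (-i)^n, so the constants in
  -- `apply_radial_eq` for ψ and for 𝓕⁻ψ are linked and cancel at the end.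
  have hexp : (𝓕⁻ ψ) (radial P (expS 1 one_pos)) = Complex.I ^ n * ψ (radial P (expS 1 one_pos)) := by
    have h1 := fourier_radial_harmonic 1 one_pos hP hP'
    have h2 : radial P (expS (1 : ℝ)⁻¹ (inv_pos.2 one_pos)) = radial P (expS 1 one_pos) := by
      congr 2; exact inv_one
    rw [h2, Real.one_rpow, Complex.ofReal_one, mul_one] at h1
    have h3 : radial P (expS 1 one_pos) =
        (-Complex.I) ^ n • (𝓕⁻ (radial P (expS 1 one_pos)) : 𝓢(Space D, ℂ)) := by
      rw [← FourierTransform.fourierInv_smul, ← h1, FourierTransform.fourierInv_fourier_eq]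
    have h4 := congrArg ψ h3
    rw [map_smul, smul_eq_mul] at h4
    rw [TemperedDistribution.fourierInv_apply, h4]
    linear_combination -(ψ (𝓕⁻ (radial P (expS 1 one_pos)) : 𝓢(Space D, ℂ))) * hI
  -- The phase comes from 𝓕χ = (-i)^n χ, the power of (2π)² from k = 2πξ. With this constant the
  -- inverse transform of A P(x) u^(-β) f, u = ‖x‖², is mapped to χ by p^(2β).
  set A : ℂ := (-Complex.I) ^ n * (((2 * Real.pi) ^ 2 : ℝ) : ℂ) ^ (-β) with hA
  have hmom : IsMomentumPow β (𝓕⁻ (A • radial P (hF.powExpSumS (-β))) : 𝓢(Space D, ℂ))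
      (radial P (hF.powExpSumS 0)) := by
    intro ξ hξ
    have hξ' : 0 < ‖ξ‖ ^ 2 := by positivity
    have hpi : (((2 * Real.pi) ^ 2 : ℝ) : ℂ) ≠ 0 := by
      exact_mod_cast (by positivity : (0 : ℝ) < (2 * Real.pi) ^ 2).ne'
    have hξc : ((‖ξ‖ ^ 2 : ℝ) : ℂ) ≠ 0 := by exact_mod_cast hξ'.ne'
    rw [hdual,
      FourierTransform.fourier_fourierInv_eq, smul_apply, smul_apply, radial_apply, radial_apply,
      hF.powExpSumS_apply, hF.powExpSumS_apply, powExpSum_of_pos _ hξ', powExpSum_of_pos _ hξ',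
      Complex.cpow_zero, norm_smul, Real.norm_of_nonneg Real.two_pi_pos.le, mul_pow,
      Complex.ofReal_mul, Complex.mul_cpow_ofReal_nonneg (by positivity) hξ'.le, hA,
      Complex.cpow_neg, Complex.cpow_neg]
    have h2 : (((2 * Real.pi) ^ 2 : ℝ) : ℂ) ^ β ≠ 0 := by simp [Complex.cpow_eq_zero_iff]
    have h3 : ((‖ξ‖ ^ 2 : ℝ) : ℂ) ^ β ≠ 0 := by rw [Ne, Complex.cpow_eq_zero_iff]; tauto
    simp only [smul_eq_mul]
    field_simp
  have key := hE _ _ _ hmom (hF.isPositionPow_radial P β)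
  have hψφ : ψ (𝓕⁻ (A • radial P (hF.powExpSumS (-β))) : 𝓢(Space D, ℂ)) =
      A * (𝓕⁻ ψ) (radial P (hF.powExpSumS (-β))) := by
    rw [FourierTransform.fourierInv_smul, map_smul, smul_eq_mul,
      TemperedDistribution.fourierInv_apply]
  rw [hψφ, apply_radial_eq ψ (apply_euler_of_dilatation hH) hP (κ := J - Complex.I * ν)
      (by linear_combination hJc) (by simpa using hJ0),
    apply_radial_eq (𝓕⁻ ψ) (fourierInv_apply_euler_of_dilatation hH) hP (κ := J + Complex.I * ν)
      (by linear_combination hJc) (by simpa using hJ0), hexp, hF.moment_powExpSumS,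
      hF.moment_powExpSumS, ← sub_eq_add_neg, hA] at key
  refine mul_left_cancel₀ h0 ?_
  refine Eq.trans ?_ (key.trans ?_)
  · ring
  · generalize mellinSum (dualExp ε) (dualWeight ε (2 * J)) (J + Complex.I * ν - β) = M
    linear_combination t * (((2 * Real.pi) ^ 2 : ℝ) : ℂ) ^ (-β) *
      ψ (radial P (expS 1 one_pos)) * (Real.pi : ℂ) ^ (J + Complex.I * ν : ℂ) /
        Complex.Gamma (J + Complex.I * ν) * M * hI

theorem Gamma_ne_zero_of_re {J : ℝ} (hJ : 0 < J) (x : ℂ) (hx : x.re = 0) :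
    Complex.Gamma (J + x) ≠ 0 :=
  Complex.Gamma_ne_zero_of_re_pos (by simpa [hx] using hJ)

/-- The two Mellin arguments are s and 2J - s, at which ω takes the same value. Freedom in ε is
needed to make ω nonzero for the given β; the exceptional points use ε = 1. -/
theorem eq_tau_of_mellinSum_eq {J ν : ℝ} (hJ0 : 0 < J) {β t : ℂ}
    (h : ∀ ε : ℝ, 0 < ε →
      (Real.pi : ℂ) ^ (J - Complex.I * ν : ℂ) / Complex.Gamma (J - Complex.I * ν) *
        mellinSum (dualExp ε) (dualWeight ε (2 * J)) (J - Complex.I * ν + β) =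
      t * ((((2 * Real.pi) ^ 2 : ℝ) : ℂ) ^ (-β) * ((Real.pi : ℂ) ^ (J + Complex.I * ν : ℂ) /
        Complex.Gamma (J + Complex.I * ν) *
        mellinSum (dualExp ε) (dualWeight ε (2 * J)) (J + Complex.I * ν - β)))) :
    (∀ m : ℕ, (J : ℂ) + β - Complex.I * ν ≠ -(m : ℂ)) ∧ t = tau J ν β := by
  have hpi : (Real.pi : ℂ) ≠ 0 := by exact_mod_cast Real.pi_pos.ne'
  have hpic : ∀ s : ℂ, (Real.pi : ℂ) ^ s ≠ 0 := fun s => by rw [Ne, Complex.cpow_eq_zero_iff]; tauto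
  have h2pi : (((2 * Real.pi) ^ 2 : ℝ) : ℂ) ^ (-β) =
      ((4 : ℂ) ^ β)⁻¹ * ((Real.pi : ℂ) ^ β)⁻¹ * ((Real.pi : ℂ) ^ β)⁻¹ := by
    have h1 : (2 * Real.pi) ^ 2 = 4 * Real.pi * Real.pi := by ring
    rw [h1, Complex.ofReal_mul, Complex.mul_cpow_ofReal_nonneg (by positivity) Real.pi_pos.le,
      Complex.ofReal_mul, Complex.mul_cpow_ofReal_nonneg (by positivity) Real.pi_pos.le,
      Complex.cpow_neg, Complex.cpow_neg]
    norm_num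
  have h4 : (4 : ℂ) ^ β ≠ 0 := by rw [Ne, Complex.cpow_eq_zero_iff]; norm_num
  have hG1 : Complex.Gamma (J - Complex.I * ν) ≠ 0 := by
    rw [sub_eq_add_neg]; exact Gamma_ne_zero_of_re hJ0 _ (by simp)
  have hG2 : Complex.Gamma (J + Complex.I * ν) ≠ 0 := Gamma_ne_zero_of_re hJ0 _ (by simp)
  have hN : (0 : ℝ) < 2 * J := by linarith
  -- At a pole the left Mellin transform is taken at -m, where it is nonzero, and the right one at
  -- 2J + m, where it vanishes: the equation would be false for every `t`.
  have hpole : ∀ m : ℕ, (J : ℂ) + β - Complex.I * ν ≠ -(m : ℂ) := by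
    intro m hm
    have h1 := h 1 one_pos
    rw [show (J : ℂ) - Complex.I * ν + β = -m by rw [← hm]; ring,
      show (J : ℂ) + Complex.I * ν - β = ((2 * J : ℝ) : ℂ) + m by
        push_cast; linear_combination -hm,
      mellinSum_dualWeight_add_nat one_pos hN, mul_zero, mul_zero, mul_zero] at h1
    exact mul_ne_zero (div_ne_zero (hpic _) hG1) (mellinSum_dualWeight_neg_nat one_pos hN m) h1
  refine ⟨hpole, ?_⟩
  -- Here the roles are exchanged: the left side vanishes and the coefficient of `t` does not, so t
  -- = 0, in agreement with `Complex.Gamma` being 0 at its poles.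
  by_cases hzero : ∃ m : ℕ, (J : ℂ) + Complex.I * ν - β = -m
  · obtain ⟨m, hm⟩ := hzero
    have h1 := h 1 one_pos
    rw [hm, show (J : ℂ) - Complex.I * ν + β = ((2 * J : ℝ) : ℂ) + m by
        push_cast; linear_combination -hm,
      mellinSum_dualWeight_add_nat one_pos hN, mul_zero] at h1
    have h3 : (((2 * Real.pi) ^ 2 : ℝ) : ℂ) ^ (-β) ≠ 0 := by
      rw [h2pi]
      exact mul_ne_zero (mul_ne_zero (inv_ne_zero h4) (inv_ne_zero (hpic _))) (inv_ne_zero (hpic _))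
    have ht := (mul_eq_zero.1 h1.symm).resolve_right (mul_ne_zero h3 (mul_ne_zero
      (div_ne_zero (hpic _) hG2) (mellinSum_dualWeight_neg_nat one_pos hN m)))
    rw [ht, tau, show (J : ℂ) - β + Complex.I * ν = -m by rw [← hm]; ring,
      Complex.Gamma_neg_nat_eq_zero]
    simp
  · push Not at hzero
    set s : ℂ := J - Complex.I * ν + β with hs
    have hs' : (J : ℂ) + Complex.I * ν - β = ((2 * J : ℝ) : ℂ) - s := by rw [hs]; push_cast; ring
    have hsm : ∀ m : ℕ, s ≠ -m := fun m hm => hpole m (by rw [← hm, hs]; ring)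
    rw [hs'] at hzero
    have hε : (0 : ℝ) < 1 / (1 + |s.im|) := by positivity
    have hε1 : 1 / (1 + |s.im|) * |s.im| < 1 := by
      rw [one_div_mul_eq_div, div_lt_one (by positivity)]; linarith
    have h1 := h _ hε
    generalize 1 / (1 + |s.im|) = ε at h1 hε hε1
    have hω1 := qProd_exp_ne_zero hε hε1 hsm
    have hω2 := qProd_exp_ne_zero hε (s := ((2 * J : ℝ) : ℂ) - s) (by simpa using hε1) hzero
    have hG3 : Complex.Gamma (((2 * J : ℝ) : ℂ) - s) ≠ 0 := Complex.Gamma_ne_zero hzero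
    rw [hs', mellinSum_dualWeight hε _ hsm, mellinSum_dualWeight hε _ hzero, sub_sub_cancel,
      h2pi] at h1
    have h5 : (Real.pi : ℂ) ^ (-s) =
        ((Real.pi : ℂ) ^ (J - Complex.I * ν : ℂ))⁻¹ * ((Real.pi : ℂ) ^ β)⁻¹ := by
      rw [hs, neg_add, Complex.cpow_add _ _ hpi, Complex.cpow_neg, Complex.cpow_neg]
    have h6 : (Real.pi : ℂ) ^ (-(((2 * J : ℝ) : ℂ) - s)) =
        ((Real.pi : ℂ) ^ (J + Complex.I * ν : ℂ))⁻¹ * (Real.pi : ℂ) ^ β := by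
      rw [← hs', neg_sub, sub_eq_add_neg, add_comm, Complex.cpow_add _ _ hpi, Complex.cpow_neg]
    rw [h5, h6] at h1
    have e1 : (J : ℂ) + β - Complex.I * ν = s := by rw [hs]; ring
    have e2 : (J : ℂ) - β + Complex.I * ν = ((2 * J : ℝ) : ℂ) - s := by rw [← hs']; ring
    rw [tau, e1, e2]
    have a1 := hpic (J - Complex.I * ν)
    have a2 := hpic (J + Complex.I * ν)
    have a3 := hpic β
    generalize (Real.pi : ℂ) ^ (J - Complex.I * ν : ℂ) = x1 at *
    generalize (Real.pi : ℂ) ^ (J + Complex.I * ν : ℂ) = x2 at *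
    generalize (Real.pi : ℂ) ^ β = x3 at *
    generalize (4 : ℂ) ^ β = x4 at *
    generalize Complex.Gamma (((2 * J : ℝ) : ℂ) - s) = g1 at *
    generalize Complex.Gamma s = g2 at *
    generalize Complex.Gamma (J - Complex.I * ν) = g3 at *
    generalize Complex.Gamma (J + Complex.I * ν) = g4 at *
    generalize qProd (Real.exp (-ε)) (Complex.exp (-(ε * s))) = o1 at *
    generalize qProd (Real.exp (-ε)) (Complex.exp (-(ε * (((2 * J : ℝ) : ℂ) - s)))) = o2 at *
    field_simp at h1 ⊢
    linear_combination -h1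

/-- Γ(z+1) = zΓ(z) in the numerator needs z ≠ 0; in the denominator the identity for 1/Γ holds
everywhere, so the zeros of τ need no separate case. -/
theorem tau_eq_mul_tau_sub_one {J ν : ℝ} {β : ℂ} (h : (J : ℂ) + (β - 1) - Complex.I * ν ≠ 0) :
    tau J ν β = 4 * (J + Complex.I * ν - β) * (J - 1 + β - Complex.I * ν) * tau J ν (β - 1) := by
  have h1 := Complex.Gamma_add_one _ h
  have h2 := Complex.one_div_Gamma_eq_self_mul_one_div_Gamma_add_one (J - β + Complex.I * ν)
  rw [show (J : ℂ) + (β - 1) - Complex.I * ν + 1 = J + β - Complex.I * ν by ring] at h1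
  rw [show (J : ℂ) - β + Complex.I * ν + 1 = J - (β - 1) + Complex.I * ν by ring] at h2
  have h3 : (4 : ℂ) ^ β = 4 * 4 ^ (β - 1) := by
    rw [Complex.cpow_sub _ _ (by norm_num), Complex.cpow_one]; field_simp
  rw [tau, tau, h1, h3, div_eq_mul_inv, div_eq_mul_inv, mul_inv, mul_inv, h2]
  ring

end LadderOperators

end

/-! ### The theorem -/

open LadderOperators in
theorem proposition1 (D : ℕ) (hD : 1 ≤ D) (j ν : ℝ) (hj : 1 / 2 ≤ j) (ψ : State D) (hψ : ψ ≠ 0)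
    (hH : dilatation D ψ = (-2 * Complex.I * (ν : ℂ)) • ψ)
    (hC : casimir D ψ = (4 * (j : ℂ) * ((j : ℂ) - 1)) • ψ) :
    ∃ J : ℝ, (J = j ∨ (D = 1 ∧ J = 1 - j)) ∧
      ∀ β t : ℂ, IsEigen β t ψ →
        (∀ m : ℕ, (J : ℂ) + β - Complex.I * ν ≠ -(m : ℂ)) ∧
        t = tau J ν β ∧
        ∀ t' : ℂ, IsEigen (β - 1) t' ψ →
          t = 4 * (J + Complex.I * ν - β) * (J - 1 + β - Complex.I * ν) * t' := by
  obtain ⟨n, P, h, hP, hP', hne⟩ := exists_harmonic_apply_ne_zero hD hψ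
  have hD' : (1 : ℝ) ≤ D := by exact_mod_cast hD
  have hn' : (0 : ℝ) ≤ n := by positivity
  obtain ⟨J, hJ⟩ : ∃ J : ℝ, 2 * J = n + D / 2 := ⟨(n + D / 2) / 2, by ring⟩
  have hJ0 : 0 < J := by linarith
  have hJc : (2 : ℂ) * J = n + D / 2 := by
    have h1 := congrArg Complex.ofReal hJ
    push_cast at h1
    exact h1
  -- All values on P times a profile are multiples of this one, so it cannot vanish.
  have h0 : ψ (radial P (expS 1 one_pos)) ≠ 0 := by
    intro h0
    apply hne
    rw [apply_radial_eq ψ (apply_euler_of_dilatation hH) hP (κ := J - Complex.I * ν)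
      (by linear_combination hJc) (by simpa using hJ0), h0]
    simp
  have hcas : 4 * J * (J - 1) = 4 * j * (j - 1) := by
    have h1 := congrArg (fun T : State D => T (radial P h)) hC
    simp only [casimir_radial ψ hP hP'] at h1
    change _ = (4 * (j : ℂ) * ((j : ℂ) - 1)) * ψ (radial P h) at h1
    have h2 := mul_right_cancel₀ hne h1
    rw [← hJc] at h2
    have h3 : (4 * J * (J - 1) : ℂ) = 4 * j * (j - 1) := by linear_combination h2
    exact_mod_cast h3
  have hmain : ∀ β t : ℂ, IsEigen β t ψ →
      (∀ m : ℕ, (J : ℂ) + β - Complex.I * ν ≠ -(m : ℂ)) ∧ t = tau J ν β := fun β t hE =>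
    eq_tau_of_mellinSum_eq hJ0 fun ε hε => mellinSum_eq_of_isEigen hH hP hP' hJ hJ0 h0 hE hε
  refine ⟨J, ?_, fun β t hE => ⟨(hmain β t hE).1, (hmain β t hE).2, fun t' hE' => ?_⟩⟩
  -- Equal Casimir eigenvalues give J = j or J = 1 - j. For D ≥ 2 the second case has J ≥ 1/2 and j
  -- ≥ 1/2, hence J = j = 1/2.
  · have h1 : (J - j) * (J - (1 - j)) = 0 := by linear_combination hcas / 4
    rcases mul_eq_zero.1 h1 with h2 | h2
    · exact Or.inl (sub_eq_zero.1 h2)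
    · rcases hD.eq_or_lt with h3 | h3
      · exact Or.inr ⟨h3.symm, sub_eq_zero.1 h2⟩
      · have h4 : (2 : ℝ) ≤ D := by exact_mod_cast h3
        left; linarith
  · rw [(hmain β t hE).2, (hmain _ _ hE').2]
    -- The required nonvanishing is the absence of the pole m = 0 for β - 1.
    exact tau_eq_mul_tau_sub_one (by simpa using (hmain _ _ hE').1 0)
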